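/- Let $n\ge 1$, let $p$ be an odd prime, let $\psi$ be the trivial character $\chi_0$ or the quadratic character $\chi_p$ modulo $p$, and let $k\in\mathbb Z$ with $\psi(-1)=(-1)^k$. Let $\mathfrak H_n$ be the Siegel upper half space and write $g=\begin{pmatrix}A_g&B_g\\C_g&D_g\end{pmatrix}$ in $n\times n$ blocks. For a real symplectic similitude $g$ of size $2n$ with multiplier $\mu(g)>0$ put $g\langle Z\rangle=(A_gZ+B_g)(C_gZ+D_g)^{-1}$, $j(g,Z)=\mu(g)^{-n/2}\det(C_gZ+D_g)$ and $(f|_kg)(Z)=j(g,Z)^{-k}f(g\langle Z\rangle)$. Let $\Gamma=\Gamma_0^n(p)=\{\gamma\in \mathrm{Sp}(n,\mathbb Z): C_\gamma\equiv 0 \bmod p\}$, $P=\{\gamma\in\mathrm{Sp}(n,\mathbb Z): C_\gamma=0\}$, and let $A_k(\Gamma,\psi)$ be the space of all functions $f:\mathfrak H_n\to\mathbb C$ with $f|_k\gamma=\psi(\det D_\gamma)f$ for $\gamma\in\Gamma$. With $\tau_p=\mathrm{diag}(1_n,p1_n)$ define on $A_k(\Gamma,\psi)$ $$U(p)f=p^{nk/2-n(n+1)/2}\sum_{\gamma\in\Gamma\backslash\Gamma\tau_p\Gamma}\psi(\det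 A_\gamma)\,f|_k\gamma .$$ For $0\le r\le n$ let $w_r\in\mathrm{Sp}(n,\mathbb Z)$ have the blocks $A=D=\mathrm{diag}(0_r,1_{n-r})$ and $C=-B=\mathrm{diag}(1_r,0_{n-r})$, and for $\gamma=\eta w_r\kappa$ with $\eta\in P$, $\kappa\in\Gamma$ put $\psi^*(\gamma)=\psi(\det D_\eta)\psi(\det D_\kappa)$. For $Z=X+iY\in\mathfrak H_n$ and $2\,\mathrm{Re}(s)>n+1$ let $$E(w_r;Z,s)=\det(Y)^{s-k/2}\sum_{\gamma\in P\backslash Pw_r\Gamma}\psi^*(\gamma)\,j(\gamma,Z)^{-k}\,|j(\gamma,Z)|^{-2s+k},$$ and let $E(w_r;Z,s)$ also denote the meromorphic continuation of this function to $s\in\mathbb C$. For $0\le i,j\le n$ set $m_\psi(s)_{ij}=0$ if $i>j$. If $i\le j$ and $d=j-i$, set $$m_{\chi_0}(s)_{ij}=\begin{cases}p^{2si-j(j+1)/2+d(d+2)/4}\ \prod_{r=i+1}^{j}(p^r-1)\Big/\prod_{r=1}^{d/2}(p^{2r}-1)& d\text{ even},\\[1ex] p^{2si-j(j+1)/2+(d^2-1)/4}\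 \prod_{r=i+1}^{j}(p^r-1)\Big/\prod_{r=1}^{(d-1)/2}(p^{2r}-1)& d\text{ odd},\end{cases}$$ $$m_{\chi_p}(s)_{ij}=\begin{cases}\chi_p(-1)^{d/2}\,p^{2si-j(j+1)/2+d^2/4}\ \prod_{r=i+1}^{j}(p^r-1)\Big/\prod_{r=1}^{d/2}(p^{2r}-1)& d\text{ even},\\ 0& d\text{ odd}.\end{cases}$$ Define $b_\psi(s)_{ij}$ recursively by $b_\psi(s)_{ij}=0$ for $i>j$, $b_\psi(s)_{ii}=1$, and for $i<j$ $$b_\psi(s)_{ij}=-\frac{p^{-2si+i(i+1)/2}}{p^{(j-i)(2s-(j+i+1)/2)}-1}\sum_{r=i}^{j-1}m_\psi(s)_{rj}\,b_\psi(s)_{ir}.$$ Then for every $0\le i\le n$ the Eisenstein series $$E^{n,(i)}_{k,\psi}(Z,s)=E(w_i;Z,s)+\sum_{j=i+1}^{n}b_\psi(s)_{ij}\,E(w_j;Z,s)$$ is an eigenfunction of $U(p)$ with eigenvalue $\lambda_i(s)=p^{\,n(k/2-s)+2si-i(i+1)/2}$. Precisely: 1. If $2\,\mathrm{Re}(s)>n+1$,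 the series $E(w_j;Z,s)$ $(0\le j\le n)$ converge absolutely, $E^{n,(i)}_{k,\psi}(\cdot,s)$ is a nonzero element of $A_k(\Gamma,\psi)$, and $U(p)E^{n,(i)}_{k,\psi}(\cdot,s)=\lambda_i(s)E^{n,(i)}_{k,\psi}(\cdot,s)$. 2. If $s\in\mathbb C$ is such that for all $i\le j\le n$ and all $Z$ the function $E(w_j;Z,\cdot)$ is holomorphic at $s$, and $p^{(j-i)(2s-(j+i+1)/2)}\ne1$ for $i<j\le n$, then $E^{n,(i)}_{k,\psi}(\cdot,s)\in A_k(\Gamma,\psi)$ and $U(p)E^{n,(i)}_{k,\psi}(\cdot,s)=\lambda_i(s)E^{n,(i)}_{k,\psi}(\cdot,s)$. 3. For every $Z\in\mathfrak H_n$, the equality $(U(p)E^{n,(i)}_{k,\psi})(Z,s)=\lambda_i(s)E^{n,(i)}_{k,\psi}(Z,s)$ holds as an identity of meromorphic functions of $s\in\mathbb C$, that is, for all $s$ outside a closed discrete set. -/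

import Mathlib

open Matrix
open scoped ComplexConjugate

noncomputable section

namespace SiegelEis

/-- Index type of the rows of a `2n × 2n` matrix in `n × n` blocks. -/
abbrev Idx (n : ℕ) : Type := Fin n ⊕ Fin n

/-- The Siegel upper half space of degree `n`. -/
structure HalfSpace (n : ℕ) where
  val : Matrix (Fin n) (Fin n) ℂ
  property : valᵀ = val ∧ (val.map Complex.im).PosDef

namespace HalfSpace

/-- The imaginary part `Y` of `Z = X + iY`. -/
def imag {n : ℕ} (Z : HalfSpace n) : Matrix (Fin n) (Fin n) ℝ := Z.1.map Complex.im

end HalfSpace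

/-- The group `GSp⁺(n, ℝ)` of real symplectic similitudes `g` with multiplier `μ(g) > 0`.
For `n ≥ 1` the multiplier is determined by the matrix. -/
structure GSpPos (n : ℕ) where
  mat : Matrix (Idx n) (Idx n) ℝ
  mu : ℝ
  mu_pos : 0 < mu
  sim : matᵀ * Matrix.J (Fin n) ℝ * mat = mu • Matrix.J (Fin n) ℝ

namespace GSpPos

variable {n : ℕ}

/-- The blocks `A, B, C, D` of `g`, as complex matrices. -/
def A (g : GSpPos n) : Matrix (Fin n) (Fin n) ℂ := g.mat.toBlocks₁₁.map Complex.ofReal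
/-- The upper right block. -/
def B (g : GSpPos n) : Matrix (Fin n) (Fin n) ℂ := g.mat.toBlocks₁₂.map Complex.ofReal
/-- The lower left block. -/
def C (g : GSpPos n) : Matrix (Fin n) (Fin n) ℂ := g.mat.toBlocks₂₁.map Complex.ofReal
/-- The lower right block. -/
def D (g : GSpPos n) : Matrix (Fin n) (Fin n) ℂ := g.mat.toBlocks₂₂.map Complex.ofReal

/-- The numerator `AZ + B`. -/
def num (g : GSpPos n) (Z : Matrix (Fin n) (Fin n) ℂ) : Matrix (Fin n) (Fin n) ℂ := g.A * Z + g.B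
/-- The denominator `CZ + D`. -/
def den (g : GSpPos n) (Z : Matrix (Fin n) (Fin n) ℂ) : Matrix (Fin n) (Fin n) ℂ := g.C * Z + g.D

end GSpPos

section Action

variable {n : ℕ}

theorem GSpPos.block_rel (g : GSpPos n) :
    g.Aᵀ * g.C = g.Cᵀ * g.A ∧ g.Bᵀ * g.D = g.Dᵀ * g.B ∧
      g.Aᵀ * g.D - g.Cᵀ * g.B = (g.mu : ℂ) • 1 ∧ g.Dᵀ * g.A - g.Bᵀ * g.C = (g.mu : ℂ) • 1 := by
  have h := g.sim
  rw [← fromBlocks_toBlocks g.mat] at h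
  simp only [J, fromBlocks_transpose, fromBlocks_multiply, fromBlocks_smul, fromBlocks_inj,
    mul_zero, mul_one, zero_add, add_zero, mul_neg, neg_mul, smul_zero, smul_neg] at h
  obtain ⟨h1, h2, h3, h4⟩ := h
  have key : ∀ {P Q : Matrix (Fin n) (Fin n) ℝ}, P = Q →
      P.map Complex.ofRealHom = Q.map Complex.ofRealHom := fun h => by rw [h]
  have e1 := key h1
  have e2 := key h2
  have e3 := key h3
  have e4 := key h4
  have hmu : (g.mu • (1 : Matrix (Fin n) (Fin n) ℝ)).map Complex.ofRealHom = (g.mu : ℂ) • 1 := by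
    ext a b
    by_cases hab : a = b <;> simp [hab]
  have hadd : ∀ P Q : Matrix (Fin n) (Fin n) ℝ, (P + Q).map Complex.ofRealHom =
      P.map Complex.ofRealHom + Q.map Complex.ofRealHom := fun P Q => by ext; simp
  have hneg : ∀ P : Matrix (Fin n) (Fin n) ℝ, (-P).map Complex.ofRealHom =
      -P.map Complex.ofRealHom := fun P => by ext; simp
  have hz : (0 : Matrix (Fin n) (Fin n) ℝ).map Complex.ofRealHom = 0 := by ext; simp
  simp only [hadd, hneg, Matrix.map_mul, transpose_map, hmu, hz] at e1 e2 e3 e4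
  change g.Cᵀ * g.A + -(g.Aᵀ * g.C) = 0 at e1
  change g.Cᵀ * g.B + -(g.Aᵀ * g.D) = _ at e2
  change g.Dᵀ * g.A + -(g.Bᵀ * g.C) = _ at e3
  change g.Dᵀ * g.B + -(g.Bᵀ * g.D) = 0 at e4
  refine ⟨?_, ?_, ?_, ?_⟩
  · rw [← sub_eq_add_neg, sub_eq_zero] at e1; exact e1.symm
  · rw [← sub_eq_add_neg, sub_eq_zero] at e4; exact e4.symm
  · rw [← neg_inj, ← e2]; abel
  · rw [← e3]; abel

theorem GSpPos.num_den_rel (g : GSpPos n) (W Z : Matrix (Fin n) (Fin n) ℂ) :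
    (g.den W)ᵀ * g.num Z - (g.num W)ᵀ * g.den Z = (g.mu : ℂ) • (Z - Wᵀ) := by
  obtain ⟨h1, h2, h3, h4⟩ := g.block_rel
  have e : (g.den W)ᵀ * g.num Z - (g.num W)ᵀ * g.den Z =
      Wᵀ * (g.Cᵀ * g.A - g.Aᵀ * g.C) * Z - Wᵀ * (g.Aᵀ * g.D - g.Cᵀ * g.B)
        + (g.Dᵀ * g.A - g.Bᵀ * g.C) * Z + (g.Dᵀ * g.B - g.Bᵀ * g.D) := by
    simp only [GSpPos.den, GSpPos.num, transpose_add, transpose_mul]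
    noncomm_ring
  rw [e, h1, h2, h3, h4]
  simp [smul_sub]
  abel

/-- A real positive definite matrix is positive definite as a complex matrix. -/
theorem posDef_complex {Y : Matrix (Fin n) (Fin n) ℝ} (hY : Y.PosDef) {v : Fin n → ℂ}
    (hv : v ≠ 0) :
    ∃ t : ℝ, 0 < t ∧ star v ⬝ᵥ (Y.map Complex.ofReal *ᵥ v) = (t : ℂ) := by
  have hs : ∀ a b, Y a b = Y b a := fun a b => by
    have := congrFun (congrFun hY.1 a) b
    simpa using this.symm
  set x : Fin n → ℝ := fun a => (v a).re with hx
  set y : Fin n → ℝ := fun a => (v a).im with hy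
  refine ⟨x ⬝ᵥ (Y *ᵥ x) + y ⬝ᵥ (Y *ᵥ y), ?_, ?_⟩
  · have nonneg : ∀ u : Fin n → ℝ, 0 ≤ u ⬝ᵥ (Y *ᵥ u) := fun u => by
      simpa using hY.posSemidef.dotProduct_mulVec_nonneg u
    have hpos : ∀ u : Fin n → ℝ, u ≠ 0 → 0 < u ⬝ᵥ (Y *ᵥ u) := fun u hu => by
      simpa using hY.dotProduct_mulVec_pos hu
    by_cases h0 : x = 0
    · have : y ≠ 0 := by
        intro h1
        apply hv
        ext a
        exact Complex.ext (congrFun h0 a) (congrFun h1 a)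
      linarith [nonneg x, hpos y this]
    · linarith [nonneg y, hpos x h0]
  · have e1 : star v ⬝ᵥ (Y.map Complex.ofReal *ᵥ v) =
        ∑ a, ∑ b, ((Y a b : ℂ) * (conj (v a) * v b)) := by
      simp only [dotProduct, mulVec, Finset.mul_sum, Pi.star_apply, map_apply]
      refine Finset.sum_congr rfl fun a _ => Finset.sum_congr rfl fun b _ => ?_
      simp only [RCLike.star_def]
      ring
    have e2 : x ⬝ᵥ (Y *ᵥ x) + y ⬝ᵥ (Y *ᵥ y) =
        ∑ a, ∑ b, (Y a b * (x a * x b + y a * y b)) := by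
      simp only [dotProduct, mulVec, Finset.mul_sum, ← Finset.sum_add_distrib]
      refine Finset.sum_congr rfl fun a _ => Finset.sum_congr rfl fun b _ => ?_
      ring
    rw [e1, e2]
    apply Complex.ext
    · simp only [Complex.re_sum, Complex.ofReal_re]
      refine Finset.sum_congr rfl fun a _ => Finset.sum_congr rfl fun b _ => ?_
      simp [hx, hy]
    · simp only [Complex.im_sum, Complex.ofReal_im]
      have e3 : ∀ a b, ((Y a b : ℂ) * (conj (v a) * v b)).im =
          Y a b * (x a * y b) - Y a b * (y a * x b) := fun a b => by
        simp [hx, hy]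
        ring
      simp only [e3, Finset.sum_sub_distrib]
      rw [sub_eq_zero, Finset.sum_comm]
      refine Finset.sum_congr rfl fun a _ => Finset.sum_congr rfl fun b _ => ?_
      rw [hs]
      ring

theorem HalfSpace.sub_conj (Z : HalfSpace n) :
    Z.1 - (Z.1.map conj)ᵀ = (2 * Complex.I) • Z.imag.map Complex.ofReal := by
  have : (Z.1.map conj)ᵀ = Z.1.map conj := by rw [← transpose_map, Z.2.1]
  rw [this]
  ext a b
  simp [HalfSpace.imag, Complex.sub_conj]
  ring

theorem GSpPos.conj_den (g : GSpPos n) (Z : Matrix (Fin n) (Fin n) ℂ) :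
    (g.den (Z.map conj))ᵀ = (g.den Z)ᴴ := by
  ext a b
  simp [GSpPos.den, GSpPos.C, GSpPos.D, Matrix.mul_apply]

theorem GSpPos.conj_num (g : GSpPos n) (Z : Matrix (Fin n) (Fin n) ℂ) :
    (g.num (Z.map conj))ᵀ = (g.num Z)ᴴ := by
  ext a b
  simp [GSpPos.num, GSpPos.A, GSpPos.B, Matrix.mul_apply]

theorem GSpPos.herm_rel (g : GSpPos n) (Z : HalfSpace n) :
    (g.den Z.1)ᴴ * g.num Z.1 - (g.num Z.1)ᴴ * g.den Z.1 =
      (g.mu * (2 * Complex.I)) • Z.imag.map Complex.ofReal := by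
  have := g.num_den_rel (Z.1.map conj) Z.1
  rw [g.conj_den, g.conj_num, Z.sub_conj, smul_smul] at this
  exact this

theorem GSpPos.isUnit_den (g : GSpPos n) (Z : HalfSpace n) : IsUnit (g.den Z.1) := by
  rw [← Matrix.mulVec_injective_iff_isUnit, ← Matrix.coe_mulVecLin, ← LinearMap.ker_eq_bot,
    LinearMap.ker_eq_bot']
  intro v hv
  by_contra hne
  obtain ⟨t, ht, h⟩ := posDef_complex Z.2.2 hne
  rw [Matrix.mulVecLin_apply] at hv
  have h2 := congrArg (fun M => star v ⬝ᵥ (M *ᵥ v)) (g.herm_rel Z)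
  simp only [sub_mulVec, ← mulVec_mulVec, hv, mulVec_zero, sub_zero, smul_mulVec,
    dotProduct_smul] at h2
  rw [dotProduct_mulVec, ← star_mulVec, hv, star_zero, zero_dotProduct] at h2
  change 0 = _ • (star v ⬝ᵥ ((Z.1.map Complex.im).map Complex.ofReal *ᵥ v)) at h2
  rw [h] at h2
  have hm := g.mu_pos
  have : (g.mu : ℂ) ≠ 0 := by exact_mod_cast hm.ne'
  have ht' : (t : ℂ) ≠ 0 := by exact_mod_cast ht.ne'
  simp [this, ht'] at h2

theorem GSpPos.smul_mem (g : GSpPos n) (Z : HalfSpace n) :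
    (g.num Z.1 * (g.den Z.1)⁻¹)ᵀ = g.num Z.1 * (g.den Z.1)⁻¹ ∧
      ((g.num Z.1 * (g.den Z.1)⁻¹).map Complex.im).PosDef := by
  have hu := (Matrix.isUnit_iff_isUnit_det _).1 (g.isUnit_den Z)
  set N := g.num Z.1 with hN
  set M := g.den Z.1 with hM
  have hMi : M * M⁻¹ = 1 := mul_nonsing_inv M hu
  have hsymm : (N * M⁻¹)ᵀ = N * M⁻¹ := by
    have h := g.num_den_rel Z.1 Z.1
    rw [Z.2.1, sub_self, smul_zero, sub_eq_zero, ← hN, ← hM] at h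
    have hMt : (M⁻¹)ᵀ * Mᵀ = 1 := by rw [← transpose_mul, hMi, transpose_one]
    calc (N * M⁻¹)ᵀ = (M⁻¹)ᵀ * (Nᵀ * M) * M⁻¹ := by
          rw [transpose_mul, Matrix.mul_assoc, Matrix.mul_assoc, hMi, Matrix.mul_one]
      _ = (M⁻¹)ᵀ * Mᵀ * (N * M⁻¹) := by rw [← h]; simp only [Matrix.mul_assoc]
      _ = N * M⁻¹ := by rw [hMt, Matrix.one_mul]
  refine ⟨hsymm, ?_⟩
  set X := N * M⁻¹ with hX
  have hXh : Xᴴ = X.map conj := by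
    rw [conjTranspose, hsymm]
    rfl
  have him : X - Xᴴ = (2 * Complex.I) • (X.map Complex.im).map Complex.ofReal := by
    rw [hXh]
    ext a b
    simp [Complex.sub_conj]
    ring
  have hMh : (M⁻¹)ᴴ * Mᴴ = 1 := by rw [← conjTranspose_mul, hMi, conjTranspose_one]
  have hrel : X - Xᴴ = (g.mu * (2 * Complex.I)) •
      ((M⁻¹)ᴴ * Z.imag.map Complex.ofReal * M⁻¹) := by
    have h := congrArg (fun T => (M⁻¹)ᴴ * T * M⁻¹) (g.herm_rel Z)
    simp only [← hN, ← hM, Matrix.mul_sub, Matrix.sub_mul, Matrix.mul_smul,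
      Matrix.smul_mul] at h
    rw [← h, hX, conjTranspose_mul]
    congr 1
    · rw [← Matrix.mul_assoc, hMh, Matrix.one_mul]
    · rw [Matrix.mul_assoc, Matrix.mul_assoc, hMi, Matrix.mul_one]
  have hfin : (X.map Complex.im).map Complex.ofReal =
      (g.mu : ℂ) • ((M⁻¹)ᴴ * Z.imag.map Complex.ofReal * M⁻¹) := by
    have h2 : (2 * Complex.I) ≠ 0 := by simp
    have h := him.symm.trans hrel
    rw [mul_comm (g.mu : ℂ), mul_smul (2 * Complex.I)] at h
    exact smul_right_injective _ h2 h
  refine PosDef.of_dotProduct_mulVec_pos ?_ ?_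
  · ext a b
    have := congrFun (congrFun hsymm a) b
    simp only [transpose_apply] at this
    simp [this]
  · intro x hx
    set v : Fin n → ℂ := fun a => (x a : ℂ) with hv
    have hvne : v ≠ 0 := fun h => hx (by
      ext a
      have := congrFun h a
      simpa [hv] using this)
    have hwne : M⁻¹ *ᵥ v ≠ 0 := fun h => hvne (by
      have := congrArg (fun w => M *ᵥ w) h
      simpa [mulVec_mulVec, hMi] using this)
    obtain ⟨t, ht, h⟩ := posDef_complex Z.2.2 hwne
    have e1 : star v ⬝ᵥ ((X.map Complex.im).map Complex.ofReal *ᵥ v) =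
        ((star x ⬝ᵥ (X.map Complex.im *ᵥ x) : ℝ) : ℂ) := by
      simp [dotProduct, mulVec, hv]
    have e2 : star v ⬝ᵥ ((X.map Complex.im).map Complex.ofReal *ᵥ v) = (g.mu : ℂ) * t := by
      rw [hfin, smul_mulVec, dotProduct_smul, smul_eq_mul, ← h, ← mulVec_mulVec, ← mulVec_mulVec,
        dotProduct_mulVec, ← star_mulVec]
      rfl
    have e3 := e1.symm.trans e2
    have : star x ⬝ᵥ (X.map Complex.im *ᵥ x) = g.mu * t := by exact_mod_cast e3
    rw [this]
    exact mul_pos g.mu_pos ht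

/-- The action `g⟨Z⟩ = (AZ + B)(CZ + D)⁻¹` of `GSp⁺(n, ℝ)` on the Siegel upper half space. -/
def act (g : GSpPos n) (Z : HalfSpace n) : HalfSpace n :=
  ⟨g.num Z.1 * (g.den Z.1)⁻¹, g.smul_mem Z⟩

/-- The automorphy factor `j(g, Z) = μ(g)^{-n/2} det(CZ + D)`. -/
def autFactor (g : GSpPos n) (Z : HalfSpace n) : ℂ :=
  ((g.mu ^ (-(n : ℝ) / 2) : ℝ) : ℂ) * (g.den Z.1).det

/-- The slash operator `(f|_k g)(Z) = j(g, Z)^{-k} f(g⟨Z⟩)`. -/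
def slash (k : ℤ) (f : HalfSpace n → ℂ) (g : GSpPos n) : HalfSpace n → ℂ :=
  fun Z => autFactor g Z ^ (-k) * f (act g Z)

end Action

/-- `Sp(n, ℤ)`. -/
abbrev SpZ (n : ℕ) : Type := Matrix.symplecticGroup (Fin n) ℤ

/-- The inclusion of integral similitudes with positive multiplier `m` in `GSp⁺(n, ℝ)`. -/
def ofInt {n : ℕ} (M : Matrix (Idx n) (Idx n) ℤ) (m : ℤ) (hm : 0 < m)
    (h : Mᵀ * Matrix.J (Fin n) ℤ * M = m • Matrix.J (Fin n) ℤ) : GSpPos n where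
  mat := M.map (Int.castRingHom ℝ)
  mu := m
  mu_pos := by exact_mod_cast hm
  sim := by
    rw [← Matrix.map_J (Fin n) (Int.castRingHom ℝ), ← transpose_map, ← Matrix.map_mul, ← Matrix.map_mul, h]
    ext a b
    simp [-zsmul_eq_mul]

/-- The inclusion of `Sp(n, ℤ)` in `GSp⁺(n, ℝ)`. -/
def SpZ.toGSp {n : ℕ} (g : SpZ n) : GSpPos n :=
  ofInt g.1 1 one_pos (by rw [one_smul]; exact SymplecticGroup.mem_iff'.1 g.2)

/-- The subgroup of `Sp(n, ℤ)` of the matrices with `C ≡ 0 mod N`. For a prime `N = p` this is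
`Γ₀ⁿ(p)`, and for `N = 0` it is the group of matrices with `C = 0`. -/
def lowerCongr (n N : ℕ) : Subgroup (SpZ n) where
  carrier := {g | ∀ a b, (N : ℤ) ∣ g.1.toBlocks₂₁ a b}
  one_mem' := by
    intro a b
    simp [toBlocks₂₁]
  mul_mem' := by
    intro g h hg hh a b
    simp only [Set.mem_ofPred_eq, toBlocks₂₁, of_apply] at hg hh ⊢
    rw [Submonoid.coe_mul, Matrix.mul_apply, Fintype.sum_sum_type]
    exact dvd_add (Finset.dvd_sum fun c _ => Dvd.dvd.mul_right (hg a c) _)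
      (Finset.dvd_sum fun c _ => Dvd.dvd.mul_left (hh c b) _)
  inv_mem' := by
    intro g hg a b
    simp only [Set.mem_ofPred_eq] at hg ⊢
    have e : (g⁻¹ : SpZ n).1.toBlocks₂₁ = -(g.1.toBlocks₂₁)ᵀ := by
      have h : ((g⁻¹ : SpZ n).1) = _ := SymplecticGroup.coe_inv g
      rw [h, ← fromBlocks_toBlocks g.1]
      simp [J, fromBlocks_transpose, fromBlocks_multiply, fromBlocks_neg]
    rw [e]
    simpa using hg b a

/-- The congruence subgroup `Γ₀ⁿ(p)`. -/
def Gamma0 (n p : ℕ) : Subgroup (SpZ n) := lowerCongr n p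

/-- The Siegel parabolic subgroup `P_{0,n}(ℤ)` of `Sp(n, ℤ)`, consisting of the matrices with
`C = 0` (for which automatically `D = ᵗA⁻¹`). -/
def parabolic (n : ℕ) : Subgroup (SpZ n) := lowerCongr n 0

theorem mem_parabolic {n : ℕ} (g : SpZ n) : g ∈ parabolic n ↔ g.1.toBlocks₂₁ = 0 := by
  change (∀ a b, ((0 : ℕ) : ℤ) ∣ g.1.toBlocks₂₁ a b) ↔ _
  simp [← Matrix.ext_iff]

/-- `diag(1, …, 1, 0, …, 0)` with `r` ones. -/
def diagHead (n r : ℕ) : Matrix (Fin n) (Fin n) ℤ :=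
  Matrix.diagonal fun a => if (a : ℕ) < r then 1 else 0

/-- `diag(0, …, 0, 1, …, 1)` with `r` zeros. -/
def diagTail (n r : ℕ) : Matrix (Fin n) (Fin n) ℤ :=
  Matrix.diagonal fun a => if (a : ℕ) < r then 0 else 1

/-- The cusp representative `w_r`, `0 ≤ r ≤ n`. -/
def w (n r : ℕ) : SpZ n :=
  ⟨fromBlocks (diagTail n r) (-diagHead n r) (diagHead n r) (diagTail n r), by
    rw [SymplecticGroup.fromBlocks_mem_iff]
    refine ⟨?_, ?_, ?_⟩
    · simp only [diagTail, diagHead, diagonal_transpose, diagonal_mul_diagonal, mul_comm]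
    · simp only [diagTail, diagHead, diagonal_transpose, diagonal_mul_diagonal, Matrix.mul_neg,
        Matrix.neg_mul, transpose_neg, mul_comm]
    · simp only [diagTail, diagHead, diagonal_transpose, diagonal_mul_diagonal, Matrix.mul_neg,
        sub_neg_eq_add, diagonal_add, ← diagonal_one]
      congr 1
      ext a
      split_ifs <;> simp⟩

section Level

variable (n p : ℕ)

/-- `ψ(det D_γ)` for `γ ∈ Sp(n, ℤ)`. -/
def charD {n p : ℕ} (ψ : DirichletCharacter ℂ p) (g : SpZ n) : ℂ :=
  ψ ((g.1.toBlocks₂₂.det : ℤ) : ZMod p)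

/-- The space `A_k(Γ₀ⁿ(p), ψ)` of all functions `f` on the Siegel upper half space with
`f|_k γ = ψ(det D_γ) f` for `γ ∈ Γ₀ⁿ(p)`. -/
def autForms (k : ℤ) (ψ : DirichletCharacter ℂ p) : Submodule ℂ (HalfSpace n → ℂ) where
  carrier := {f | ∀ g ∈ Gamma0 n p, slash k f g.toGSp = charD ψ g • f}
  zero_mem' := by
    intro g _
    funext Z
    simp [slash]
  add_mem' := by
    intro f f' hf hf' g hg
    have h1 := hf g hg
    have h2 := hf' g hg
    rw [smul_add, ← h1, ← h2]
    funext Z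
    simp [slash, mul_add]
  smul_mem' := by
    intro c f hf g hg
    have h1 := hf g hg
    rw [smul_comm, ← h1]
    funext Z
    simp only [slash, Pi.smul_apply, smul_eq_mul]
    ring

/-- `τ_p = diag(1_n, p 1_n)`. -/
def tau : Matrix (Idx n) (Idx n) ℤ := fromBlocks 1 0 0 ((p : ℤ) • 1)

/-- The double coset `Γ₀ⁿ(p) τ_p Γ₀ⁿ(p)`. -/
def heckeSet : Set (Matrix (Idx n) (Idx n) ℤ) :=
  {M | ∃ α ∈ Gamma0 n p, ∃ β ∈ Gamma0 n p, M = α.1 * tau n p * β.1}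

theorem heckeSet_sim {M : Matrix (Idx n) (Idx n) ℤ} (hM : M ∈ heckeSet n p) :
    Mᵀ * Matrix.J (Fin n) ℤ * M = (p : ℤ) • Matrix.J (Fin n) ℤ := by
  obtain ⟨α, -, β, -, rfl⟩ := hM
  have hα := SymplecticGroup.mem_iff'.1 α.2
  have hβ := SymplecticGroup.mem_iff'.1 β.2
  have ht : (tau n p)ᵀ * Matrix.J (Fin n) ℤ * tau n p = (p : ℤ) • Matrix.J (Fin n) ℤ := by
    simp [tau, J, fromBlocks_transpose, fromBlocks_multiply, fromBlocks_smul]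
  calc (α.1 * tau n p * β.1)ᵀ * J (Fin n) ℤ * (α.1 * tau n p * β.1)
      = β.1ᵀ * ((tau n p)ᵀ * (α.1ᵀ * J (Fin n) ℤ * α.1) * tau n p) * β.1 := by
        simp only [transpose_mul, Matrix.mul_assoc]
    _ = (p : ℤ) • J (Fin n) ℤ := by
        rw [hα, ht, Matrix.mul_smul, Matrix.smul_mul, hβ]

/-- Left equivalence under `Γ₀ⁿ(p)` on the double coset `Γ₀ⁿ(p) τ_p Γ₀ⁿ(p)`. -/
def heckeSetoid : Setoid (heckeSet n p) where
  r M M' := ∃ δ ∈ Gamma0 n p, M'.1 = δ.1 * M.1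
  iseqv :=
    { refl := fun M => ⟨1, one_mem _, by simp⟩
      symm := by
        rintro M M' ⟨δ, hδ, h⟩
        refine ⟨δ⁻¹, inv_mem hδ, ?_⟩
        rw [h, ← Matrix.mul_assoc, ← Submonoid.coe_mul, inv_mul_cancel]
        simp
      trans := by
        rintro M M' M'' ⟨δ, hδ, h⟩ ⟨ε, hε, h'⟩
        refine ⟨ε * δ, mul_mem hε hδ, ?_⟩
        rw [h', h, Submonoid.coe_mul, Matrix.mul_assoc] }

/-- The operator
`(U(p)f)(Z) = p^{nk/2 - n(n+1)/2} ∑_γ ψ(det A_γ) (f|_k γ)(Z)`,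
where `γ` runs through a set of representatives of the (finitely many) cosets
`Γ₀ⁿ(p) \ Γ₀ⁿ(p) τ_p Γ₀ⁿ(p)`. For `f` in `A_k(Γ₀ⁿ(p), ψ)` the summand depends only on the coset. -/
def Up [Fact p.Prime] (k : ℤ) (ψ : DirichletCharacter ℂ p) (f : HalfSpace n → ℂ) :
    HalfSpace n → ℂ := fun Z =>
  (p : ℂ) ^ ((n : ℂ) * k / 2 - (n : ℂ) * (n + 1) / 2) *
    ∑ᶠ q : Quotient (heckeSetoid n p),
      ψ ((q.out.1.toBlocks₁₁.det : ℤ) : ZMod p) *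
        slash k f
          (ofInt q.out.1 p (by exact_mod_cast (Fact.out : p.Prime).pos)
            (heckeSet_sim n p q.out.2)) Z

/-- The set `P_{0,n}(ℤ) w_r Γ₀ⁿ(p)`. -/
def cell (r : ℕ) : Set (SpZ n) := DoubleCoset.doubleCoset (w n r) (parabolic n) (Gamma0 n p)

open Classical in
/-- The function `ψ*(η w_r κ) = ψ(det D_η) ψ(det D_κ)` on `P_{0,n}(ℤ) w_r Γ₀ⁿ(p)`, extended by `0`.
For `ψ² = 1` the value does not depend on the chosen decomposition. -/
def psiStar (ψ : DirichletCharacter ℂ p) (r : ℕ) (g : SpZ n) : ℂ :=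
  if h : ∃ x : SpZ n × SpZ n, x.1 ∈ parabolic n ∧ x.2 ∈ Gamma0 n p ∧ g = x.1 * w n r * x.2 then
    charD ψ h.choose.1 * charD ψ h.choose.2
  else 0

/-- The index set `P_{0,n}(ℤ) \ P_{0,n}(ℤ) w_r Γ₀ⁿ(p)`, as a set of cosets in
`P_{0,n}(ℤ) \ Sp(n, ℤ)`. -/
def cellCosets (r : ℕ) : Set (Quotient (QuotientGroup.rightRel (parabolic n))) :=
  (fun g => Quotient.mk _ g) '' cell n p r

/-- The summand `ψ*(γ) j(γ, Z)^{-k} |j(γ, Z)|^{-2s+k}` of the Eisenstein series. -/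
def eisTerm (ψ : DirichletCharacter ℂ p) (k : ℤ) (r : ℕ) (Z : HalfSpace n) (s : ℂ) (g : SpZ n) :
    ℂ :=
  psiStar n p ψ r g * autFactor g.toGSp Z ^ (-k) *
    ((‖autFactor g.toGSp Z‖ : ℝ) : ℂ) ^ (-2 * s + k)

/-- The Siegel Eisenstein series
`det(Y)^{s-k/2} ∑_γ ψ*(γ) j(γ, Z)^{-k} |j(γ, Z)|^{-2s+k}`, `γ ∈ P_{0,n}(ℤ) \ P_{0,n}(ℤ) w_r Γ₀ⁿ(p)`,
given by the series itself. If `ψ(-1) = (-1)^k`, the summand depends only on the coset of `γ`. -/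
def eisSeries (ψ : DirichletCharacter ℂ p) (k : ℤ) (r : ℕ) (Z : HalfSpace n) (s : ℂ) : ℂ :=
  ((Z.imag.det : ℝ) : ℂ) ^ (s - k / 2) *
    ∑' q : cellCosets n p r, eisTerm n p ψ k r Z s q.1.out

open Classical in
/-- The Siegel Eisenstein series `E^n_{k,ψ}(w_r; Z, s)` for all `s`: the series for
`2 Re(s) > n + 1`, and elsewhere the value at `s` of its meromorphic continuation in `s` (with the
value `0` at a pole). The second alternative of the inner conditional serves only to make the
definition independent of the theorem that the continuation exists. -/
def eisenstein (ψ : DirichletCharacter ℂ p) (k : ℤ) (r : ℕ) (Z : HalfSpace n) (s : ℂ) : ℂ :=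
  if (n : ℝ) + 1 < 2 * s.re then eisSeries n p ψ k r Z s
  else if h : ∃ F : ℕ → HalfSpace n → ℂ → ℂ, ∀ j ≤ n, ∀ W, Meromorphic (F j W) ∧
      ∀ t : ℂ, (n : ℝ) + 1 < 2 * t.re → F j W t = eisSeries n p ψ k j W t then
    toMeromorphicNFOn (h.choose r Z) Set.univ s
  else 0

end Level

section Coefficients

variable (p : ℕ) [Fact p.Prime]

/-- The quadratic character `χ_p` modulo `p`. -/
def quadChar : DirichletCharacter ℂ p :=
  (quadraticChar (ZMod p)).ringHomComp (Int.castRingHom ℂ)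

/-- The coefficient `m_{χ₀}(s)_{ij}`. -/
def mTriv (s : ℂ) (i j : ℕ) : ℂ :=
  if i ≤ j then
    if Even (j - i) then
      (p : ℂ) ^ (2 * s * i - (j : ℂ) * (j + 1) / 2 + ((j : ℂ) - i) * ((j : ℂ) - i + 2) / 4) *
        ((∏ r ∈ Finset.Icc (i + 1) j, ((p : ℂ) ^ r - 1)) /
          ∏ r ∈ Finset.Icc 1 ((j - i) / 2), ((p : ℂ) ^ (2 * r) - 1))
    else
      (p : ℂ) ^ (2 * s * i - (j : ℂ) * (j + 1) / 2 + (((j : ℂ) - i) ^ 2 - 1) / 4) *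
        ((∏ r ∈ Finset.Icc (i + 1) j, ((p : ℂ) ^ r - 1)) /
          ∏ r ∈ Finset.Icc 1 ((j - i - 1) / 2), ((p : ℂ) ^ (2 * r) - 1))
  else 0

/-- The coefficient `m_{χ_p}(s)_{ij}`. -/
def mQuad (s : ℂ) (i j : ℕ) : ℂ :=
  if i ≤ j ∧ Even (j - i) then
    quadChar p (-1) ^ ((j - i) / 2) *
      (p : ℂ) ^ (2 * s * i - (j : ℂ) * (j + 1) / 2 + ((j : ℂ) - i) ^ 2 / 4) *
        ((∏ r ∈ Finset.Icc (i + 1) j, ((p : ℂ) ^ r - 1)) /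
          ∏ r ∈ Finset.Icc 1 ((j - i) / 2), ((p : ℂ) ^ (2 * r) - 1))
  else 0

open Classical in
/-- The coefficient `m_ψ(s)_{ij}` for `ψ = χ₀` or `ψ = χ_p`. -/
def mCoeff (ψ : DirichletCharacter ℂ p) (s : ℂ) (i j : ℕ) : ℂ :=
  if ψ = 1 then mTriv p s i j else mQuad p s i j

/-- The coefficient `b_ψ(s)_{ij}`, defined by recursion on `j`. -/
def bCoeff (ψ : DirichletCharacter ℂ p) (s : ℂ) (i : ℕ) (j : ℕ) : ℂ :=
  if j < i then 0
  else if j = i then 1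
  else
    -((p : ℂ) ^ (-2 * s * i + (i : ℂ) * (i + 1) / 2) /
        ((p : ℂ) ^ (((j : ℂ) - i) * (2 * s - ((j : ℂ) + i + 1) / 2)) - 1)) *
      ∑ r ∈ (Finset.Ico i j).attach, mCoeff p ψ s r.1 j * bCoeff ψ s i r.1
termination_by j
decreasing_by exact (Finset.mem_Ico.1 r.2).2

/-- The Eisenstein series
`E^{n,(i)}_{k,ψ}(Z, s) = E(w_i; Z, s) + ∑_{j=i+1}^n b_ψ(s)_{ij} E(w_j; Z, s)`. -/
def eigenEis (n : ℕ) (ψ : DirichletCharacter ℂ p) (k : ℤ) (i : ℕ) (s : ℂ) : HalfSpace n → ℂ :=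
  fun Z => eisenstein n p ψ k i Z s +
    ∑ j ∈ Finset.Icc (i + 1) n, bCoeff p ψ s i j * eisenstein n p ψ k j Z s

/-- The eigenvalue `p^{n(k/2 - s) + 2si - i(i+1)/2}`. -/
def eigenvalue (n : ℕ) (k : ℤ) (i : ℕ) (s : ℂ) : ℂ :=
  (p : ℂ) ^ ((n : ℂ) * ((k : ℂ) / 2 - s) + 2 * s * i - (i : ℂ) * (i + 1) / 2)

end Coefficients

end SiegelEis

end

open Matrix
open scoped ComplexConjugate

noncomputable section

/-! On the Eisenstein series of the n + 1 cusps the operator U(p) is triangular: for 2 Re(s) > n + 1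
it sends E(w_i) to p^{n(k/2-s)} Σ_{j ≥ i} m_ij E(w_j) (`Up_eisSeries`). The ratio m_jj / m_ii is
p^{(j-i)(2s-(j+i+1)/2)}; where none of these ratios is 1, the equation for a row eigenvector with
b_ii = 1 can be solved column by column, and this is the recursion for b (`sum_bCoeff_mul_mCoeff`).

The matrix m is found as follows. The value ψ*(γ) depends only on the bottom row (C, D) modulo p:
such a pair has a normal form U (E_I, E_{Iᶜ}) m(V) n(T) with |I| = rank C, the product det U · det V
is unique up to squares, and ψ² = 1 (`exists_NF`, `NF.det_sq`, `psiStar_eq`). Hence every series is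
a sum over all of P \ Sp(n, ℤ), weighted by a function of (C, D) modulo p. The cosets in U(p) are
represented by ((1, S), (0, p)) with S symmetric modulo p (`heckeEquiv`). For fixed S, passing from
(C, pD) to a primitive pair (C', D') gives a bijection between the cosets of the i-th cell and those
with D' of rank n - i modulo p (`tsum_heckeG`). Summing over S before summing over cosets leaves a
finite problem: the sum over S of the character of (D - CS, C). In normal form, with rank C = j, it
becomes the sum of the discriminant characters of the symmetric j × j matrices of rank j - i over
𝔽_p (`sum_pairChar`). Splitting off the first row gives a recursion for this sum (`symSum_cons`),
its solution is `symSum_fin`, and comparison with the closed formulas is `mCoeff_eq`.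

Absolute convergence is proved by reduction theory. The point Z may be replaced by i, where |j(g,
i)|² = det(C Cᵀ + D Dᵀ). Each coset of P has a representative with Hermite reduced Gram matrix and
bounded real part. The representatives with prescribed dyadic size of the diagonal entries are
counted by means of the invariant distance on the half space, and the series is then dominated by a
product of geometric series (`hermiteReduction`, `exists_card_bound`, `summable_det_gramD`).

The eigenfunction is nonzero because, seen from the cusp w_i along Z = iy with y → ∞, only the coset
P survives, and it occurs with coefficient b_ii = 1 up to a nonzero factor (`eigenEis_ne_zero`).

For other s, U(p)f(Z) is a fixed finite combination of values of f, so the identities extend by the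
identity theorem for meromorphic functions. Existence of the continuation is not needed: by the
definition of `eisenstein`, either it exists or all values outside the half plane of convergence are
0, and there the assertions are trivial (`meromorphic_eisenstein_or`). -/

namespace SiegelEis

/-! ### Normal forms of symmetric pairs (C, D) over a field and their character. -/

section NormalForm

variable {ι : Type*} [Fintype ι] [DecidableEq ι] {F : Type*} [Field F]

/-- The diagonal idempotent matrix supported on `I`. -/
def idem (F : Type*) [Field F] (I : Finset ι) : Matrix ι ι F :=
  diagonal fun a => if a ∈ I then 1 else 0

theorem idem_transpose (I : Finset ι) : (idem F I)ᵀ = idem F I := by simp [idem]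

theorem idem_mul_self (I : Finset ι) : idem F I * idem F I = idem F I := by
  simp [idem, diagonal_mul_diagonal]

theorem idem_mul_compl (I : Finset ι) : idem F I * idem F Iᶜ = 0 := by
  rw [idem, idem, diagonal_mul_diagonal, ← diagonal_zero]
  congr 1; ext a; by_cases h : a ∈ I <;> simp [h]

theorem idem_compl_mul (I : Finset ι) : idem F Iᶜ * idem F I = 0 := by
  rw [idem, idem, diagonal_mul_diagonal, ← diagonal_zero]
  congr 1; ext a; by_cases h : a ∈ I <;> simp [h]

theorem idem_add_compl (I : Finset ι) : idem F I + idem F Iᶜ = 1 := by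
  rw [idem, idem, diagonal_add, ← diagonal_one]
  congr 1; ext a; by_cases h : a ∈ I <;> simp [h]

theorem idem_mul_apply (I : Finset ι) (M : Matrix ι ι F) (a b : ι) :
    (idem F I * M) a b = if a ∈ I then M a b else 0 := by
  simp [idem, diagonal_mul]

theorem mul_idem_apply (I : Finset ι) (M : Matrix ι ι F) (a b : ι) :
    (M * idem F I) a b = if b ∈ I then M a b else 0 := by
  simp [idem, mul_diagonal]

theorem rank_idem (I : Finset ι) : (idem F I).rank = I.card := by
  classical
  rw [idem, Matrix.rank_diagonal]
  simp [Fintype.card_subtype]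

/-- The pair `(C, D)` is `U (E_I, E_{Iᶜ}) m(V) n(T)` with `m(V) = diag(W, V)`, `W = ᵗV⁻¹`. -/
structure NF (C D : Matrix ι ι F) (I : Finset ι) (U W V T : Matrix ι ι F) : Prop where
  hC : C = U * idem F I * W
  hD : D = U * (idem F I * W * T + idem F Iᶜ * V)
  hU : IsUnit U.det
  hWV : Wᵀ * V = 1
  hT : Tᵀ = T

variable {C D U W V T U' W' V' T' M : Matrix ι ι F} {I J : Finset ι}

theorem inv_pair_comm (h : Wᵀ * V = 1) : V * Wᵀ = 1 ∧ W * Vᵀ = 1 ∧ Vᵀ * W = 1 := by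
  have h1 := mul_eq_one_comm.1 h
  refine ⟨h1, ?_, ?_⟩
  · rw [← transpose_transpose W, ← transpose_mul, h1, transpose_one]
  · rw [← transpose_transpose W, ← transpose_mul, h, transpose_one]

theorem det_inv_pair (h : Wᵀ * V = 1) : W.det * V.det = 1 := by
  rw [← det_transpose W, ← det_mul, h, det_one]

theorem NF.rank_eq (h : NF C D I U W V T) : C.rank = I.card := by
  have hW : IsUnit W.det := IsUnit.of_mul_eq_one _ (det_inv_pair h.hWV)
  rw [h.hC, rank_mul_eq_left_of_isUnit_det _ _ hW, rank_mul_eq_right_of_isUnit_det _ _ h.hU,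
    rank_idem]

/-- The action of a permutation on the index set of a normal form. -/
theorem NF.perm (h : NF C D J U W V T) (e : Equiv.Perm ι) (he : ∀ a, e a ∈ J ↔ a ∈ I) :
    ∃ P : Matrix ι ι F, P * Pᵀ = 1 ∧ NF C D I (U * P) (Pᵀ * W) (Pᵀ * V) T := by
  set P : Matrix ι ι F := (1 : Matrix ι ι F).submatrix id e with hP
  have hPP : P * Pᵀ = 1 := by
    rw [hP, transpose_submatrix, transpose_one]
    ext a b
    rw [mul_apply, ← Equiv.sum_comp e.symm]
    simp [one_apply]
  have hPP' : Pᵀ * P = 1 := mul_eq_one_comm.1 hPP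
  have hE : ∀ I J : Finset ι, (∀ a, e a ∈ J ↔ a ∈ I) → P * idem F I * Pᵀ = idem F J := by
    intro I J he
    have : P * idem F I = idem F J * P := by
      ext a b
      rw [mul_idem_apply, idem_mul_apply]
      by_cases hab : a = e b
      · subst hab; simp [he]
      · simp [hP, one_apply, hab]
    rw [this, Matrix.mul_assoc, hPP, Matrix.mul_one]
  have h1 := hE I J he
  have h2 := hE Iᶜ Jᶜ (fun a => by simp [he])
  refine ⟨P, hPP, ?_, ?_, ?_, ?_, h.hT⟩
  · rw [h.hC, ← h1]; simp only [Matrix.mul_assoc]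
  · rw [h.hD, ← h1, ← h2]; simp only [Matrix.mul_assoc, Matrix.mul_add]
  · rw [det_mul]
    exact h.hU.mul (IsUnit.of_mul_eq_one _ (by rw [← det_mul, hPP, det_one]))
  · rw [transpose_mul, transpose_transpose, Matrix.mul_assoc, ← Matrix.mul_assoc P, hPP,
      Matrix.one_mul, h.hWV]

theorem exists_perm_of_card_eq (h : I.card = J.card) :
    ∃ e : Equiv.Perm ι, ∀ a, e a ∈ J ↔ a ∈ I := by
  classical
  obtain ⟨e⟩ : Nonempty ({a // a ∈ I} ≃ {a // a ∈ J}) := ⟨Fintype.equivOfCardEq (by simpa using h)⟩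
  refine ⟨e.extendSubtype, fun a => ⟨fun ha => ?_, fun ha => e.extendSubtype_mem a ha⟩⟩
  by_contra hn
  exact e.extendSubtype_not_mem a hn ha

/-- Two normal forms with the same index set differ by a square. -/
theorem NF.det_sq_aux (h : NF C D I U W V T) (h' : NF C D I U' W' V' T') :
    ∃ x : F, x ≠ 0 ∧ U.det * V.det = U'.det * V'.det * (x * x) := by
  obtain ⟨v1, v2, v3⟩ := inv_pair_comm h.hWV
  obtain ⟨v1', v2', v3'⟩ := inv_pair_comm h'.hWV
  -- Comparing the two expressions for C gives A E_I = E_I X, so A and X are block triangular with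
  -- the same I-block. Comparing those for D shows that their Iᶜ-blocks are inverse transposes of
  -- each other. Hence det A · det X is the square of the determinant of the I-block.
  set A := U'⁻¹ * U with hA
  set X := W' * Vᵀ with hX
  have hUi : U'⁻¹ * U' = 1 := nonsing_inv_mul _ h'.hU
  have hUA : U' * A = U := by rw [hA, ← Matrix.mul_assoc, mul_nonsing_inv _ h'.hU, Matrix.one_mul]
  have e1 : A * idem F I = idem F I * X := by
    have := congrArg (fun M => U'⁻¹ * M * Vᵀ) (h.hC.symm.trans h'.hC)
    simp only [Matrix.mul_assoc, v2, Matrix.mul_one] at this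
    rw [← Matrix.mul_assoc U'⁻¹ U', hUi, Matrix.one_mul, ← Matrix.mul_assoc U'⁻¹ U] at this
    exact this
  have e2 : ∃ Y, A * idem F Iᶜ * Xᵀ = idem F Iᶜ + idem F I * Y := by
    refine ⟨W' * T' * W'ᵀ - X * W * T * W'ᵀ, ?_⟩
    have := congrArg (fun M => U'⁻¹ * M * W'ᵀ) (h.hD.symm.trans h'.hD)
    simp only [← Matrix.mul_assoc, hUi, Matrix.one_mul] at this
    rw [← hA] at this
    simp only [Matrix.mul_add, Matrix.add_mul, ← Matrix.mul_assoc, e1] at this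
    simp only [Matrix.mul_assoc, v1', Matrix.mul_one] at this
    have hXt : Xᵀ = V * W'ᵀ := by rw [hX, transpose_mul, transpose_transpose]
    rw [hXt, Matrix.mul_sub]
    simp only [Matrix.mul_assoc]
    rw [add_comm] at this
    rw [← sub_eq_iff_eq_add.2 (this.trans (add_comm _ _)).symm]
    abel
  obtain ⟨Y, e2⟩ := e2
  let q : ι → Prop := fun a => a ∈ I
  have hAz : ∀ a, ¬ q a → ∀ b, q b → A a b = 0 := by
    intro a ha b hb
    have := congrFun (congrFun e1 a) b
    simp only [q] at ha hb
    simpa [mul_idem_apply, idem_mul_apply, ha, hb] using this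
  have hXz : ∀ a, q a → ∀ b, ¬ q b → X a b = 0 := by
    intro a ha b hb
    have := congrFun (congrFun e1 a) b
    simp only [q] at ha hb
    simpa [mul_idem_apply, idem_mul_apply, ha, hb] using this.symm
  have dA := twoBlockTriangular_det A q hAz
  have dX := twoBlockTriangular_det' X q hXz
  have b1 : A.toSquareBlockProp q = X.toSquareBlockProp q := by
    ext ⟨a, ha⟩ ⟨b, hb⟩
    have := congrFun (congrFun e1 a) b
    simp only [q] at ha hb
    simpa [mul_idem_apply, idem_mul_apply, ha, hb, toSquareBlockProp] using this
  have b2 : A.toSquareBlockProp (fun i => ¬ q i) * (X.toSquareBlockProp (fun i => ¬ q i))ᵀ = 1 := by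
    ext ⟨a, ha⟩ ⟨b, hb⟩
    have := congrFun (congrFun e2 a) b
    simp only [q] at ha hb
    rw [mul_apply, Matrix.add_apply, idem_mul_apply, if_neg ha, add_zero] at this
    have hI : (idem F Iᶜ) a b = if a = b then 1 else 0 := by
      simp [idem, diagonal_apply, ha]
    simp only [mul_idem_apply, hI, transpose_apply, ite_mul, zero_mul] at this
    rw [mul_apply, one_apply]
    simp only [Subtype.mk.injEq]
    rw [← this, ← Finset.sum_filter]
    exact (Finset.sum_subtype (Finset.univ.filter fun x => x ∈ Iᶜ) (by simp [q])
      (fun x => A a x * X b x)).symm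
  obtain ⟨y, hdet⟩ : ∃ y : F, A.det * X.det = y * y := by
    have h2 := congrArg det b2
    rw [det_mul, det_transpose, det_one] at h2
    rw [dA, dX, ← b1]
    have key : ∀ a b d : F, b * d = 1 → a * b * (a * d) = a * a := fun a b d h => by
      linear_combination a * a * h
    exact ⟨_, key _ _ _ h2⟩
  refine ⟨y, ?_, ?_⟩
  · intro h0
    rw [h0, mul_zero] at hdet
    have : A.det * X.det ≠ 0 := by
      refine mul_ne_zero ?_ ?_
      · intro hz
        have := h.hU.ne_zero
        rw [← hUA, det_mul, hz, mul_zero] at this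
        exact this rfl
      · rw [hX, det_mul, det_transpose]
        exact mul_ne_zero (left_ne_zero_of_mul_eq_one (det_inv_pair h'.hWV))
          (right_ne_zero_of_mul_eq_one (det_inv_pair h.hWV))
    exact this hdet
  · rw [← hdet, hX, det_mul W', det_transpose, ← hUA, det_mul]
    linear_combination -(U'.det * A.det * V.det) * det_inv_pair h'.hWV

/-- Both index sets have rank C elements, so a permutation matrix P matches them; it enters U and V
once each and contributes (det P)² = 1. For ψ² = 1 this makes ψ(det U) ψ(det V) an invariant of the
pair. -/
theorem NF.det_sq (h : NF C D I U W V T) (h' : NF C D J U' W' V' T') :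
    ∃ x : F, x ≠ 0 ∧ U.det * V.det = U'.det * V'.det * (x * x) := by
  obtain ⟨e, he⟩ := exists_perm_of_card_eq (h.rank_eq.symm.trans h'.rank_eq)
  obtain ⟨P, hP, h2⟩ := h'.perm e he
  obtain ⟨x, hx, h3⟩ := h.det_sq_aux h2
  refine ⟨x, hx, ?_⟩
  have h4 : P.det * P.det = 1 := by
    have := congrArg det hP
    rwa [det_mul, det_transpose, det_one] at this
  rw [h3, det_mul, det_mul, det_transpose]
  linear_combination U'.det * V'.det * (x * x) * h4

variable (ψ : MulChar F ℂ)

open Classical in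
/-- The value `ψ(det U) ψ(det V)` on the pairs `(C, D)` with a normal form of rank `r`, and `0` on
all other pairs. -/
def pairChar (r : ℕ) (C D : Matrix ι ι F) : ℂ :=
  if h : ∃ x : Finset ι × Matrix ι ι F × Matrix ι ι F × Matrix ι ι F × Matrix ι ι F,
      x.1.card = r ∧ NF C D x.1 x.2.1 x.2.2.1 x.2.2.2.1 x.2.2.2.2 then
    ψ h.choose.2.1.det * ψ h.choose.2.2.2.1.det
  else 0

variable {ψ}

theorem MulChar.apply_sq (hψ : ψ ^ 2 = 1) {x : F} (hx : x ≠ 0) : ψ x * ψ x = 1 := by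
  have := congrArg (fun χ : MulChar F ℂ => χ x) hψ
  simpa [pow_two, MulChar.one_apply hx.isUnit] using this

theorem pairChar_eq (hψ : ψ ^ 2 = 1) (h : NF C D I U W V T) {r : ℕ} (hr : I.card = r) :
    pairChar ψ r C D = ψ U.det * ψ V.det := by
  have hex : ∃ x : Finset ι × Matrix ι ι F × Matrix ι ι F × Matrix ι ι F × Matrix ι ι F,
      x.1.card = r ∧ NF C D x.1 x.2.1 x.2.2.1 x.2.2.2.1 x.2.2.2.2 := ⟨(I, U, W, V, T), hr, h⟩
  rw [pairChar, dif_pos hex]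
  obtain ⟨x, hx, h2⟩ := hex.choose_spec.2.det_sq h
  rw [← map_mul, h2, map_mul, map_mul, map_mul, MulChar.apply_sq hψ hx, mul_one]

theorem pairChar_eq_zero {r : ℕ} (h : ¬ ∃ I U W V T, I.card = r ∧ NF C D I U W V T) :
    pairChar ψ r C D = 0 := by
  rw [pairChar, dif_neg]
  rintro ⟨⟨I, U, W, V, T⟩, h1, h2⟩
  exact h ⟨I, U, W, V, T, h1, h2⟩

theorem pairChar_ne_zero {r : ℕ} (h : pairChar ψ r C D ≠ 0) :
    ∃ I U W V T, I.card = r ∧ NF C D I U W V T := by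
  by_contra hn
  exact h (pairChar_eq_zero hn)

theorem pairChar_of_ne (h : NF C D I U W V T) {r : ℕ} (hr : I.card ≠ r) :
    pairChar ψ r C D = 0 := by
  apply pairChar_eq_zero
  rintro ⟨I', U', W', V', T', h1, h2⟩
  exact hr (by rw [← h1, ← h.rank_eq, ← h2.rank_eq])

theorem NF.mul_left (h : NF C D I U W V T) (hM : IsUnit M.det) : NF (M * C) (M * D) I (M * U) W V T where
  hC := by rw [h.hC]; simp only [Matrix.mul_assoc]
  hD := by rw [h.hD]; simp only [Matrix.mul_assoc]
  hU := by rw [det_mul]; exact hM.mul h.hU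
  hWV := h.hWV
  hT := h.hT

/-- The pair is multiplied by m(W') n(T'), which over 𝔽_p is the reduction of an element of Γ₀(p).
Moving n(T) past the Levi factor replaces T by V'ᵀ T V'. -/
theorem NF.mul_right (h : NF C D I U W V T) (hWV : W'ᵀ * V' = 1) (hT : T'ᵀ = T') :
    NF (C * W') (C * W' * T' + D * V') I U (W * W') (V * V') (T' + V'ᵀ * T * V') where
  hC := by rw [h.hC]; simp only [Matrix.mul_assoc]
  hD := by
    have h1 := (inv_pair_comm hWV).2.1
    rw [h.hC, h.hD]
    simp only [Matrix.mul_assoc, Matrix.mul_add, Matrix.add_mul]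
    rw [← Matrix.mul_assoc W' V'ᵀ, h1, Matrix.one_mul]
    abel
  hU := h.hU
  hWV := by
    rw [transpose_mul, Matrix.mul_assoc, ← Matrix.mul_assoc Wᵀ, h.hWV, Matrix.one_mul, hWV]
  hT := by
    simp only [transpose_add, transpose_mul, transpose_transpose, h.hT, hT, Matrix.mul_assoc]

theorem pairChar_mul_left (hψ : ψ ^ 2 = 1) (hM : IsUnit M.det) (r : ℕ) :
    pairChar ψ r (M * C) (M * D) = ψ M.det * pairChar ψ r C D := by
  by_cases h : ∃ I U W V T, I.card = r ∧ NF C D I U W V T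
  · obtain ⟨I, U, W, V, T, hr, h⟩ := h
    rw [pairChar_eq hψ (h.mul_left hM) hr, pairChar_eq hψ h hr, det_mul, map_mul, mul_assoc]
  · rw [pairChar_eq_zero h, mul_zero, pairChar_eq_zero]
    rintro ⟨I, U, W, V, T, hr, h'⟩
    refine h ⟨I, M⁻¹ * U, W, V, T, hr, ?_⟩
    have := h'.mul_left (M := M⁻¹) (isUnit_nonsing_inv_det _ hM)
    rwa [← Matrix.mul_assoc, ← Matrix.mul_assoc, nonsing_inv_mul _ hM, Matrix.one_mul,
      Matrix.one_mul] at this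

theorem pairChar_mul_right (hψ : ψ ^ 2 = 1) (hWV : Wᵀ * V = 1) (hT : Tᵀ = T) (r : ℕ) :
    pairChar ψ r (C * W) (C * W * T + D * V) = ψ V.det * pairChar ψ r C D := by
  obtain ⟨v1, v2, v3⟩ := inv_pair_comm hWV
  by_cases h : ∃ I U W V T, I.card = r ∧ NF C D I U W V T
  · obtain ⟨I, U, W', V', T', hr, h⟩ := h
    rw [pairChar_eq hψ (h.mul_right hWV hT) hr, pairChar_eq hψ h hr, det_mul, map_mul]
    ring
  · rw [pairChar_eq_zero h, mul_zero, pairChar_eq_zero]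
    rintro ⟨I, U, W', V', T', hr, h'⟩
    refine h ?_
    have := h'.mul_right (W' := Vᵀ) (V' := Wᵀ) (T' := -(W * T * Wᵀ))
      (by rw [transpose_transpose, v1])
      (by simp only [transpose_neg, transpose_mul, transpose_transpose, hT, Matrix.mul_assoc])
    refine ⟨I, U, W' * Vᵀ, V' * Wᵀ, -(W * T * Wᵀ) + Wᵀᵀ * T' * Wᵀ, hr, ?_⟩
    convert this using 1
    · rw [Matrix.mul_assoc, v2, Matrix.mul_one]
    · rw [Matrix.add_mul, Matrix.mul_assoc D, v1, Matrix.mul_one, Matrix.mul_assoc C W Vᵀ, v2,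
        Matrix.mul_one, Matrix.mul_neg]
      simp only [Matrix.mul_assoc]
      abel

/-- Every symmetric pair of full rank has a normal form. -/
theorem exists_NF (hs : C * Dᵀ = D * Cᵀ) {X Y : Matrix ι ι F} (hXY : C * X + D * Y = 1) :
    ∃ I U W V T, NF C D I U W V T := by
  classical
  obtain ⟨L, L', d, hL⟩ := Pivot.exists_list_transvec_mul_diagonal_mul_list_transvec C
  set P := (L.map TransvectionStruct.toMatrix).prod
  set R := (L'.map TransvectionStruct.toMatrix).prod
  have hP : P.det = 1 := TransvectionStruct.det_toMatrix_prod L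
  have hR : R.det = 1 := TransvectionStruct.det_toMatrix_prod L'
  -- I marks the nonzero pivots of C; their values are moved into U through Δ.
  set I : Finset ι := Finset.univ.filter fun a => d a ≠ 0 with hI
  set Δ : Matrix ι ι F := diagonal fun a => if d a = 0 then 1 else d a with hΔ
  have hΔd : IsUnit Δ.det := by
    rw [hΔ, det_diagonal, isUnit_iff_ne_zero, Finset.prod_ne_zero_iff]
    intro a _
    split_ifs with h <;> simp [h]
  have hd : diagonal d = Δ * idem F I := by
    rw [hΔ, idem, diagonal_mul_diagonal]
    congr 1; ext a
    by_cases h : d a = 0 <;> simp [hI, h]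
  set U := P * Δ with hUdef
  have hU : IsUnit U.det := by rw [hUdef, det_mul, hP, one_mul]; exact hΔd
  have hUi : U * U⁻¹ = 1 := mul_nonsing_inv _ hU
  have hUi' : U⁻¹ * U = 1 := nonsing_inv_mul _ hU
  have hRu : IsUnit R.det := by rw [hR]; exact isUnit_one
  set V := (R⁻¹)ᵀ with hV
  have hWV : Rᵀ * V = 1 := by rw [hV, ← transpose_mul, nonsing_inv_mul _ hRu, transpose_one]
  obtain ⟨v1, v2, v3⟩ := inv_pair_comm hWV
  have hC : C = U * idem F I * R := by rw [hL, hd, hUdef]; simp only [Matrix.mul_assoc]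
  set D1 := U⁻¹ * D * Rᵀ with hD1
  have hD : D = U * D1 * V := by
    rw [hD1]; simp only [Matrix.mul_assoc]
    rw [hWV, Matrix.mul_one, ← Matrix.mul_assoc, hUi, Matrix.one_mul]
  have hs1 : idem F I * D1ᵀ = D1 * idem F I := by
    have h1 := congrArg (fun M => U⁻¹ * M * (U⁻¹)ᵀ) hs
    rw [hC, hD] at h1
    simp only [transpose_mul, idem_transpose, Matrix.mul_assoc] at h1
    have hUt : Uᵀ * (U⁻¹)ᵀ = 1 := by rw [← transpose_mul, hUi', transpose_one]
    have hx : ∀ M, U⁻¹ * (U * M) = M := fun M => by rw [← Matrix.mul_assoc, hUi', Matrix.one_mul]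
    have hy : ∀ M, R * (Vᵀ * M) = M := fun M => by rw [← Matrix.mul_assoc, v2, Matrix.one_mul]
    have hz : ∀ M, V * (Rᵀ * M) = M := fun M => by rw [← Matrix.mul_assoc, v1, Matrix.one_mul]
    simpa only [hx, hy, hz, hUt, Matrix.mul_one] using h1
  have hs2 : ∀ a b, (if a ∈ I then D1 b a else 0) = (if b ∈ I then D1 a b else 0) := fun a b => by
    have := congrFun (congrFun hs1 a) b
    rwa [idem_mul_apply, mul_idem_apply, transpose_apply] at this
  -- the symmetric correction
  set S : Matrix ι ι F := of fun a b => if a ∈ I then D1 a b else if b ∈ I then D1 b a else 0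
    with hS
  have hSt : Sᵀ = S := by
    ext a b
    have := hs2 a b
    simp only [hS, transpose_apply, of_apply]
    by_cases ha : a ∈ I <;> by_cases hb : b ∈ I <;> simp only [ha, hb, if_true, if_false] at this ⊢
    exact this
  set D2 := D1 - idem F I * S with hD2
  have hD2l : idem F I * D2 = 0 := by
    ext a b
    rw [idem_mul_apply]
    by_cases ha : a ∈ I <;> simp [hD2, idem_mul_apply, hS, ha]
  have hD2r : D2 * idem F I = 0 := by
    ext a b
    rw [mul_idem_apply]
    have := hs2 a b
    by_cases ha : a ∈ I
    · simp [hD2, idem_mul_apply, hS, ha]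
    · by_cases hb : b ∈ I
      · simp only [ha, hb, if_true, if_false] at this
        simp [hD2, idem_mul_apply, ha, hb, ← this]
      · simp [hb]
  have hD2c : D2 * idem F Iᶜ = D2 := by
    have := congrArg (D2 * ·) (idem_add_compl (F := F) I)
    simpa [Matrix.mul_add, hD2r] using this
  set U2 := idem F I + D2 with hU2
  have h1 : U2 * idem F I = idem F I := by rw [hU2, Matrix.add_mul, hD2r, idem_mul_self, add_zero]
  have h2 : U2 * idem F Iᶜ = D2 := by rw [hU2, Matrix.add_mul, hD2c, idem_mul_compl, zero_add]
  have hinv : ∃ Z, U2 * Z = 1 := by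
    have e1 := congrArg (fun M => U⁻¹ * M * U) hXY
    simp only [Matrix.mul_one] at e1
    rw [hUi', hC, hD] at e1
    have hx : ∀ M, U⁻¹ * (U * M) = M := fun M => by rw [← Matrix.mul_assoc, hUi', Matrix.one_mul]
    simp only [Matrix.mul_add, Matrix.add_mul, Matrix.mul_assoc, hx] at e1
    have e2 : D1 = D2 + idem F I * S := by rw [hD2]; abel
    rw [e2, Matrix.add_mul] at e1
    refine ⟨idem F I * (R * (X * U) + S * (V * (Y * U))) + idem F Iᶜ * (V * (Y * U)), ?_⟩
    rw [Matrix.mul_add, ← Matrix.mul_assoc U2, ← Matrix.mul_assoc U2, h1, h2, ← e1, Matrix.mul_add]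
    simp only [Matrix.mul_assoc]
    abel
  obtain ⟨Z, hZ⟩ := hinv
  have hU2u : IsUnit U2.det := IsUnit.of_mul_eq_one Z.det (by rw [← det_mul, hZ, det_one])
  refine ⟨I, U * U2, R, V, Vᵀ * S * V, ?_, ?_, ?_, hWV, ?_⟩
  · rw [Matrix.mul_assoc U, h1, ← hC]
  · rw [Matrix.mul_assoc U, Matrix.mul_add, ← Matrix.mul_assoc U2, ← Matrix.mul_assoc U2,
      ← Matrix.mul_assoc U2, h1, h2]
    have e2 : D1 = D2 + idem F I * S := by rw [hD2]; abel
    rw [hD, e2]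
    have hy : ∀ M, R * (Vᵀ * M) = M := fun M => by rw [← Matrix.mul_assoc, v2, Matrix.one_mul]
    simp only [Matrix.mul_assoc, hy, Matrix.add_mul, Matrix.mul_add]
    abel
  · rw [det_mul]; exact hU.mul hU2u
  · simp only [transpose_mul, transpose_transpose, hSt, Matrix.mul_assoc]

end NormalForm

/-! ### Sums of discriminant characters over symmetric matrices of given rank. -/

section SymCount

variable {ι κ : Type*} [Fintype ι] [DecidableEq ι] [Fintype κ] [DecidableEq κ]
  {F : Type*} [Field F]

theorem idem_disjSum (I : Finset ι) (J : Finset κ) :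
    idem F (I.disjSum J) = fromBlocks (idem F I) 0 0 (idem F J) := by
  rw [idem, idem, idem, fromBlocks_diagonal]
  congr 1
  ext x
  cases x <;> simp

theorem compl_disjSum (I : Finset ι) (J : Finset κ) : (I.disjSum J)ᶜ = Iᶜ.disjSum Jᶜ := by
  ext x
  cases x <;> simp

theorem NF.block {C D U W V T : Matrix ι ι F} {I : Finset ι} {C' D' U' W' V' T' : Matrix κ κ F}
    {J : Finset κ} (h : NF C D I U W V T) (h' : NF C' D' J U' W' V' T') :
    NF (fromBlocks C 0 0 C') (fromBlocks D 0 0 D') (I.disjSum J) (fromBlocks U 0 0 U')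
      (fromBlocks W 0 0 W') (fromBlocks V 0 0 V') (fromBlocks T 0 0 T') where
  hC := by simp [idem_disjSum, fromBlocks_multiply, h.hC, h'.hC]
  hD := by simp [idem_disjSum, compl_disjSum, fromBlocks_multiply, fromBlocks_add, h.hD, h'.hD]
  hU := by rw [det_fromBlocks_zero₂₁]; exact h.hU.mul h'.hU
  hWV := by simp [fromBlocks_multiply, fromBlocks_transpose, h.hWV, h'.hWV]
  hT := by simp [fromBlocks_transpose, h.hT, h'.hT]

theorem NF.reindex {C D U W V T : Matrix ι ι F} {I : Finset ι} (h : NF C D I U W V T) (e : κ ≃ ι) :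
    NF (C.submatrix e e) (D.submatrix e e) (I.map e.symm.toEmbedding) (U.submatrix e e)
      (W.submatrix e e) (V.submatrix e e) (T.submatrix e e) := by
  have hE : ∀ I : Finset ι, idem F (I.map e.symm.toEmbedding) = (idem F I).submatrix e e := by
    intro I
    ext a b
    simp [idem, diagonal_apply]
  have hc : (I.map e.symm.toEmbedding)ᶜ = Iᶜ.map e.symm.toEmbedding := by
    ext a; simp
  refine ⟨?_, ?_, ?_, ?_, ?_⟩
  · rw [hE, submatrix_mul_equiv, submatrix_mul_equiv, h.hC]
  · rw [hc, hE, hE, h.hD]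
    rw [← submatrix_mul_equiv _ _ _ e, Matrix.submatrix_add]
    simp only [submatrix_mul_equiv, Pi.add_apply]
  · rw [det_submatrix_equiv_self]; exact h.hU
  · rw [transpose_submatrix, submatrix_mul_equiv, h.hWV, submatrix_one_equiv]
  · rw [transpose_submatrix, h.hT]

variable {ψ : MulChar F ℂ} (hψ : ψ ^ 2 = 1)

include hψ in
theorem pairChar_reindex (C D : Matrix ι ι F) (e : κ ≃ ι) (r : ℕ) :
    pairChar ψ r (C.submatrix e e) (D.submatrix e e) = pairChar ψ r C D := by
  by_cases h : ∃ I U W V T, I.card = r ∧ NF C D I U W V T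
  · obtain ⟨I, U, W, V, T, hr, h⟩ := h
    rw [pairChar_eq hψ h hr, pairChar_eq hψ (h.reindex e) (by simpa using hr),
      det_submatrix_equiv_self, det_submatrix_equiv_self]
  · rw [pairChar_eq_zero h, pairChar_eq_zero]
    rintro ⟨I, U, W, V, T, hr, h'⟩
    refine h ⟨_, _, _, _, _, ?_, by simpa using h'.reindex e.symm⟩
    simpa using hr

include hψ in
theorem pairChar_block {C D U W V T : Matrix ι ι F} {I : Finset ι} {C' D' U' W' V' T' : Matrix κ κ F}
    {J : Finset κ} (h : NF C D I U W V T) (h' : NF C' D' J U' W' V' T') (d : ℕ) :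
    pairChar ψ d (fromBlocks C 0 0 C') (fromBlocks D 0 0 D') =
      if I.card ≤ d then ψ U.det * ψ V.det * pairChar ψ (d - I.card) C' D' else 0 := by
  by_cases hd : I.card ≤ d
  · rw [if_pos hd]
    by_cases hJ : J.card = d - I.card
    · rw [pairChar_eq hψ h' hJ, pairChar_eq hψ (h.block h') (by rw [Finset.card_disjSum]; omega),
        det_fromBlocks_zero₂₁, det_fromBlocks_zero₂₁, map_mul, map_mul]
      ring
    · rw [pairChar_of_ne h' hJ, mul_zero, pairChar_of_ne (h.block h')]
      rw [Finset.card_disjSum]; omega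
  · rw [if_neg hd, pairChar_of_ne (h.block h')]
    rw [Finset.card_disjSum]; omega

/-- Symmetric matrices. -/
abbrev SymMat (ι F : Type*) : Type _ := {S : Matrix ι ι F // Sᵀ = S}

theorem exists_NF_one {S : Matrix ι ι F} (hS : Sᵀ = S) : ∃ I U W V T, NF S 1 I U W V T :=
  exists_NF (X := 0) (Y := 1) (by simp [hS]) (by simp)

theorem NF_invertible {A : Matrix ι ι F} (hA : Aᵀ = A) (hu : IsUnit A.det) :
    NF A 1 Finset.univ A 1 1 A⁻¹ where
  hC := by simp [idem]
  hD := by simp [idem, mul_nonsing_inv _ hu]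
  hU := hu
  hWV := by simp
  hT := by rw [transpose_nonsing_inv, hA]

theorem NF_zero_one : NF (0 : Matrix ι ι F) 1 ∅ 1 1 1 0 where
  hC := by simp [idem]
  hD := by simp [idem]
  hU := by simp
  hWV := by simp
  hT := by simp

theorem NF_one_zero : NF (1 : Matrix ι ι F) 0 Finset.univ 1 1 1 0 where
  hC := by simp [idem]
  hD := by simp [idem]
  hU := by simp
  hWV := by simp
  hT := by simp

include hψ in
-- Multiply (S, 1) by Q on the left and by the Levi element of Qᵀ on the right: the factors ψ(det Q)
-- and ψ(det Q⁻¹) cancel. For symmetric S of rank d the value is thus the character of the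
-- discriminant of the nondegenerate part of S.
theorem pairChar_congr {Q : Matrix ι ι F} (hQ : IsUnit Q.det) (S : Matrix ι ι F) (d : ℕ) :
    pairChar ψ d (Q * S * Qᵀ) 1 = pairChar ψ d S 1 := by
  have h1 : Qᵀᵀ * Q⁻¹ = 1 := by rw [transpose_transpose, mul_nonsing_inv _ hQ]
  have h2 := pairChar_mul_right (C := Q * S) (D := Q * 1) (T := 0) hψ h1 (by simp) d
  rw [pairChar_mul_left hψ hQ, Matrix.mul_zero, zero_add, Matrix.mul_one, mul_nonsing_inv _ hQ] at h2
  rw [h2, ← mul_assoc, ← map_mul, ← det_mul, nonsing_inv_mul _ hQ, det_one, map_one, one_mul]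

include hψ in
/-- Splitting off an invertible symmetric block. -/
theorem pairChar_schur {A : Matrix ι ι F} (hA : Aᵀ = A) (hu : IsUnit A.det) (B : Matrix ι κ F)
    {S : Matrix κ κ F} (hS : Sᵀ = S) (d : ℕ) :
    pairChar ψ d (fromBlocks A B Bᵀ S) 1 =
      if Fintype.card ι ≤ d then
        ψ A.det * pairChar ψ (d - Fintype.card ι) (S - Bᵀ * A⁻¹ * B) 1 else 0 := by
  have hAi : (A⁻¹)ᵀ = A⁻¹ := by rw [transpose_nonsing_inv, hA]
  set Q : Matrix (ι ⊕ κ) (ι ⊕ κ) F := fromBlocks 1 0 (Bᵀ * A⁻¹) 1 with hQ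
  have hQd : IsUnit Q.det := by rw [hQ, det_fromBlocks_zero₁₂]; simp
  have e : fromBlocks A B Bᵀ S = Q * fromBlocks A 0 0 (S - Bᵀ * A⁻¹ * B) * Qᵀ := by
    rw [hQ, fromBlocks_transpose, fromBlocks_multiply, fromBlocks_multiply]
    simp only [transpose_one, transpose_zero, transpose_mul, transpose_transpose, hAi,
      Matrix.one_mul, Matrix.zero_mul, Matrix.mul_zero, Matrix.mul_one, add_zero, zero_add]
    rw [Matrix.mul_assoc Bᵀ, nonsing_inv_mul _ hu, Matrix.mul_one, ← Matrix.mul_assoc A,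
      mul_nonsing_inv _ hu, Matrix.one_mul, Matrix.mul_assoc Bᵀ]
    congr 1
    abel
  obtain ⟨J, U, W, V, T, h⟩ := exists_NF_one (S := S - Bᵀ * A⁻¹ * B) (by
    simp only [transpose_sub, transpose_mul, transpose_transpose, hS, hAi, Matrix.mul_assoc])
  rw [e, pairChar_congr hψ hQd, ← fromBlocks_one, pairChar_block hψ (NF_invertible hA hu) h]
  simp

include hψ in
theorem pairChar_zero_block {S : Matrix κ κ F} (hS : Sᵀ = S) (d : ℕ) :
    pairChar ψ d (fromBlocks (0 : Matrix ι ι F) 0 0 S) 1 = pairChar ψ d S 1 := by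
  obtain ⟨J, U, W, V, T, h⟩ := exists_NF_one hS
  rw [← fromBlocks_one, pairChar_block hψ NF_zero_one h]
  simp

variable [Fintype F] [DecidableEq F]

variable (ψ) in
/-- The sum of the discriminant characters of the symmetric matrices of rank `d`. -/
def symSum (d : ℕ) (ι : Type*) [Fintype ι] [DecidableEq ι] : ℂ :=
  ∑ S : SymMat ι F, pairChar ψ d S.1 1

/-- Symmetric matrices in blocks. -/
def symBlocks : SymMat (ι ⊕ κ) F ≃ SymMat ι F × Matrix ι κ F × SymMat κ F where
  toFun S := (⟨S.1.toBlocks₁₁, by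
      have := congrArg toBlocks₁₁ S.2; exact this⟩, S.1.toBlocks₁₂,
    ⟨S.1.toBlocks₂₂, by have := congrArg toBlocks₂₂ S.2; exact this⟩)
  invFun x := ⟨fromBlocks x.1.1 x.2.1 x.2.1ᵀ x.2.2.1, by
    rw [fromBlocks_transpose, x.1.2, x.2.2.2, transpose_transpose]⟩
  left_inv S := by
    apply Subtype.ext
    have : S.1.toBlocks₂₁ = S.1.toBlocks₁₂ᵀ := congrArg toBlocks₂₁ S.2.symm
    simp only
    rw [← this, fromBlocks_toBlocks]
  right_inv x := by simp

/-- Translation by a symmetric matrix. -/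
def symShift (X : SymMat ι F) : SymMat ι F ≃ SymMat ι F where
  toFun S := ⟨S.1 - X.1, by rw [transpose_sub, S.2, X.2]⟩
  invFun S := ⟨S.1 + X.1, by rw [transpose_add, S.2, X.2]⟩
  left_inv S := by simp
  right_inv S := by simp

/-- Congruence by an invertible matrix. -/
def symCongr {Q : Matrix ι ι F} (hQ : IsUnit Q.det) : SymMat ι F ≃ SymMat ι F where
  toFun S := ⟨Q * S.1 * Qᵀ, by simp only [transpose_mul, transpose_transpose, S.2, Matrix.mul_assoc]⟩
  invFun S := ⟨Q⁻¹ * S.1 * (Q⁻¹)ᵀ, by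
    simp only [transpose_mul, transpose_transpose, S.2, Matrix.mul_assoc]⟩
  left_inv S := by
    apply Subtype.ext
    have : Qᵀ * (Q⁻¹)ᵀ = 1 := by rw [← transpose_mul, nonsing_inv_mul _ hQ, transpose_one]
    simp only [Matrix.mul_assoc, this, Matrix.mul_one]
    rw [← Matrix.mul_assoc, nonsing_inv_mul _ hQ, Matrix.one_mul]
  right_inv S := by
    apply Subtype.ext
    have : (Q⁻¹)ᵀ * Qᵀ = 1 := by rw [← transpose_mul, mul_nonsing_inv _ hQ, transpose_one]
    simp only [Matrix.mul_assoc, this, Matrix.mul_one]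
    rw [← Matrix.mul_assoc, mul_nonsing_inv _ hQ, Matrix.one_mul]

/-- Reindexing symmetric matrices. -/
def symReindex (e : κ ≃ ι) : SymMat ι F ≃ SymMat κ F where
  toFun S := ⟨S.1.submatrix e e, by rw [transpose_submatrix, S.2]⟩
  invFun S := ⟨S.1.submatrix e.symm e.symm, by rw [transpose_submatrix, S.2]⟩
  left_inv S := by simp
  right_inv S := by simp

include hψ in
theorem symSum_congr (d : ℕ) (e : κ ≃ ι) : symSum ψ d ι = symSum ψ d κ := by
  refine Fintype.sum_equiv (symReindex e) _ _ fun S => ?_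
  have := pairChar_reindex hψ S.1 1 e d
  rw [submatrix_one_equiv] at this
  exact this.symm

include hψ in
-- The Schur complement S - BᵀA⁻¹B runs through all symmetric matrices along with S, so the sum no
-- longer depends on B.
theorem sum_schur {A : Matrix ι ι F} (hA : Aᵀ = A) (hu : IsUnit A.det) (B : Matrix ι κ F) (d : ℕ) :
    ∑ S : SymMat κ F, pairChar ψ d (fromBlocks A B Bᵀ S.1) 1 =
      if Fintype.card ι ≤ d then ψ A.det * symSum ψ (d - Fintype.card ι) κ else 0 := by
  have hAi : (A⁻¹)ᵀ = A⁻¹ := by rw [transpose_nonsing_inv, hA]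
  rw [Finset.sum_congr rfl fun S _ => pairChar_schur hψ hA hu B S.2 d]
  split_ifs with h
  · rw [← Finset.mul_sum]
    congr 1
    exact Fintype.sum_equiv (symShift ⟨Bᵀ * A⁻¹ * B, by
      simp only [transpose_mul, transpose_transpose, hAi, Matrix.mul_assoc]⟩) _ _ fun S => rfl
  · simp

/-- An invertible matrix moving a nonzero vector to the first unit vector. -/
theorem exists_mul_eq_single {v : Matrix Unit (Unit ⊕ κ) F} (hv : v ≠ 0) :
    ∃ Q : Matrix (Unit ⊕ κ) (Unit ⊕ κ) F, IsUnit Q.det ∧ v * Qᵀ = fromCols 1 0 := by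
  have key : ∀ (x : Matrix Unit Unit F) (u : Matrix Unit κ F), x () () ≠ 0 →
      ∃ Q : Matrix (Unit ⊕ κ) (Unit ⊕ κ) F, IsUnit Q.det ∧ fromCols x u * Qᵀ = fromCols 1 0 := by
    intro x u hx
    have hxu : IsUnit x.det := by simpa [det_unique] using hx
    refine ⟨(fromBlocks x⁻¹ (-(x⁻¹ * u)) 0 1)ᵀ, ?_, ?_⟩
    · rw [det_transpose, det_fromBlocks_zero₂₁, det_one, mul_one]
      exact isUnit_nonsing_inv_det _ hxu
    · rw [transpose_transpose, ← fromRows_fromCols_eq_fromBlocks, fromCols_mul_fromRows,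
        mul_fromCols, mul_fromCols, ← Matrix.mul_neg, ← Matrix.mul_assoc,
        mul_nonsing_inv _ hxu]
      ext a b
      cases b <;> simp
  have hv' : v = fromCols v.toCols₁ v.toCols₂ := (fromCols_toCols v).symm
  by_cases h0 : v.toCols₁ () () = 0
  · obtain ⟨l, hl⟩ : ∃ l, v.toCols₂ () l ≠ 0 := by
      by_contra hn
      push Not at hn
      apply hv
      ext a b
      cases b with
      | inl b => exact h0
      | inr b => exact hn b
    set E : Matrix κ Unit F := of fun a _ => if a = l then 1 else 0 with hE
    obtain ⟨Q, hQ, h⟩ := key (v.toCols₁ + v.toCols₂ * E) v.toCols₂ (by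
      rw [Matrix.add_apply, h0, zero_add]
      simpa [Matrix.mul_apply, hE] using hl)
    refine ⟨Q * (fromBlocks 1 0 E 1)ᵀ, ?_, ?_⟩
    · rw [det_mul, det_transpose, det_fromBlocks_zero₁₂]
      simpa using hQ
    · rw [transpose_mul, transpose_transpose, ← Matrix.mul_assoc, ← h]
      congr 1
      conv_lhs => rw [hv']
      rw [← fromRows_fromCols_eq_fromBlocks, fromCols_mul_fromRows]
      ext a b
      cases b <;> simp
  · obtain ⟨Q, hQ, h⟩ := key v.toCols₁ v.toCols₂ h0
    exact ⟨Q, hQ, by rw [← h, ← hv']⟩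

/-- The matrices over a one-point index set. -/
def symUnit : F ≃ SymMat Unit F where
  toFun x := ⟨of fun _ _ => x, by ext; rfl⟩
  invFun S := S.1 () ()
  left_inv x := rfl
  right_inv S := by apply Subtype.ext; ext; rfl

theorem card_matrix_unit : Fintype.card (Matrix Unit κ F) = Fintype.card F ^ Fintype.card κ := by
  change Fintype.card (Unit → κ → F) = _
  rw [Fintype.card_fun, Fintype.card_fun, Fintype.card_unit, pow_one]

include hψ in
-- The matrices are sorted by their corner x and the rest v of the first row. For x = 0, v = 0 a
-- smaller matrix remains; for x ≠ 0 the corner is split off with weight ψ(x), and v is free; the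
-- case x = 0, v ≠ 0 is left as it stands for `sum_hyperbolic`.
theorem symSum_cons (d : ℕ) :
    symSum ψ d (Unit ⊕ κ) = symSum ψ d κ +
      (∑ v ∈ Finset.univ.erase (0 : Matrix Unit κ F),
        ∑ S : SymMat κ F, pairChar ψ d (fromBlocks 0 v vᵀ S.1) 1) +
      if 1 ≤ d then (∑ a, ψ a) * Fintype.card F ^ Fintype.card κ * symSum ψ (d - 1) κ else 0 := by
  have h0 : symSum ψ d (Unit ⊕ κ) = ∑ x : F, ∑ v : Matrix Unit κ F, ∑ S : SymMat κ F,
      pairChar ψ d (fromBlocks (of fun _ _ => x) v vᵀ S.1) 1 := by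
    rw [symSum, Fintype.sum_equiv symBlocks _
      (fun x => pairChar ψ d (fromBlocks x.1.1 x.2.1 x.2.1ᵀ x.2.2.1) 1)
      (fun S => by rw [← congrArg Subtype.val (symBlocks.symm_apply_apply S)]; rfl),
      Fintype.sum_prod_type, ← Equiv.sum_comp symUnit]
    refine Finset.sum_congr rfl fun x _ => ?_
    rw [Fintype.sum_prod_type]
    rfl
  rw [h0, ← Finset.add_sum_erase _ _ (Finset.mem_univ (0 : F)),
    ← Finset.add_sum_erase _ _ (Finset.mem_univ (0 : Matrix Unit κ F))]
  have hz : (of fun _ _ => 0 : Matrix Unit Unit F) = 0 := rfl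
  rw [hz]
  congr 1
  · congr 1
    exact Finset.sum_congr rfl fun S _ => pairChar_zero_block hψ S.2 d
  · have h1 : ∀ x ∈ Finset.univ.erase (0 : F), (∑ v : Matrix Unit κ F, ∑ S : SymMat κ F,
        pairChar ψ d (fromBlocks (of fun _ _ => x) v vᵀ S.1) 1) =
        if 1 ≤ d then ψ x * (Fintype.card F ^ Fintype.card κ * symSum ψ (d - 1) κ) else 0 := by
      intro x hx
      have hx := Finset.ne_of_mem_erase hx
      rw [Finset.sum_congr rfl fun v _ => sum_schur (A := of fun _ _ => x) hψ (by ext; rfl)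
        (by simpa [det_unique] using hx) v d]
      rw [Finset.sum_const, Finset.card_univ, card_matrix_unit]
      simp only [Fintype.card_unit, det_unique, of_apply, nsmul_eq_mul, Nat.cast_pow]
      split_ifs
      · ring
      · simp
    rw [Finset.sum_congr rfl h1]
    split_ifs
    · rw [← Finset.sum_mul, mul_assoc]
      congr 1
      rw [← Finset.add_sum_erase _ _ (Finset.mem_univ (0 : F)), MulChar.map_zero, zero_add]
    · simp

include hψ in
-- Once v is moved to the first unit vector, the leading 2 × 2 block is (0 1; 1 x), of determinant
-- -1 whatever x is, and can be split off. The power of q counts the free entry x and the free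
-- remainder of the second row.
theorem sum_hyperbolic (d : ℕ) {v : Matrix Unit (Unit ⊕ κ) F} (hv : v ≠ 0) :
    ∑ S : SymMat (Unit ⊕ κ) F, pairChar ψ d (fromBlocks 0 v vᵀ S.1) 1 =
      if 2 ≤ d then ψ (-1) * Fintype.card F ^ (Fintype.card κ + 1) * symSum ψ (d - 2) κ else 0 := by
  obtain ⟨Q, hQ, hvQ⟩ := exists_mul_eq_single hv
  set e : Matrix Unit (Unit ⊕ κ) F := fromCols 1 0 with he
  have h1 : ∑ S : SymMat (Unit ⊕ κ) F, pairChar ψ d (fromBlocks 0 v vᵀ S.1) 1 =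
      ∑ S : SymMat (Unit ⊕ κ) F, pairChar ψ d (fromBlocks 0 e eᵀ S.1) 1 := by
    refine Fintype.sum_equiv (symCongr hQ) _ _ fun S => ?_
    have hQ' : IsUnit (fromBlocks (1 : Matrix Unit Unit F) 0 0 Q).det := by
      rw [det_fromBlocks_zero₂₁]; simpa using hQ
    rw [← pairChar_congr hψ hQ']
    congr 1
    rw [fromBlocks_transpose, fromBlocks_multiply, fromBlocks_multiply, ← hvQ]
    simp [symCongr, transpose_mul]
  rw [h1, Fintype.sum_equiv symBlocks _ (fun x => pairChar ψ d
    (fromBlocks 0 e eᵀ (fromBlocks x.1.1 x.2.1 x.2.1ᵀ x.2.2.1)) 1)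
    (fun S => by conv_lhs => rw [← symBlocks.symm_apply_apply S]
                 rfl),
    Fintype.sum_prod_type, ← Equiv.sum_comp symUnit]
  have h2 : ∀ x : F, ∑ y : Matrix Unit κ F × SymMat κ F, pairChar ψ d
      (fromBlocks 0 e eᵀ (fromBlocks (symUnit x).1 y.1 y.1ᵀ y.2.1)) 1 =
      if 2 ≤ d then ψ (-1) * (Fintype.card F ^ Fintype.card κ * symSum ψ (d - 2) κ) else 0 := by
    intro x
    rw [Fintype.sum_prod_type]
    have h3 : ∀ u : Matrix Unit κ F, ∑ S : SymMat κ F, pairChar ψ d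
        (fromBlocks 0 e eᵀ (fromBlocks (symUnit x).1 u uᵀ S.1)) 1 =
        if 2 ≤ d then ψ (-1) * symSum ψ (d - 2) κ else 0 := by
      intro u
      set A : Matrix (Unit ⊕ Unit) (Unit ⊕ Unit) F := fromBlocks 0 1 1 (symUnit x).1 with hA
      have hAs : Aᵀ = A := by rw [hA, fromBlocks_transpose, (symUnit x).2]; simp
      have hAd : A.det = -1 := by
        rw [← det_submatrix_equiv_self (finTwoEquiv.trans Equiv.boolEquivPUnitSumPUnit) A,
          det_fin_two]
        have e0 : Equiv.boolEquivPUnitSumPUnit false = (Sum.inl () : Unit ⊕ Unit) := rfl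
        have e1 : Equiv.boolEquivPUnitSumPUnit true = (Sum.inr () : Unit ⊕ Unit) := rfl
        simp [hA, finTwoEquiv, e0, e1]
      have := sum_schur (κ := κ) hψ hAs (by rw [hAd]; simp) (fromRows 0 u) d
      rw [hAd] at this
      simp only [Fintype.card_sum, Fintype.card_unit] at this
      rw [← this]
      refine Finset.sum_congr rfl fun S _ => ?_
      rw [← pairChar_reindex hψ _ _ (Equiv.sumAssoc Unit Unit κ), submatrix_one_equiv]
      congr 1
      ext a b
      rcases a with (a | a) | a <;> rcases b with (b | b) | b <;> simp [he, hA, one_apply]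
    rw [Finset.sum_congr rfl fun u _ => h3 u, Finset.sum_const, Finset.card_univ, card_matrix_unit]
    simp only [nsmul_eq_mul, Nat.cast_pow]
    split_ifs
    · ring
    · simp
  rw [Finset.sum_congr rfl fun x _ => h2 x, Finset.sum_const, Finset.card_univ]
  simp only [nsmul_eq_mul]
  split_ifs
  · ring
  · simp

/-- The coefficients in the closed formula for `symSum`. -/
def symCoef (g c q : ℂ) : ℕ → ℂ
  | 0 => 1
  | 1 => g / (q - 1)
  | d + 2 => q ^ (d + 1) * (g * symCoef g c q (d + 1) + c * symCoef g c q d) / (q ^ (d + 2) - 1)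

theorem symSum_fin_zero (hψ : ψ ^ 2 = 1) (d : ℕ) :
    symSum ψ d (Fin 0) = if d = 0 then 1 else 0 := by
  have h : ∀ S : SymMat (Fin 0) F, pairChar ψ d S.1 1 = if d = 0 then 1 else 0 := fun S => by
    have h0 : S.1 = 0 := Subsingleton.elim _ _
    rw [h0]
    split_ifs with hd
    · rw [pairChar_eq hψ NF_zero_one (by simp [hd])]; simp
    · rw [pairChar_of_ne NF_zero_one (by simpa using Ne.symm hd)]
  rw [symSum, Finset.sum_congr rfl fun S _ => h S, Finset.sum_const, Finset.card_univ]
  have : Fintype.card (SymMat (Fin 0) F) = 1 := by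
    rw [Fintype.card_eq_one_iff]
    exact ⟨⟨0, by simp⟩, fun S => Subtype.ext (Subsingleton.elim _ _)⟩
  rw [this, one_smul]

/-- Writing N(j, d) for the sum, q for the order of F, g = Σ ψ(a) and c = ψ(-1), the decomposition
by the first row reads N(j+1, d) = N(j, d) + (q^j - 1) c q^j N(j-1, d-2) + g q^j N(j, d-1), with
absent terms read as 0. The product carries the dependence on j, and what remains is the recursion
defining `symCoef`. -/
theorem symSum_fin (hψ : ψ ^ 2 = 1) (j d : ℕ) :
    symSum ψ d (Fin j) = symCoef (∑ a, ψ a) (ψ (-1)) (Fintype.card F) d *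
      ∏ t ∈ Finset.range d, ((Fintype.card F : ℂ) ^ (j - t) - 1) := by
  set g := ∑ a, ψ a
  set c := ψ (-1)
  set q : ℂ := (Fintype.card F : ℂ) with hq
  have hq1 : ∀ m : ℕ, q ^ (m + 1) - 1 ≠ 0 := by
    intro m h
    have h1 : (Fintype.card F) ^ (m + 1) = 1 := by
      have := sub_eq_zero.1 h
      rw [hq] at this
      exact_mod_cast this
    have h2 : 1 < Fintype.card F := Fintype.one_lt_card
    exact absurd h1 (Nat.one_lt_pow (by omega) h2).ne'
  have hq1' : q - 1 ≠ 0 := by simpa using hq1 0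
  set P : ℕ → ℕ → ℂ := fun j d => ∏ t ∈ Finset.range d, (q ^ (j - t) - 1) with hP
  have hP0 : ∀ j, P j 0 = 1 := fun j => by simp [hP]
  have hPs : ∀ j d, P (j + 1) (d + 1) = (q ^ (j + 1) - 1) * P j d := fun j d => by
    simp only [hP]
    rw [Finset.prod_range_succ', mul_comm]
    congr 1
    refine Finset.prod_congr rfl fun t _ => ?_
    rw [Nat.add_sub_add_right]
  have hPd : ∀ j d, P j (d + 1) = P j d * (q ^ (j - d) - 1) := fun j d => by
    simp only [hP]; rw [Finset.prod_range_succ]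
  -- The factor at t = j is q^0 - 1, so the formula gives 0 for ranks exceeding the size.
  have hPz : ∀ j d, j < d → P j d = 0 := fun j d h =>
    Finset.prod_eq_zero (Finset.mem_range.2 h) (by simp)
  change symSum ψ d (Fin j) = symCoef g c q d * P j d
  have step : ∀ j d, symSum ψ d (Fin (j + 1)) = symSum ψ d (Fin j) +
      (∑ v ∈ Finset.univ.erase (0 : Matrix Unit (Fin j) F),
        ∑ S : SymMat (Fin j) F, pairChar ψ d (fromBlocks 0 v vᵀ S.1) 1) +
      if 1 ≤ d then g * q ^ j * symSum ψ (d - 1) (Fin j) else 0 := by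
    intro j d
    rw [symSum_congr hψ d (Fintype.equivOfCardEq (by simp [add_comm]) : Unit ⊕ Fin j ≃ Fin (j + 1)),
      symSum_cons hψ, Fintype.card_fin]
  induction j using Nat.strong_induction_on generalizing d with
  | _ j ih =>
  rcases j with - | j
  · rw [symSum_fin_zero hψ]
    rcases d with - | d
    · simp [symCoef, hP0]
    · rw [hPz _ _ (Nat.succ_pos d)]; simp
  rw [step]
  rcases j with - | m
  · have he : Finset.univ.erase (0 : Matrix Unit (Fin 0) F) = ∅ := by
      ext v; simpa using Subsingleton.elim v 0
    rw [he, Finset.sum_empty, symSum_fin_zero hψ, symSum_fin_zero hψ]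
    rcases d with - | d
    · simp [symCoef, hP0]
    rw [hPs]
    rcases d with - | d
    · simp only [symCoef, hP0]
      field_simp
      simp
    · rw [hPz _ _ (Nat.succ_pos d)]; simp
  · have hH : (∑ v ∈ Finset.univ.erase (0 : Matrix Unit (Fin (m + 1)) F),
        ∑ S : SymMat (Fin (m + 1)) F, pairChar ψ d (fromBlocks 0 v vᵀ S.1) 1) =
        if 2 ≤ d then (q ^ (m + 1) - 1) * (c * q ^ (m + 1) * symSum ψ (d - 2) (Fin m)) else 0 := by
      set e : Unit ⊕ Fin m ≃ Fin (m + 1) := Fintype.equivOfCardEq (by simp [add_comm])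
      have h1 : ∀ v ∈ Finset.univ.erase (0 : Matrix Unit (Fin (m + 1)) F),
          ∑ S : SymMat (Fin (m + 1)) F, pairChar ψ d (fromBlocks 0 v vᵀ S.1) 1 =
          if 2 ≤ d then c * q ^ (m + 1) * symSum ψ (d - 2) (Fin m) else 0 := by
        intro v hv
        have hv := Finset.ne_of_mem_erase hv
        have hv' : v.submatrix id e ≠ 0 := fun h => hv (by
          ext a b
          have := congrFun (congrFun h a) (e.symm b)
          simpa using this)
        have hh := sum_hyperbolic hψ d hv'
        rw [Fintype.card_fin] at hh
        rw [← hh]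
        refine Fintype.sum_equiv (symReindex e) _ _ fun S => ?_
        rw [← pairChar_reindex hψ _ _ (Equiv.sumCongr (Equiv.refl Unit) e), submatrix_one_equiv]
        congr 1
        ext a b
        cases a <;> cases b <;> rfl
      rw [Finset.sum_congr rfl h1, Finset.sum_const, Finset.card_erase_of_mem (Finset.mem_univ _),
        Finset.card_univ, card_matrix_unit, Fintype.card_fin]
      have hpos : 1 ≤ Fintype.card F ^ (m + 1) := Nat.one_le_pow _ _ Fintype.card_pos
      rw [nsmul_eq_mul, Nat.cast_sub hpos]
      split_ifs
      · push_cast; ring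
      · simp
    rw [hH, ih (m + 1) (by omega)]
    rcases d with - | d
    · simp [symCoef, hP0]
    rcases d with - | d
    · rw [if_neg (by omega), if_pos (by omega), ih (m + 1) (by omega), hPs, hPs]
      have hc0 : symCoef g c q 0 = 1 := by rw [symCoef]
      have hc1 : symCoef g c q (0 + 1) = g / (q - 1) := by rw [symCoef]
      simp only [hP0, hc1, Nat.zero_add, Nat.sub_self, hc0]
      field_simp
      ring
    · rw [if_pos (by omega), if_pos (by omega)]
      simp only [show d + 1 + 1 - 1 = d + 1 from rfl,
        show d + 1 + 1 - 2 = d from rfl]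
      rw [ih (m + 1) (by omega), ih m (by omega), hPs (m + 1), hPd (m + 1) (d + 1), hPs m d]
      by_cases hdm : d ≤ m
      · have e1 : q ^ (m + 1 + 1) = q ^ (m - d) * q ^ (d + 2) := by
          rw [← pow_add]; congr 1; omega
        have e2 : q ^ (m + 1) = q ^ (m - d) * q ^ (d + 1) := by
          rw [← pow_add]; congr 1; omega
        have e3 : m + 1 - (d + 1) = m - d := by omega
        have e4 : symCoef g c q (d + 2) * (q ^ (d + 2) - 1) =
            q ^ (d + 1) * (g * symCoef g c q (d + 1) + c * symCoef g c q d) := by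
          rw [symCoef, div_mul_cancel₀ _ (hq1 (d + 1))]
        rw [e1, e3]
        linear_combination (-(q ^ (m + 1) - 1) * P m d * q ^ (m - d)) * e4 +
          ((q ^ (m + 1) - 1) * P m d * (g * symCoef g c q (d + 1) + c * symCoef g c q d)) * e2
      · rw [hPz m d (by omega)]; ring

end SymCount

/-! ### The sum over translates (D - CS, C), and closed forms of the coefficients. -/

section HeckeCount

variable {ι κ : Type*} [Fintype ι] [DecidableEq ι] [Fintype κ] [DecidableEq κ]
  {F : Type*} [Field F] [Fintype F] [DecidableEq F] {ψ : MulChar F ℂ}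

theorem card_symMat_sum : Fintype.card (SymMat (ι ⊕ κ) F) =
    Fintype.card (SymMat ι F) * (Fintype.card (Matrix ι κ F) * Fintype.card (SymMat κ F)) := by
  rw [Fintype.card_congr symBlocks, Fintype.card_prod, Fintype.card_prod]

theorem card_symMat_fin (m : ℕ) :
    Fintype.card (SymMat (Fin m) F) = Fintype.card F ^ (m * (m + 1) / 2) := by
  induction m with
  | zero =>
    rw [Nat.zero_mul, Nat.zero_div, pow_zero, Fintype.card_eq_one_iff]
    exact ⟨⟨0, by simp⟩, fun S => Subtype.ext (Subsingleton.elim _ _)⟩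
  | succ m ih =>
    rw [Fintype.card_congr (symReindex (F := F)
      (Fintype.equivOfCardEq (by simp [add_comm]) : Unit ⊕ Fin m ≃ Fin (m + 1))), card_symMat_sum,
      ih, card_matrix_unit, ← Fintype.card_congr symUnit, Fintype.card_fin, ← pow_add, ← pow_succ']
    congr 1
    have : (m + 1) * (m + 1 + 1) = m * (m + 1) + 2 * (m + 1) := by ring
    rw [this, Nat.add_mul_div_left _ _ two_pos]
    omega

/-- Negation of symmetric matrices. -/
def symNeg : SymMat ι F ≃ SymMat ι F where
  toFun S := ⟨-S.1, by rw [transpose_neg, S.2]⟩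
  invFun S := ⟨-S.1, by rw [transpose_neg, S.2]⟩
  left_inv S := by simp
  right_inv S := by simp

/-- The sum over all translates of the opposite cell character at a standard pair. -/
theorem sum_pairChar_idem (hψ : ψ ^ 2 = 1) (I : Finset ι) {i : ℕ} (hi : i ≤ Fintype.card ι) :
    ∑ S : SymMat ι F, pairChar ψ (Fintype.card ι - i) (idem F Iᶜ - idem F I * S.1) (idem F I) =
      if i ≤ I.card then
        (Fintype.card (SymMat ι F) : ℂ) / Fintype.card (SymMat (Fin I.card) F) *
          symSum ψ (I.card - i) (Fin I.card) else 0 := by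
  set r := Fintype.card ι - i with hr
  -- The part E_I S E_{Iᶜ} is removed by left multiplication with a matrix M of determinant 1 that
  -- fixes E_I.
  have h1 : ∀ S : SymMat ι F, pairChar ψ r (idem F Iᶜ - idem F I * S.1) (idem F I) =
      pairChar ψ r (idem F Iᶜ - idem F I * S.1 * idem F I) (idem F I) := by
    intro S
    set M := 1 - idem F I * S.1 * idem F Iᶜ with hM
    have e1 : M * (idem F Iᶜ - idem F I * S.1 * idem F I) = idem F Iᶜ - idem F I * S.1 := by
      have e0 : idem F I * S.1 = idem F I * S.1 * idem F I + idem F I * S.1 * idem F Iᶜ := by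
        rw [← Matrix.mul_add, idem_add_compl, Matrix.mul_one]
      rw [hM, Matrix.sub_mul, Matrix.one_mul, Matrix.mul_sub]
      simp only [Matrix.mul_assoc]
      rw [← Matrix.mul_assoc (idem F Iᶜ) (idem F I), idem_compl_mul, idem_mul_self, Matrix.zero_mul,
        Matrix.mul_zero, Matrix.mul_zero, sub_zero]
      conv_rhs => rw [e0]
      simp only [Matrix.mul_assoc]
      abel
    have e2 : M * idem F I = idem F I := by
      rw [hM, Matrix.sub_mul, Matrix.one_mul, Matrix.mul_assoc, idem_compl_mul, Matrix.mul_zero,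
        sub_zero]
    have e3 : M.det = 1 := by
      rw [hM, sub_eq_add_neg, Matrix.mul_assoc, ← Matrix.mul_neg, det_one_add_mul_comm,
        Matrix.neg_mul, Matrix.mul_assoc, idem_compl_mul]
      simp
    have := pairChar_mul_left (C := idem F Iᶜ - idem F I * S.1 * idem F I) (D := idem F I) hψ
      (M := M) (by rw [e3]; exact isUnit_one) r
    rw [e1, e2, e3, map_one, one_mul] at this
    exact this
  rw [Finset.sum_congr rfl fun S _ => h1 S]
  set e : {a // ¬ a ∈ I} ⊕ {a // a ∈ I} ≃ ι := (Equiv.sumComm _ _).trans (Equiv.sumCompl (· ∈ I))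
  have hE : (idem F I).submatrix e e = fromBlocks 0 0 0 1 := by
    ext a b
    rcases a with ⟨a, ha⟩ | ⟨a, ha⟩ <;> rcases b with ⟨b, hb⟩ | ⟨b, hb⟩ <;>
      simp [idem, e, diagonal_apply, ha, one_apply]
    intro hab; exact hb (hab ▸ ha)
  have hE' : (idem F Iᶜ).submatrix e e = fromBlocks 1 0 0 0 := by
    ext a b
    rcases a with ⟨a, ha⟩ | ⟨a, ha⟩ <;> rcases b with ⟨b, hb⟩ | ⟨b, hb⟩ <;>
      simp [idem, e, diagonal_apply, ha, one_apply]
    intro hab; exact ha (hab ▸ hb)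
  have hcard : Fintype.card {a // ¬ a ∈ I} + I.card = Fintype.card ι := by
    have := Fintype.card_congr e
    rw [Fintype.card_sum, Fintype.card_coe] at this
    exact this
  -- In the blocks Iᶜ, I the pair is (1, 0) ⊕ (-S_I, 1). Rank n - i of the whole means rank |I| - i
  -- of S_I, and the other entries of S only contribute their number.
  have h2 : ∑ S : SymMat ι F, pairChar ψ r (idem F Iᶜ - idem F I * S.1 * idem F I) (idem F I) =
      ∑ x : SymMat {a // ¬ a ∈ I} F × Matrix {a // ¬ a ∈ I} {a // a ∈ I} F × SymMat {a // a ∈ I} F,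
        if i ≤ I.card then pairChar ψ (I.card - i) (-x.2.2.1) 1 else 0 := by
    refine Fintype.sum_equiv ((symReindex e).trans symBlocks) _ _ fun S => ?_
    rw [← pairChar_reindex hψ _ _ e]
    set S' := S.1.submatrix e e with hS'
    have e1 : (idem F Iᶜ - idem F I * S.1 * idem F I).submatrix e e =
        fromBlocks 1 0 0 (-S'.toBlocks₂₂) := by
      rw [submatrix_sub, Pi.sub_apply, Pi.sub_apply, ← submatrix_mul_equiv _ _ _ e,
        ← submatrix_mul_equiv _ _ _ e, hE, hE', ← hS', ← fromBlocks_toBlocks S']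
      simp [fromBlocks_multiply, sub_eq_add_neg, fromBlocks_neg, fromBlocks_add]
    rw [e1, hE]
    have hsym : (-S'.toBlocks₂₂)ᵀ = -S'.toBlocks₂₂ := by
      have : S'ᵀ = S' := by rw [hS', transpose_submatrix, S.2]
      rw [transpose_neg]
      exact congrArg Neg.neg (congrArg toBlocks₂₂ this)
    obtain ⟨J, U, W, V, T, h⟩ := exists_NF_one hsym
    rw [pairChar_block hψ NF_one_zero h, det_one, map_one, one_mul, one_mul, Finset.card_univ]
    by_cases hI : i ≤ I.card
    · rw [if_pos hI, if_pos (by omega)]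
      congr 1
      omega
    · rw [if_neg hI, if_neg (by omega)]
  rw [h2]
  split_ifs with hI
  · rw [Fintype.sum_prod_type]
    simp only [Fintype.sum_prod_type]
    have h3 : ∑ S : SymMat {a // a ∈ I} F, pairChar ψ (I.card - i) (-S.1) 1 =
        symSum ψ (I.card - i) (Fin I.card) := by
      rw [← symSum_congr hψ _ (Fintype.equivOfCardEq (by simp) : Fin I.card ≃ {a // a ∈ I})]
      exact Fintype.sum_equiv symNeg _ _ fun S => rfl
    simp only [h3, Finset.sum_const, Finset.card_univ, nsmul_eq_mul]
    rw [Fintype.card_congr (symReindex e : SymMat ι F ≃ _), card_symMat_sum,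
      Fintype.card_congr (symReindex (Fintype.equivOfCardEq (by simp) : Fin I.card ≃ {a // a ∈ I}) :
        SymMat {a // a ∈ I} F ≃ SymMat (Fin I.card) F)]
    have : (Fintype.card (SymMat (Fin I.card) F) : ℂ) ≠ 0 := by
      rw [card_symMat_fin]
      exact_mod_cast (pow_pos Fintype.card_pos _).ne'
    push_cast
    field_simp
  · simp

/-- The bijection S ↦ W(S - T)Wᵀ reduces to the standard pair (E_I, E_{Iᶜ}). The right factor now
enters through W instead of V, which is harmless since det W · det V = 1 and ψ² = 1. -/
theorem sum_pairChar_NF (hψ : ψ ^ 2 = 1) {C D U W V T : Matrix ι ι F} {I : Finset ι}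
    (h : NF C D I U W V T) {i : ℕ} (hi : i ≤ Fintype.card ι) :
    ∑ S : SymMat ι F, pairChar ψ (Fintype.card ι - i) (D - C * S.1) C =
      ψ U.det * ψ V.det * if i ≤ I.card then
        (Fintype.card (SymMat ι F) : ℂ) / Fintype.card (SymMat (Fin I.card) F) *
          symSum ψ (I.card - i) (Fin I.card) else 0 := by
  obtain ⟨v1, v2, v3⟩ := inv_pair_comm h.hWV
  have hW : IsUnit W.det := IsUnit.of_mul_eq_one _ (det_inv_pair h.hWV)
  rw [← sum_pairChar_idem hψ I hi, Finset.mul_sum]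
  refine Fintype.sum_equiv ((symShift ⟨T, h.hT⟩).trans (symCongr hW)) _ _ fun S => ?_
  set S' := W * (S.1 - T) * Wᵀ with hS'
  change _ = ψ U.det * ψ V.det * pairChar ψ _ (idem F Iᶜ - idem F I * S') (idem F I)
  have e1 : D - C * S.1 = U * ((idem F Iᶜ - idem F I * S') * V) := by
    have : S' * V = W * (S.1 - T) := by rw [hS', Matrix.mul_assoc, h.hWV, Matrix.mul_one]
    rw [Matrix.sub_mul, Matrix.mul_assoc _ S', this, h.hC, h.hD]
    simp only [Matrix.mul_add, Matrix.mul_sub, Matrix.mul_assoc]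
    abel
  have e2 : C = U * (idem F I * W) := by rw [h.hC, Matrix.mul_assoc]
  have e3 := pairChar_mul_right (C := idem F Iᶜ - idem F I * S') (D := idem F I) (T := 0) hψ v3
    (by simp) (Fintype.card ι - i)
  rw [Matrix.mul_zero, zero_add] at e3
  have e4 : ψ W.det = ψ V.det := by
    have h1 := MulChar.apply_sq hψ (right_ne_zero_of_mul_eq_one (det_inv_pair h.hWV))
    have h2 : ψ W.det * ψ V.det = 1 := by rw [← map_mul, det_inv_pair h.hWV, map_one]
    have h3 : ψ V.det ≠ 0 := right_ne_zero_of_mul_eq_one h1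
    exact mul_right_cancel₀ h3 (h2.trans h1.symm)
  rw [e1]
  conv_lhs => rw [e2]
  rw [pairChar_mul_left hψ h.hU, e3, e4, mul_assoc]

/-- The sum over all translates of the opposite cell character as a combination of the cell
characters. -/
theorem sum_pairChar (hψ : ψ ^ 2 = 1) {C D : Matrix ι ι F} (hs : C * Dᵀ = D * Cᵀ)
    {X Y : Matrix ι ι F} (hXY : C * X + D * Y = 1) {i : ℕ} (hi : i ≤ Fintype.card ι) :
    ∑ S : SymMat ι F, pairChar ψ (Fintype.card ι - i) (D - C * S.1) C =
      ∑ j ∈ Finset.Icc i (Fintype.card ι),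
        (Fintype.card (SymMat ι F) : ℂ) / Fintype.card (SymMat (Fin j) F) *
          symSum ψ (j - i) (Fin j) * pairChar ψ j C D := by
  obtain ⟨I, U, W, V, T, h⟩ := exists_NF hs hXY
  rw [sum_pairChar_NF hψ h hi]
  by_cases hI : i ≤ I.card
  · rw [Finset.sum_eq_single_of_mem I.card (Finset.mem_Icc.2 ⟨hI, Finset.card_le_univ I⟩)]
    · rw [if_pos hI, pairChar_eq hψ h rfl]; ring
    · intro j _ hj
      rw [pairChar_of_ne h (Ne.symm hj), mul_zero]
  · rw [if_neg hI, mul_zero, eq_comm]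
    apply Finset.sum_eq_zero
    intro j hj
    rw [pairChar_of_ne h, mul_zero]
    have := (Finset.mem_Icc.1 hj).1
    omega

/-- The trivial character has g = q - 1 and c = 1. The coefficients at 2m and 2m + 1 then agree, and
each needs the two before it, so both are treated in one induction. -/
theorem symCoef_triv (q : ℂ) (hq : ∀ m : ℕ, q ^ (m + 1) - 1 ≠ 0) (m : ℕ) :
    symCoef (q - 1) 1 q (2 * m) = q ^ (m * (m + 1)) / ∏ r ∈ Finset.Icc 1 m, (q ^ (2 * r) - 1) ∧
    symCoef (q - 1) 1 q (2 * m + 1) =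
      q ^ (m * (m + 1)) / ∏ r ∈ Finset.Icc 1 m, (q ^ (2 * r) - 1) := by
  have hprod : ∀ m : ℕ, ∏ r ∈ Finset.Icc 1 m, (q ^ (2 * r) - 1) ≠ 0 := fun m =>
    Finset.prod_ne_zero_iff.2 fun r hr => by
      obtain ⟨t, rfl⟩ : ∃ t, r = t + 1 := ⟨r - 1, by have := (Finset.mem_Icc.1 hr).1; omega⟩
      exact hq (2 * t + 1)
  induction m with
  | zero =>
    have := hq 0
    rw [zero_add, pow_one] at this
    simp [symCoef, this]
  | succ m ih =>
    obtain ⟨h1, h2⟩ := ih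
    have hs : ∏ r ∈ Finset.Icc 1 (m + 1), (q ^ (2 * r) - 1) =
        (∏ r ∈ Finset.Icc 1 m, (q ^ (2 * r) - 1)) * (q ^ (2 * m + 2) - 1) :=
      Finset.prod_Icc_succ_top (by omega) _
    have a1 : symCoef (q - 1) 1 q (2 * (m + 1)) =
        q ^ ((m + 1) * (m + 1 + 1)) / ∏ r ∈ Finset.Icc 1 (m + 1), (q ^ (2 * r) - 1) := by
      rw [show 2 * (m + 1) = 2 * m + 2 by ring, symCoef, h1, h2, hs]
      have := hprod m
      have := hq (2 * m + 1)
      rw [div_eq_div_iff (by assumption) (mul_ne_zero (by assumption) (by assumption))]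
      field_simp
      ring
    refine ⟨a1, ?_⟩
    rw [show 2 * (m + 1) + 1 = (2 * m + 1) + 2 by ring, symCoef,
      show 2 * m + 1 + 1 = 2 * (m + 1) by ring, a1, h2, hs]
    have := hprod m
    have := hq (2 * m + 1)
    have := hq (2 * m + 2)
    rw [div_eq_div_iff (by assumption) (mul_ne_zero (by assumption) (by assumption))]
    rw [show 2 * m + 1 + 1 = 2 * m + 2 from rfl] at *
    field_simp
    ring

/-- A nontrivial character has g = 0, so the recursion has step two and the odd coefficients vanish.
-/
theorem symCoef_quad (c q : ℂ) (m : ℕ) :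
    symCoef 0 c q (2 * m) = c ^ m * q ^ (m ^ 2) / ∏ r ∈ Finset.Icc 1 m, (q ^ (2 * r) - 1) ∧
    symCoef 0 c q (2 * m + 1) = 0 := by
  induction m with
  | zero => simp [symCoef]
  | succ m ih =>
    obtain ⟨h1, h2⟩ := ih
    have hs : ∏ r ∈ Finset.Icc 1 (m + 1), (q ^ (2 * r) - 1) =
        (∏ r ∈ Finset.Icc 1 m, (q ^ (2 * r) - 1)) * (q ^ (2 * m + 2) - 1) :=
      Finset.prod_Icc_succ_top (by omega) _
    constructor
    · rw [show 2 * (m + 1) = 2 * m + 2 by ring, symCoef, h1, hs, ← div_div]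
      congr 1
      ring
    · rw [show 2 * (m + 1) + 1 = (2 * m + 1) + 2 by ring, symCoef, h2]
      simp

theorem prod_range_eq_prod_Icc (q : ℂ) (i d : ℕ) :
    ∏ t ∈ Finset.range d, (q ^ (i + d - t) - 1) = ∏ r ∈ Finset.Icc (i + 1) (i + d), (q ^ r - 1) := by
  induction d with
  | zero => simp
  | succ d ih =>
    rw [Finset.prod_range_succ', ← add_assoc, Finset.prod_Icc_succ_top (by omega), ← ih]
    congr 1
    exact Finset.prod_congr rfl fun t _ => by rw [Nat.add_sub_add_right]

end HeckeCount

/-! ### The coefficients m_ij as sums of discriminant characters. -/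

section Closed

variable (p : ℕ) [hp : Fact p.Prime]

theorem quadChar_sq : quadChar p ^ 2 = 1 := by
  ext a
  rw [MulChar.pow_apply_coe, MulChar.one_apply_coe, quadChar, MulChar.ringHomComp_apply,
    ← map_pow]
  have := quadraticChar_sq_one (F := ZMod p) (a := a) a.ne_zero
  rw [this, map_one]

/-- With d = 2m or d = 2m + 1 the exponents d(d+2)/4 and (d²-1)/4 of the trivial character both
equal m(m+1), and the exponent d²/4 of the quadratic one equals m²; these are the exponents in the
closed forms of `symCoef`. -/
theorem mCoeff_eq {ψ : DirichletCharacter ℂ p} (hψ : ψ = 1 ∨ ψ = quadChar p) (s : ℂ)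
    {i j : ℕ} (hij : i ≤ j) :
    mCoeff p ψ s i j = (p : ℂ) ^ (2 * s * i - (j : ℂ) * (j + 1) / 2) *
      symSum (F := ZMod p) ψ (j - i) (Fin j) := by
  have hp1 := hp.out.one_lt
  have hp0 : (p : ℂ) ≠ 0 := by exact_mod_cast hp.out.ne_zero
  have hq : ∀ m : ℕ, (p : ℂ) ^ (m + 1) - 1 ≠ 0 := fun m h => by
    have h1 : p ^ (m + 1) = 1 := by exact_mod_cast sub_eq_zero.1 h
    exact absurd h1 (Nat.one_lt_pow (by omega) hp1).ne'
  have hψ2 : ψ ^ 2 = 1 := by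
    rcases hψ with rfl | rfl
    · exact one_pow 2
    · exact quadChar_sq p
  obtain ⟨d, rfl⟩ := Nat.exists_eq_add_of_le hij
  rw [symSum_fin hψ2, ZMod.card, Nat.add_sub_cancel_left, prod_range_eq_prod_Icc]
  have split : ∀ (x : ℂ) (m : ℕ), (p : ℂ) ^ (x + m) = (p : ℂ) ^ x * (p : ℂ) ^ m := fun x m => by
    rw [Complex.cpow_add _ _ hp0, Complex.cpow_natCast]
  have hpar := Nat.even_or_odd' d
  obtain ⟨m, hd⟩ := hpar
  by_cases h1 : ψ = 1
  · have hg : ∑ a : ZMod p, ψ a = (p : ℂ) - 1 := by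
      rw [h1, MulChar.sum_one_eq_card_units, ZMod.card_units_eq_totient, Nat.totient_prime hp.out,
        Nat.cast_sub hp1.le, Nat.cast_one]
    have hc : ψ (-1) = 1 := by
      rw [h1, MulChar.one_apply isUnit_one.neg]
    rw [mCoeff, if_pos h1, mTriv, if_pos hij, Nat.add_sub_cancel_left, hg, hc]
    obtain ⟨e1, e2⟩ := symCoef_triv (p : ℂ) hq m
    rcases hd with rfl | rfl
    · rw [if_pos (even_two_mul m), e1, Nat.mul_div_cancel_left m two_pos,
        show 2 * s * (i : ℂ) - ((i + 2 * m : ℕ) : ℂ) * (((i + 2 * m : ℕ) : ℂ) + 1) / 2 +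
          (((i + 2 * m : ℕ) : ℂ) - i) * (((i + 2 * m : ℕ) : ℂ) - i + 2) / 4 =
          (2 * s * (i : ℂ) - ((i + 2 * m : ℕ) : ℂ) * (((i + 2 * m : ℕ) : ℂ) + 1) / 2) +
            ((m * (m + 1) : ℕ) : ℂ) by push_cast; ring, split]
      ring
    · rw [if_neg (by simp), e2, Nat.add_sub_cancel, Nat.mul_div_cancel_left m two_pos,
        show 2 * s * (i : ℂ) - ((i + (2 * m + 1) : ℕ) : ℂ) * (((i + (2 * m + 1) : ℕ) : ℂ) + 1) / 2 +
          ((((i + (2 * m + 1) : ℕ) : ℂ) - i) ^ 2 - 1) / 4 =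
          (2 * s * (i : ℂ) - ((i + (2 * m + 1) : ℕ) : ℂ) * (((i + (2 * m + 1) : ℕ) : ℂ) + 1) / 2) +
            ((m * (m + 1) : ℕ) : ℂ) by push_cast; ring, split]
      ring
  · have h2 := hψ.resolve_left h1
    have hg : ∑ a : ZMod p, ψ a = 0 := MulChar.sum_eq_zero_of_ne_one h1
    rw [mCoeff, if_neg h1, mQuad, Nat.add_sub_cancel_left, hg]
    obtain ⟨e1, e2⟩ := symCoef_quad (ψ (-1)) (p : ℂ) m
    rcases hd with rfl | rfl
    · rw [if_pos ⟨hij, even_two_mul m⟩, e1, Nat.mul_div_cancel_left m two_pos,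
        show 2 * s * (i : ℂ) - ((i + 2 * m : ℕ) : ℂ) * (((i + 2 * m : ℕ) : ℂ) + 1) / 2 +
          (((i + 2 * m : ℕ) : ℂ) - i) ^ 2 / 4 =
          (2 * s * (i : ℂ) - ((i + 2 * m : ℕ) : ℂ) * (((i + 2 * m : ℕ) : ℂ) + 1) / 2) +
            ((m ^ 2 : ℕ) : ℂ) by push_cast; ring, split, h2]
      ring
    · rw [if_neg (by simp), e2]
      simp

end Closed

/-! ### Blocks of integral symplectic matrices over an arbitrary commutative ring. -/

section Blocks

variable {n : ℕ} (R : Type*) [CommRing R]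

/-- The block `A` of `g`, over `R`. -/
def bA (g : SpZ n) : Matrix (Fin n) (Fin n) R := g.1.toBlocks₁₁.map (Int.castRingHom R)
/-- The block `B` of `g`, over `R`. -/
def bB (g : SpZ n) : Matrix (Fin n) (Fin n) R := g.1.toBlocks₁₂.map (Int.castRingHom R)
/-- The block `C` of `g`, over `R`. -/
def bC (g : SpZ n) : Matrix (Fin n) (Fin n) R := g.1.toBlocks₂₁.map (Int.castRingHom R)
/-- The block `D` of `g`, over `R`. -/
def bD (g : SpZ n) : Matrix (Fin n) (Fin n) R := g.1.toBlocks₂₂.map (Int.castRingHom R)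

theorem map_eq_fromBlocks (g : SpZ n) :
    g.1.map (Int.castRingHom R) = fromBlocks (bA R g) (bB R g) (bC R g) (bD R g) := by
  conv_lhs => rw [← fromBlocks_toBlocks g.1]
  rw [fromBlocks_map]; rfl

theorem blocks_mul (g h : SpZ n) :
    bA R (g * h) = bA R g * bA R h + bB R g * bC R h ∧
    bB R (g * h) = bA R g * bB R h + bB R g * bD R h ∧
    bC R (g * h) = bC R g * bA R h + bD R g * bC R h ∧
    bD R (g * h) = bC R g * bB R h + bD R g * bD R h := by
  have h1 := map_eq_fromBlocks R (g * h)
  rw [Submonoid.coe_mul, Matrix.map_mul, map_eq_fromBlocks, map_eq_fromBlocks,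
    fromBlocks_multiply, fromBlocks_inj] at h1
  exact ⟨h1.1.symm, h1.2.1.symm, h1.2.2.1.symm, h1.2.2.2.symm⟩

theorem bC_mul (g h : SpZ n) : bC R (g * h) = bC R g * bA R h + bD R g * bC R h :=
  (blocks_mul R g h).2.2.1

theorem bD_mul (g h : SpZ n) : bD R (g * h) = bC R g * bB R h + bD R g * bD R h :=
  (blocks_mul R g h).2.2.2

theorem fromBlocks_mem (g : SpZ n) :
    fromBlocks (bA R g) (bB R g) (bC R g) (bD R g) ∈ symplecticGroup (Fin n) R := by
  rw [← map_eq_fromBlocks]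
  exact SymplecticGroup.map_mem g.2 (Int.castRingHom R)

theorem col_rel (g : SpZ n) : (bA R g)ᵀ * bC R g = (bC R g)ᵀ * bA R g ∧
    (bB R g)ᵀ * bD R g = (bD R g)ᵀ * bB R g ∧
    (bA R g)ᵀ * bD R g - (bC R g)ᵀ * bB R g = 1 :=
  SymplecticGroup.fromBlocks_mem_iff.1 (fromBlocks_mem R g)

theorem row_rel (g : SpZ n) : bA R g * (bB R g)ᵀ = bB R g * (bA R g)ᵀ ∧
    bC R g * (bD R g)ᵀ = bD R g * (bC R g)ᵀ ∧
    bA R g * (bD R g)ᵀ - bB R g * (bC R g)ᵀ = 1 := by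
  have h := SymplecticGroup.transpose_mem (fromBlocks_mem R g)
  rw [fromBlocks_transpose, SymplecticGroup.fromBlocks_mem_iff] at h
  simpa only [transpose_transpose] using h

theorem row_rel' (g : SpZ n) : bD R g * (bA R g)ᵀ - bC R g * (bB R g)ᵀ = 1 := by
  have h := congrArg transpose (row_rel R g).2.2
  simpa only [transpose_sub, transpose_mul, transpose_transpose, transpose_one] using h

theorem blocks_inv (g : SpZ n) : bA R g⁻¹ = (bD R g)ᵀ ∧ bB R g⁻¹ = -(bB R g)ᵀ ∧
    bC R g⁻¹ = -(bC R g)ᵀ ∧ bD R g⁻¹ = (bA R g)ᵀ := by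
  have e : (g⁻¹ : SpZ n).1 = fromBlocks (g.1.toBlocks₂₂)ᵀ (-(g.1.toBlocks₁₂)ᵀ)
      (-(g.1.toBlocks₂₁)ᵀ) (g.1.toBlocks₁₁)ᵀ := by
    have h : ((g⁻¹ : SpZ n).1) = _ := SymplecticGroup.coe_inv g
    rw [h]
    conv_lhs => rw [← fromBlocks_toBlocks g.1]
    simp [J, fromBlocks_transpose, fromBlocks_multiply, fromBlocks_neg]
  have h2 := map_eq_fromBlocks R g⁻¹
  rw [e, fromBlocks_map, fromBlocks_inj] at h2
  refine ⟨h2.1.symm, h2.2.1.symm.trans ?_, h2.2.2.1.symm.trans ?_, h2.2.2.2.symm⟩ <;>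
  · ext a b; simp [bB, bC]

theorem blocks_one : bA R (1 : SpZ n) = 1 ∧ bB R (1 : SpZ n) = 0 ∧ bC R (1 : SpZ n) = 0 ∧
    bD R (1 : SpZ n) = 1 := by
  have h := map_eq_fromBlocks R (1 : SpZ n)
  rw [show ((1 : SpZ n).1) = 1 from rfl, Matrix.map_one _ (map_zero _) (map_one _), ← fromBlocks_one,
    fromBlocks_inj] at h
  exact ⟨h.1.symm, h.2.1.symm, h.2.2.1.symm, h.2.2.2.symm⟩

/-- The integral symplectic matrix with given blocks. -/
def mkSp (A B C D : Matrix (Fin n) (Fin n) ℤ) (h1 : Aᵀ * C = Cᵀ * A) (h2 : Bᵀ * D = Dᵀ * B)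
    (h3 : Aᵀ * D - Cᵀ * B = 1) : SpZ n :=
  ⟨fromBlocks A B C D, SymplecticGroup.fromBlocks_mem_iff.2 ⟨h1, h2, h3⟩⟩

/-- The Levi element `diag(W, V)`. -/
def levi (W V : Matrix (Fin n) (Fin n) ℤ) (h : Wᵀ * V = 1) : SpZ n :=
  mkSp W 0 0 V (by simp) (by simp) (by simpa using h)

/-- The translation by a symmetric matrix. -/
def transl (T : Matrix (Fin n) (Fin n) ℤ) (h : Tᵀ = T) : SpZ n :=
  mkSp 1 T 0 1 (by simp) (by simp [h]) (by simp)

theorem blocks_levi (W V : Matrix (Fin n) (Fin n) ℤ) (h : Wᵀ * V = 1) :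
    bA R (levi W V h) = W.map (Int.castRingHom R) ∧ bB R (levi W V h) = 0 ∧
    bC R (levi W V h) = 0 ∧ bD R (levi W V h) = V.map (Int.castRingHom R) := by
  refine ⟨rfl, ?_, ?_, rfl⟩ <;>
  · ext a b; simp [bB, bC, levi, mkSp]

theorem blocks_transl (T : Matrix (Fin n) (Fin n) ℤ) (h : Tᵀ = T) :
    bA R (transl T h) = 1 ∧ bB R (transl T h) = T.map (Int.castRingHom R) ∧
    bC R (transl T h) = 0 ∧ bD R (transl T h) = 1 := by
  refine ⟨?_, rfl, ?_, ?_⟩ <;>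
  · ext a b
    rcases eq_or_ne a b with rfl | hab
    · simp [bA, bC, bD, transl, mkSp]
    · simp [bA, bC, bD, transl, mkSp, hab]

theorem mem_parabolic_iff (g : SpZ n) : g ∈ parabolic n ↔ bC ℤ g = 0 := by
  rw [mem_parabolic]
  have : bC ℤ g = g.1.toBlocks₂₁ := by ext; simp [bC]
  rw [this]

theorem map_castRingHom_eq (M : Matrix (Fin n) (Fin n) ℤ) : M.map (Int.castRingHom ℤ) = M := by
  ext; simp

theorem map_bC (g : SpZ n) : bC R g = (bC ℤ g).map (Int.castRingHom R) := by
  ext; simp [bC]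

theorem map_bD (g : SpZ n) : bD R g = (bD ℤ g).map (Int.castRingHom R) := by
  ext; simp [bD]

theorem bC_of_parabolic {g : SpZ n} (h : g ∈ parabolic n) : bC R g = 0 := by
  rw [map_bC, (mem_parabolic_iff g).1 h]; ext; simp

theorem mem_parabolic_of_bC [CharZero R] {g : SpZ n} (h : bC R g = 0) : g ∈ parabolic n := by
  rw [mem_parabolic_iff]
  ext a b
  have := congrFun (congrFun h a) b
  rw [map_bC] at this
  simpa using this

theorem mem_Gamma0_iff {p : ℕ} (g : SpZ n) : g ∈ Gamma0 n p ↔ bC (ZMod p) g = 0 := by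
  change (∀ a b, (p : ℤ) ∣ g.1.toBlocks₂₁ a b) ↔ _
  rw [← Matrix.ext_iff]
  simp only [bC, map_apply, Int.coe_castRingHom, Matrix.zero_apply, ZMod.intCast_zmod_eq_zero_iff_dvd]

theorem levi_mem_parabolic (W V : Matrix (Fin n) (Fin n) ℤ) (h : Wᵀ * V = 1) :
    levi W V h ∈ parabolic n := (mem_parabolic_iff _).2 (blocks_levi ℤ W V h).2.2.1

theorem transl_mem_parabolic (T : Matrix (Fin n) (Fin n) ℤ) (h : Tᵀ = T) :
    transl T h ∈ parabolic n := (mem_parabolic_iff _).2 (blocks_transl ℤ T h).2.2.1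

/-- The initial segment of length `r`. -/
def headSet (n r : ℕ) : Finset (Fin n) := Finset.univ.filter fun a => (a : ℕ) < r

theorem card_headSet {n r : ℕ} (h : r ≤ n) : (headSet n r).card = r := by
  rw [headSet, Fin.card_filter_val_lt, min_eq_right h]

theorem blocks_w (F : Type*) [Field F] (n r : ℕ) :
    bA F (w n r) = idem F (headSet n r)ᶜ ∧ bB F (w n r) = -idem F (headSet n r) ∧
    bC F (w n r) = idem F (headSet n r) ∧ bD F (w n r) = idem F (headSet n r)ᶜ := by
  refine ⟨?_, ?_, ?_, ?_⟩ <;>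
  · ext a b
    by_cases hab : a = b
    · subst hab
      by_cases ha : (a : ℕ) < r <;>
        simp [bA, bB, bC, bD, w, idem, headSet, diagHead, diagTail, ha]
    · simp [bA, bB, bC, bD, w, idem, diagHead, diagTail, hab]

theorem charD_eq {p : ℕ} (ψ : DirichletCharacter ℂ p) (g : SpZ n) :
    charD ψ g = ψ (bD (ZMod p) g).det := by
  rw [charD, bD, ← RingHom.mapMatrix_apply, ← RingHom.map_det]
  rfl

end Blocks

/-! ### Lifting from 𝔽_p to ℤ: cells of Sp(n, ℤ) as rank conditions modulo p. -/

section Lift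

variable {n p : ℕ} [hp : Fact p.Prime]

/-- A diagonal matrix over 𝔽_p need not lift to an invertible integral one, so it is moved to the
right of the transvections. Conjugating a transvection by it gives another transvection, and that
one lifts with determinant 1. -/
theorem exists_lift_transvections (L : List (TransvectionStruct (Fin n) (ZMod p)))
    {d : Fin n → ZMod p} (hd : ∀ a, d a ≠ 0) :
    ∃ M : Matrix (Fin n) (Fin n) ℤ, M.det = 1 ∧
      diagonal d * (L.map TransvectionStruct.toMatrix).prod =
        M.map (Int.castRingHom (ZMod p)) * diagonal d := by
  induction L with
  | nil =>
    refine ⟨1, det_one, ?_⟩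
    rw [Matrix.map_one _ (map_zero _) (map_one _)]; simp
  | cons t L ih =>
    obtain ⟨M, hM, h⟩ := ih
    obtain ⟨i, j, hij, c⟩ := t
    set x : ℤ := ((d i * c * (d j)⁻¹).val : ℤ)
    have hx : (x : ZMod p) = d i * c * (d j)⁻¹ := by simp [x]
    refine ⟨transvection i j x * M, by rw [det_mul, det_transvection_of_ne _ _ hij, hM, one_mul], ?_⟩
    have h1 : diagonal d * transvection i j c =
        (transvection i j x).map (Int.castRingHom (ZMod p)) * diagonal d := by
      ext a b
      rw [diagonal_mul, mul_diagonal, map_apply]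
      simp only [transvection, Matrix.add_apply, one_apply, single_apply]
      by_cases hab : a = b
      · subst hab
        by_cases h : i = a ∧ j = a
        · exact absurd (h.1.trans h.2.symm) hij
        · simp [h]
      · by_cases h : i = a ∧ j = b
        · obtain ⟨rfl, rfl⟩ := h
          simp [hab, hx, hd j]
        · simp [hab, h]
    rw [List.map_cons, List.prod_cons, TransvectionStruct.toMatrix_mk, ← Matrix.mul_assoc, h1,
      Matrix.mul_assoc, h, ← Matrix.mul_assoc, Matrix.map_mul]

theorem exists_lift_GL {U : Matrix (Fin n) (Fin n) (ZMod p)} (hU : IsUnit U.det) :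
    ∃ M : Matrix (Fin n) (Fin n) ℤ, ∃ d : Fin n → ZMod p, M.det = 1 ∧ (∀ a, d a ≠ 0) ∧
      U = M.map (Int.castRingHom (ZMod p)) * diagonal d := by
  obtain ⟨L, L', d, h⟩ := Pivot.exists_list_transvec_mul_diagonal_mul_list_transvec U
  have hd : ∀ a, d a ≠ 0 := by
    have h1 := hU.ne_zero
    rw [h, det_mul, det_mul, TransvectionStruct.det_toMatrix_prod,
      TransvectionStruct.det_toMatrix_prod, det_diagonal, one_mul, mul_one,
      Finset.prod_ne_zero_iff] at h1
    exact fun a => h1 a (Finset.mem_univ a)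
  obtain ⟨M', hM', h'⟩ := exists_lift_transvections L' hd
  obtain ⟨M, hM, h2⟩ := exists_lift_transvections L (d := fun _ => (1 : ZMod p)) (by simp)
  rw [show (diagonal fun _ => 1 : Matrix (Fin n) (Fin n) (ZMod p)) = 1 from diagonal_one,
    Matrix.one_mul, Matrix.mul_one] at h2
  refine ⟨M * M', d, by rw [det_mul, hM, hM', one_mul], hd, ?_⟩
  rw [h, h2, Matrix.mul_assoc, h', Matrix.map_mul, Matrix.mul_assoc]

/-- The symmetric integral lift of a symmetric matrix modulo `p`. -/
def liftSym (T : Matrix (Fin n) (Fin n) (ZMod p)) : Matrix (Fin n) (Fin n) ℤ :=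
  T.map fun x => (x.val : ℤ)

theorem liftSym_map (T : Matrix (Fin n) (Fin n) (ZMod p)) :
    (liftSym T).map (Int.castRingHom (ZMod p)) = T := by
  ext a b; simp [liftSym]

theorem liftSym_transpose {T : Matrix (Fin n) (Fin n) (ZMod p)} (h : Tᵀ = T) :
    (liftSym T)ᵀ = liftSym T := by
  rw [liftSym, ← transpose_map, h]

/-- The Siegel parabolic subgroup modulo `p` is the reduction of `Γ₀ⁿ(p)`. -/
theorem exists_lift_Gamma0 {W V T : Matrix (Fin n) (Fin n) (ZMod p)} (hWV : Wᵀ * V = 1)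
    (hT : Tᵀ = T) : ∃ κ ∈ Gamma0 n p, bA (ZMod p) κ = W ∧ bB (ZMod p) κ = W * T ∧
      bD (ZMod p) κ = V := by
  obtain ⟨v1, v2, v3⟩ := inv_pair_comm hWV
  obtain ⟨M, d, hM, hd, hV⟩ := exists_lift_GL (U := V)
    (isUnit_iff_ne_zero.2 (right_ne_zero_of_mul_eq_one (det_inv_pair hWV)))
  have hMi : (M⁻¹)ᵀᵀ * M = 1 := by
    rw [transpose_transpose, nonsing_inv_mul _ (by rw [hM]; exact isUnit_one)]
  -- Each diagonal entry d_a is lifted separately to an element (x 1; py z) of Γ₀(p) in SL₂(ℤ) with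
  -- z ≡ d_a; together they form κ1.
  have hex : ∀ a, ∃ x y z : ℤ, (z : ZMod p) = d a ∧ x * z - p * y = 1 := by
    intro a
    have h1 : (((d a)⁻¹.val : ℤ) : ZMod p) * ((d a).val : ℤ) = 1 := by
      simp [hd a]
    have h2 : (p : ℤ) ∣ ((d a)⁻¹.val : ℤ) * ((d a).val : ℤ) - 1 := by
      rw [← ZMod.intCast_zmod_eq_zero_iff_dvd]
      push_cast
      push_cast at h1
      rw [h1, sub_self]
    obtain ⟨y, hy⟩ := h2
    exact ⟨((d a)⁻¹.val : ℤ), y, ((d a).val : ℤ), by simp, by rw [← hy]; ring⟩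
  choose x y z hz hxyz using hex
  set κ1 : SpZ n := mkSp (diagonal x) 1 (diagonal fun a => (p : ℤ) * y a) (diagonal z)
    (by simp [diagonal_mul_diagonal, mul_comm]) (by simp)
    (by
      rw [diagonal_transpose, diagonal_mul_diagonal, diagonal_transpose,
        Matrix.mul_one, diagonal_sub, ← diagonal_one]
      congr 1
      ext a
      simpa using hxyz a)
  have hκ1 : bC (ZMod p) κ1 = 0 := by
    ext a b
    by_cases hab : a = b <;> simp [bC, κ1, mkSp, hab]
  have hκ1D : bD (ZMod p) κ1 = diagonal d := by
    ext a b
    by_cases hab : a = b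
    · subst hab; simp [bD, κ1, mkSp, hz]
    · simp [bD, κ1, mkSp, hab]
  set κ2 := levi _ M hMi * κ1
  obtain ⟨l1, l2, l3, l4⟩ := blocks_levi (ZMod p) _ M hMi
  have hC2 : bC (ZMod p) κ2 = 0 := by rw [bC_mul, l3, hκ1, Matrix.zero_mul, Matrix.mul_zero, add_zero]
  have hD2 : bD (ZMod p) κ2 = V := by
    rw [bD_mul, l3, l4, hκ1D, Matrix.zero_mul, zero_add, hV]
  obtain ⟨c1, c2, c3⟩ := col_rel (ZMod p) κ2
  rw [hC2, transpose_zero, Matrix.zero_mul, sub_zero, hD2] at c3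
  have hA2 : bA (ZMod p) κ2 = W := by
    have := congrArg (fun N => (N * Wᵀ)ᵀ) c3
    simpa only [Matrix.mul_assoc, v1, Matrix.mul_one, Matrix.one_mul, transpose_transpose] using this
  rw [hD2] at c2
  -- X solves B + WX = WT, because WVᵀ = 1. It is symmetric since VᵀB is, by the column relations.
  set X := T - Vᵀ * bB (ZMod p) κ2 with hX
  have hXt : Xᵀ = X := by rw [hX, transpose_sub, hT, transpose_mul, transpose_transpose, c2]
  obtain ⟨t1, t2, t3, t4⟩ := blocks_transl (ZMod p) (liftSym X) (liftSym_transpose hXt)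
  refine ⟨κ2 * transl (liftSym X) (liftSym_transpose hXt), ?_, ?_, ?_, ?_⟩
  · rw [mem_Gamma0_iff, bC_mul, hC2, t3]; simp
  · rw [(blocks_mul _ _ _).1, t1, t3, hA2]; simp
  · rw [(blocks_mul _ _ _).2.1, t2, t4, hA2, liftSym_map, hX, Matrix.mul_sub, ← Matrix.mul_assoc,
      v2]
    simp
  · rw [bD_mul, hC2, t4, hD2]; simp

/-- The bottom row of w_r is (E_I, E_{Iᶜ}) with I the initial segment, so a decomposition through
w_r reduces to a normal form modulo p. -/
theorem NF_of_decomp {r : ℕ} {η κ : SpZ n} (hη : η ∈ parabolic n) (hκ : κ ∈ Gamma0 n p) :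
    NF (bC (ZMod p) (η * w n r * κ)) (bD (ZMod p) (η * w n r * κ)) (headSet n r)
      (bD (ZMod p) η) (bA (ZMod p) κ) (bD (ZMod p) κ)
      ((bD (ZMod p) κ)ᵀ * bB (ZMod p) κ) := by
  have h1 := bC_of_parabolic (ZMod p) hη
  have h2 := (mem_Gamma0_iff κ).1 hκ
  obtain ⟨w1, w2, w3, w4⟩ := blocks_w (ZMod p) n r
  obtain ⟨c1, c2, c3⟩ := col_rel (ZMod p) κ
  obtain ⟨e1, e2, e3⟩ := row_rel (ZMod p) η
  rw [h2, transpose_zero, Matrix.zero_mul, sub_zero] at c3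
  rw [h1, transpose_zero, Matrix.mul_zero, sub_zero] at e3
  refine ⟨?_, ?_, ?_, c3, ?_⟩
  · rw [bC_mul, bC_mul, bD_mul, h1, h2, w3]; simp
  · rw [bD_mul, bC_mul, bD_mul, h1, w3, w4]
    rw [← Matrix.mul_assoc _ (bD (ZMod p) κ)ᵀ, Matrix.mul_assoc _ _ (bD (ZMod p) κ)ᵀ,
      (inv_pair_comm c3).2.1]
    simp [Matrix.mul_add, Matrix.mul_assoc]
  · exact IsUnit.of_mul_eq_one (bA (ZMod p) η).det (by
      have := congrArg det e3
      rw [det_mul, det_transpose, det_one] at this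
      rw [mul_comm]; exact this)
  · rw [transpose_mul, transpose_transpose, c2]

/-- Conversely a normal form lifts. After a permutation I is the initial segment. The determinant
one part of U lifts to η; its diagonal part passes through E and E' into the Levi factor of κ. What
is left, g0, has the bottom row of w_r modulo p, and is therefore a translation times w_r modulo p.
-/
theorem exists_decomp {r : ℕ} (hr : r ≤ n) {g : SpZ n} {I : Finset (Fin n)}
    {U W V T : Matrix (Fin n) (Fin n) (ZMod p)}
    (h : NF (bC (ZMod p) g) (bD (ZMod p) g) I U W V T) (hI : I.card = r) :
    ∃ η ∈ parabolic n, ∃ κ ∈ Gamma0 n p, g = η * w n r * κ := by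
  obtain ⟨e, he⟩ := exists_perm_of_card_eq ((card_headSet hr).trans hI.symm)
  obtain ⟨P, -, h⟩ := h.perm e he
  generalize U * P = U at h
  generalize Pᵀ * W = W at h
  generalize Pᵀ * V = V at h
  set E := idem (ZMod p) (headSet n r) with hE
  set E' := idem (ZMod p) (headSet n r)ᶜ with hE'
  have hEE : E * E = E := idem_mul_self _
  have hEE' : E * E' = 0 := idem_mul_compl _
  have hE'E : E' * E = 0 := idem_compl_mul _
  have hE'E' : E' * E' = E' := idem_mul_self _
  have hsum : E + E' = 1 := idem_add_compl _
  have hEt : Eᵀ = E := idem_transpose _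
  have hEt' : E'ᵀ = E' := idem_transpose _
  obtain ⟨M, d, hM, hd, hU⟩ := exists_lift_GL h.hU
  set W' : Matrix (Fin n) (Fin n) (ZMod p) :=
    diagonal fun a => if a ∈ headSet n r then d a else (d a)⁻¹ with hW'
  set V' : Matrix (Fin n) (Fin n) (ZMod p) :=
    diagonal fun a => if a ∈ headSet n r then (d a)⁻¹ else d a with hV'
  have hWV' : W'ᵀ * V' = 1 := by
    rw [hW', hV', diagonal_transpose, diagonal_mul_diagonal, ← diagonal_one]
    congr 1; ext a
    by_cases ha : a ∈ headSet n r <;> simp [ha, hd a]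
  have hd1 : diagonal d * E = E * W' := by
    rw [hE, hW', idem, diagonal_mul_diagonal, diagonal_mul_diagonal]
    congr 1; ext a
    by_cases ha : a ∈ headSet n r <;> simp [ha]
  have hd2 : diagonal d * E' = E' * V' := by
    rw [hE', hV', idem, diagonal_mul_diagonal, diagonal_mul_diagonal]
    congr 1; ext a
    by_cases ha : a ∈ headSet n r <;> simp [ha]
  have hWV2 : (W' * W)ᵀ * (V' * V) = 1 := by
    rw [transpose_mul, Matrix.mul_assoc, ← Matrix.mul_assoc W'ᵀ, hWV', Matrix.one_mul, h.hWV]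
  obtain ⟨κ, hκ, k1, k2, k4⟩ := exists_lift_Gamma0 hWV2 h.hT
  have k3 := (mem_Gamma0_iff κ).1 hκ
  have hMi : (M⁻¹)ᵀᵀ * M = 1 := by
    rw [transpose_transpose, nonsing_inv_mul _ (by rw [hM]; exact isUnit_one)]
  obtain ⟨l1, l2, l3, l4⟩ := blocks_levi (ZMod p) _ M hMi
  set η := levi _ M hMi with hη
  obtain ⟨g0, hg⟩ : ∃ g0, g = η * (g0 * κ) := ⟨η⁻¹ * g * κ⁻¹, by group⟩
  set M' := M.map (Int.castRingHom (ZMod p)) with hM'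
  have hM'u : IsUnit M'.det := by
    rw [hM', ← RingHom.mapMatrix_apply, ← RingHom.map_det, hM, map_one]; exact isUnit_one
  have hcan : ∀ X Y : Matrix (Fin n) (Fin n) (ZMod p), M' * X = M' * Y → X = Y := fun X Y hXY => by
    have := congrArg (M'⁻¹ * ·) hXY
    simpa only [← Matrix.mul_assoc, nonsing_inv_mul _ hM'u, Matrix.one_mul] using this
  obtain ⟨v1, v2, v3⟩ := inv_pair_comm hWV2
  have hC0 : bC (ZMod p) g0 = E := by
    have h1 := h.hC
    rw [hg, bC_mul, bC_mul, l3, l4, k1, k3, Matrix.zero_mul, zero_add, Matrix.mul_zero, add_zero, hU,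
      Matrix.mul_assoc M', hd1, Matrix.mul_assoc M', Matrix.mul_assoc E] at h1
    have h2 := congrArg (· * (V' * V)ᵀ) (hcan _ _ h1)
    simpa only [Matrix.mul_assoc E, Matrix.mul_assoc (bC (ZMod p) g0), v2, Matrix.mul_one] using h2
  have hD0 : bD (ZMod p) g0 = E' := by
    have h1 := h.hD
    rw [hg, bD_mul, bD_mul, l3, l4, k2, k4, Matrix.zero_mul, zero_add, hC0, hU, Matrix.mul_assoc M',
      Matrix.mul_add (diagonal d), ← Matrix.mul_assoc (diagonal d),
      ← Matrix.mul_assoc (diagonal d), ← Matrix.mul_assoc (diagonal d), hd1, hd2] at h1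
    have h2 := hcan _ _ h1
    simp only [Matrix.mul_assoc] at h2
    have h3 := congrArg (· * (W' * W)ᵀ) (add_left_cancel h2)
    simpa only [← Matrix.mul_assoc V' V, Matrix.mul_assoc E', Matrix.mul_assoc (bD (ZMod p) g0), v1,
      Matrix.mul_one] using h3
  obtain ⟨r1, r2, r3⟩ := row_rel (ZMod p) g0
  rw [hC0, hD0, hEt, hEt'] at r3
  set A0 := bA (ZMod p) g0
  set B0 := bB (ZMod p) g0
  have hA0 : A0 * E' = E' := by
    have := congrArg (· * E') r3
    simpa only [Matrix.sub_mul, Matrix.mul_assoc, hE'E', hEE', Matrix.mul_zero, sub_zero,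
      Matrix.one_mul] using this
  have hB0 : B0 * E = -E := by
    have := congrArg (· * E) r3
    simp only [Matrix.sub_mul, Matrix.mul_assoc, hEE, hE'E, Matrix.mul_zero, zero_sub,
      Matrix.one_mul] at this
    rwa [neg_eq_iff_eq_neg] at this
  have hA0s : A0 = A0 * E + E' := by
    conv_lhs => rw [← Matrix.mul_one A0, ← hsum, Matrix.mul_add, hA0]
  have hB0s : B0 = -E + B0 * E' := by
    conv_lhs => rw [← Matrix.mul_one B0, ← hsum, Matrix.mul_add, hB0]
  -- X is the upper right block of g0 w_r⁻¹ modulo p, that is, the translation by which g0 and w_r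
  -- differ.
  set X := A0 * E + B0 * E' with hX
  have hXt : Xᵀ = X := by
    have e1 : A0 * B0ᵀ = -(A0 * E) + E' * B0ᵀ := by
      have hBt : B0ᵀ = -E + E' * B0ᵀ := by
        have := congrArg transpose hB0s
        simpa only [transpose_add, transpose_neg, transpose_mul, hEt, hEt'] using this
      conv_lhs => rw [hBt, Matrix.mul_add, ← Matrix.mul_assoc, hA0, Matrix.mul_neg]
    have e2 : B0 * A0ᵀ = -(E * A0ᵀ) + B0 * E' := by
      have := congrArg transpose e1
      simpa only [transpose_add, transpose_neg, transpose_mul, hEt, hEt', transpose_transpose]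
        using this
    have e3 := e1.symm.trans (r1.trans e2)
    rw [hX, transpose_add, transpose_mul, transpose_mul, hEt, hEt']
    rw [neg_add_eq_sub, neg_add_eq_sub, sub_eq_sub_iff_add_eq_add] at e3
    rw [add_comm, e3, add_comm]
  set τ := transl (liftSym X) (liftSym_transpose hXt)
  obtain ⟨t1, t2, t3, t4⟩ := blocks_transl (ZMod p) (liftSym X) (liftSym_transpose hXt)
  rw [liftSym_map] at t2
  obtain ⟨i1, i2, i3, i4⟩ := blocks_inv (ZMod p) τ
  obtain ⟨w1, w2, w3, w4⟩ := blocks_w (ZMod p) n r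
  obtain ⟨u1, u2, u3, u4⟩ := blocks_inv (ZMod p) (w n r)
  refine ⟨η * τ, mul_mem (levi_mem_parabolic _ _ _) (transl_mem_parabolic _ _),
    ((w n r)⁻¹ * (τ⁻¹ * g0)) * κ, mul_mem ?_ hκ, ?_⟩
  · rw [mem_Gamma0_iff, bC_mul, (blocks_mul _ _ _).1, bC_mul (ZMod p) τ⁻¹, u3, u4, w1, w3, i1, i2, i3, i4, t1, t2,
      t3, t4, hC0]
    rw [← hE, ← hE', hEt, hEt', hXt]
    simp only [transpose_one, transpose_zero, neg_zero, Matrix.one_mul, Matrix.zero_mul, zero_add]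
    change -E * (A0 + -X * E) + E' * E = 0
    have hXE : X * E = A0 * E := by
      rw [hX, Matrix.add_mul, Matrix.mul_assoc, Matrix.mul_assoc, hEE, hE'E, Matrix.mul_zero, add_zero]
    rw [hE'E, Matrix.neg_mul X, hXE, add_zero, ← sub_eq_add_neg, sub_eq_of_eq_add' hA0s,
      Matrix.neg_mul, hEE', neg_zero]
  · rw [hg]; group

/-- Every element of `Sp(n, ℤ)` lies in one of the cells. -/
theorem exists_decomp_of_card (g : SpZ n) : ∃ r ≤ n, ∃ η ∈ parabolic n, ∃ κ ∈ Gamma0 n p,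
    g = η * w n r * κ := by
  obtain ⟨I, U, W, V, T, h⟩ := exists_NF (row_rel (ZMod p) g).2.1
    (X := -(bB (ZMod p) g)ᵀ) (Y := (bA (ZMod p) g)ᵀ) (by
      rw [← row_rel' (ZMod p) g, Matrix.mul_neg]; abel)
  have hI : I.card ≤ n := by simpa using Finset.card_le_univ I
  exact ⟨I.card, hI, exists_decomp hI h rfl⟩

/-- The value defined by a chosen decomposition becomes a function of the bottom row modulo p. This
gives independence of the choice and lets ψ* be computed by linear algebra over 𝔽_p. -/
theorem psiStar_eq {ψ : DirichletCharacter ℂ p} (hψ : ψ ^ 2 = 1) {r : ℕ} (hr : r ≤ n) (g : SpZ n) :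
    psiStar n p ψ r g = pairChar ψ r (bC (ZMod p) g) (bD (ZMod p) g) := by
  by_cases h : ∃ x : SpZ n × SpZ n, x.1 ∈ parabolic n ∧ x.2 ∈ Gamma0 n p ∧ g = x.1 * w n r * x.2
  · rw [psiStar, dif_pos h]
    obtain ⟨h1, h2, h3⟩ := h.choose_spec
    have hN := NF_of_decomp (p := p) (r := r) h1 h2
    rw [← h3] at hN
    rw [pairChar_eq hψ hN (card_headSet hr), charD_eq, charD_eq]
  · rw [psiStar, dif_neg h, pairChar_eq_zero]
    rintro ⟨I, U, W, V, T, hI, hN⟩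
    obtain ⟨η, hη, κ, hκ, hg⟩ := exists_decomp hr hN hI
    exact h ⟨(η, κ), hη, hκ, hg⟩

end Lift

/-! ### The cocycle relation and the weight z^{-k}|z|^{-2s+k}. -/

section Cocycle

variable {n : ℕ}

theorem HalfSpace.ext {Z W : HalfSpace n} (h : Z.1 = W.1) : Z = W := by
  cases Z; cases W; cases h; rfl

theorem GSpPos.num_eq (g : GSpPos n) (Z : HalfSpace n) : g.num Z.1 = (act g Z).1 * g.den Z.1 := by
  have hu := (Matrix.isUnit_iff_isUnit_det _).1 (g.isUnit_den Z)
  change _ = g.num Z.1 * (g.den Z.1)⁻¹ * g.den Z.1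
  rw [Matrix.mul_assoc, nonsing_inv_mul _ hu, Matrix.mul_one]

theorem GSpPos.num_den_mul {g₁ g₂ g₃ : GSpPos n} (h : g₃.mat = g₁.mat * g₂.mat)
    (Z : Matrix (Fin n) (Fin n) ℂ) :
    g₃.num Z = g₁.A * g₂.num Z + g₁.B * g₂.den Z ∧
      g₃.den Z = g₁.C * g₂.num Z + g₁.D * g₂.den Z := by
  have h' := h
  rw [← fromBlocks_toBlocks g₁.mat, ← fromBlocks_toBlocks g₂.mat, ← fromBlocks_toBlocks g₃.mat,
    fromBlocks_multiply, fromBlocks_inj] at h'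
  obtain ⟨h1, h2, h3, h4⟩ := h'
  have key : ∀ P Q R S : Matrix (Fin n) (Fin n) ℝ, (P * Q + R * S).map Complex.ofReal =
      P.map Complex.ofReal * Q.map Complex.ofReal + R.map Complex.ofReal * S.map Complex.ofReal := by
    intro P Q R S
    ext a b
    simp [Matrix.mul_apply]
  have e1 := congrArg (fun M => M.map Complex.ofReal) h1
  have e2 := congrArg (fun M => M.map Complex.ofReal) h2
  have e3 := congrArg (fun M => M.map Complex.ofReal) h3
  have e4 := congrArg (fun M => M.map Complex.ofReal) h4
  simp only [key] at e1 e2 e3 e4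
  change g₃.A = g₁.A * g₂.A + g₁.B * g₂.C at e1
  change g₃.B = g₁.A * g₂.B + g₁.B * g₂.D at e2
  change g₃.C = g₁.C * g₂.A + g₁.D * g₂.C at e3
  change g₃.D = g₁.C * g₂.B + g₁.D * g₂.D at e4
  constructor
  · rw [GSpPos.num, e1, e2, GSpPos.num, GSpPos.den]; noncomm_ring
  · rw [GSpPos.den, e3, e4, GSpPos.num, GSpPos.den]; noncomm_ring

theorem GSpPos.den_mul {g₁ g₂ g₃ : GSpPos n} (h : g₃.mat = g₁.mat * g₂.mat) (Z : HalfSpace n) :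
    g₃.den Z.1 = g₁.den (act g₂ Z).1 * g₂.den Z.1 := by
  rw [(GSpPos.num_den_mul h Z.1).2, g₂.num_eq Z]
  change _ = (g₁.C * (act g₂ Z).1 + g₁.D) * g₂.den Z.1
  noncomm_ring

theorem act_mul {g₁ g₂ g₃ : GSpPos n} (h : g₃.mat = g₁.mat * g₂.mat) (Z : HalfSpace n) :
    act g₃ Z = act g₁ (act g₂ Z) := by
  apply HalfSpace.ext
  have hu := (Matrix.isUnit_iff_isUnit_det _).1 (g₃.isUnit_den Z)
  have h1 : g₃.num Z.1 = (act g₁ (act g₂ Z)).1 * g₃.den Z.1 := by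
    rw [GSpPos.den_mul h, ← Matrix.mul_assoc, ← GSpPos.num_eq, (GSpPos.num_den_mul h Z.1).1,
      g₂.num_eq Z, GSpPos.num]
    noncomm_ring
  change g₃.num Z.1 * (g₃.den Z.1)⁻¹ = _
  rw [h1, Matrix.mul_assoc, mul_nonsing_inv _ hu, Matrix.mul_one]

theorem autFactor_mul {g₁ g₂ g₃ : GSpPos n} (h : g₃.mat = g₁.mat * g₂.mat)
    (hmu : g₃.mu = g₁.mu * g₂.mu) (Z : HalfSpace n) :
    autFactor g₃ Z = autFactor g₁ (act g₂ Z) * autFactor g₂ Z := by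
  rw [autFactor, autFactor, autFactor, GSpPos.den_mul h, det_mul, hmu,
    Real.mul_rpow g₁.mu_pos.le g₂.mu_pos.le]
  push_cast
  ring

theorem slash_mul (k : ℤ) (f : HalfSpace n → ℂ) {g₁ g₂ g₃ : GSpPos n} (h : g₃.mat = g₁.mat * g₂.mat)
    (hmu : g₃.mu = g₁.mu * g₂.mu) (Z : HalfSpace n) :
    slash k f g₃ Z = autFactor g₂ Z ^ (-k) * slash k f g₁ (act g₂ Z) := by
  rw [slash, slash, act_mul h, autFactor_mul h hmu, mul_zpow]
  ring

theorem autFactor_ne_zero (g : GSpPos n) (Z : HalfSpace n) : autFactor g Z ≠ 0 := by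
  refine mul_ne_zero ?_ ((Matrix.isUnit_iff_isUnit_det _).1 (g.isUnit_den Z)).ne_zero
  exact_mod_cast (Real.rpow_pos_of_pos g.mu_pos _).ne'

theorem HalfSpace.det_imag_pos (Z : HalfSpace n) : 0 < Z.imag.det := Z.2.2.det_pos

/-- The hermitian relation produces a factor μⁿ in the determinant; the normalisation μ^{-n/2} of j
cancels it. -/
theorem det_imag_act (g : GSpPos n) (Z : HalfSpace n) :
    ‖autFactor g Z‖ ^ 2 * (act g Z).imag.det = Z.imag.det := by
  have h := g.herm_rel Z
  rw [g.num_eq Z, conjTranspose_mul] at h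
  have hW := (act g Z).sub_conj
  have hc : (((act g Z).1).map conj)ᵀ = ((act g Z).1)ᴴ := rfl
  rw [hc] at hW
  have e1 : (g.den Z.1)ᴴ * ((act g Z).1 - ((act g Z).1)ᴴ) * g.den Z.1 =
      (g.mu * (2 * Complex.I)) • Z.imag.map Complex.ofReal := by
    rw [← h]; noncomm_ring
  rw [hW, Matrix.mul_smul, Matrix.smul_mul, mul_comm (g.mu : ℂ), mul_smul (2 * Complex.I)] at e1
  have e2 := congrArg det (smul_right_injective _ (by simp : 2 * Complex.I ≠ 0) e1)
  rw [det_mul, det_mul, det_conjTranspose, det_smul, Fintype.card_fin] at e2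
  have e3 : ∀ Y : Matrix (Fin n) (Fin n) ℝ, (Y.map Complex.ofReal).det = ((Y.det : ℝ) : ℂ) :=
    fun Y => (RingHom.map_det Complex.ofRealHom Y).symm
  rw [e3, e3] at e2
  have e4 : ‖(g.den Z.1).det‖ ^ 2 * (act g Z).imag.det = g.mu ^ n * Z.imag.det := by
    have : (((‖(g.den Z.1).det‖ ^ 2 * (act g Z).imag.det : ℝ)) : ℂ) =
        ((g.mu ^ n * Z.imag.det : ℝ) : ℂ) := by
      push_cast
      rw [← e2, ← Complex.conj_mul', RCLike.star_def]
      ring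
    exact_mod_cast this
  have e5 : (g.mu ^ (-(n : ℝ) / 2)) ^ 2 * g.mu ^ n = 1 := by
    rw [← Real.rpow_natCast, ← Real.rpow_natCast, ← Real.rpow_mul g.mu_pos.le,
      ← Real.rpow_add g.mu_pos]
    rw [show -(n : ℝ) / 2 * ((2 : ℕ) : ℝ) + n = 0 by push_cast; ring, Real.rpow_zero]
  rw [autFactor, norm_mul, Complex.norm_real, Real.norm_of_nonneg (Real.rpow_pos_of_pos g.mu_pos _).le,
    mul_pow, mul_assoc, e4, ← mul_assoc, e5, one_mul]

/-- The weight `z^{-k} |z|^{-2s+k}`. -/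
def wt (k : ℤ) (s z : ℂ) : ℂ := z ^ (-k) * ((‖z‖ : ℝ) : ℂ) ^ (-2 * s + k)

theorem wt_mul (k : ℤ) (s z w : ℂ) : wt k s (z * w) = wt k s z * wt k s w := by
  rw [wt, wt, wt, mul_zpow, norm_mul, Complex.ofReal_mul,
    Complex.mul_cpow_ofReal_nonneg (norm_nonneg _) (norm_nonneg _)]
  ring

theorem norm_wt (k : ℤ) (s : ℂ) {z : ℂ} (hz : z ≠ 0) : ‖wt k s z‖ = ‖z‖ ^ (-2 * s.re) := by
  have hz' := norm_pos_iff.2 hz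
  rw [wt, norm_mul, norm_zpow, Complex.norm_cpow_eq_rpow_re_of_pos hz', ← Real.rpow_intCast,
    ← Real.rpow_add hz']
  congr 1
  simp

theorem wt_ofReal {x : ℝ} (hx : 0 < x) (k : ℤ) (s : ℂ) : wt k s x = (x : ℂ) ^ (-2 * s) := by
  have hx' : (x : ℂ) ≠ 0 := by exact_mod_cast hx.ne'
  rw [wt, Complex.norm_real, Real.norm_of_nonneg hx.le, Complex.cpow_add _ _ hx',
    Complex.cpow_intCast, mul_comm, mul_assoc, ← zpow_add₀ hx', add_neg_cancel, zpow_zero, mul_one]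

theorem wt_one (k : ℤ) (s : ℂ) : wt k s 1 = 1 := by simp [wt]

theorem wt_neg_one (k : ℤ) (s : ℂ) : wt k s (-1) = (-1) ^ k := by
  simp only [wt, norm_neg, norm_one, Complex.ofReal_one, Complex.one_cpow, mul_one]
  rcases Int.even_or_odd k with h | h
  · rw [h.neg_one_zpow, h.neg.neg_one_zpow]
  · rw [h.neg_one_zpow, h.neg.neg_one_zpow]

theorem toGSp_blocks (g : SpZ n) : g.toGSp.A = bA ℂ g ∧ g.toGSp.B = bB ℂ g ∧ g.toGSp.C = bC ℂ g ∧
    g.toGSp.D = bD ℂ g := by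
  refine ⟨?_, ?_, ?_, ?_⟩ <;>
  · ext a b
    simp [SpZ.toGSp, ofInt, GSpPos.A, GSpPos.B, GSpPos.C, GSpPos.D, bA, bB, bC, bD, toBlocks₁₁,
      toBlocks₁₂, toBlocks₂₁, toBlocks₂₂]

/-- The automorphy factor of an element of `Sp(n, ℤ)`. -/
theorem autFactor_toGSp (g : SpZ n) (Z : HalfSpace n) :
    autFactor g.toGSp Z = (bC ℂ g * Z.1 + bD ℂ g).det := by
  obtain ⟨-, -, h3, h4⟩ := toGSp_blocks g
  rw [autFactor, GSpPos.den, h3, h4]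
  simp [SpZ.toGSp, ofInt]

theorem toGSp_mul (g h : SpZ n) : (g * h).toGSp.mat = g.toGSp.mat * h.toGSp.mat ∧
    (g * h).toGSp.mu = g.toGSp.mu * h.toGSp.mu := by
  constructor
  · simp only [SpZ.toGSp, ofInt, Submonoid.coe_mul, Matrix.map_mul]
  · simp [SpZ.toGSp, ofInt]

theorem autFactor_toGSp_mul (g h : SpZ n) (Z : HalfSpace n) :
    autFactor (g * h).toGSp Z = autFactor g.toGSp (act h.toGSp Z) * autFactor h.toGSp Z :=
  autFactor_mul (toGSp_mul g h).1 (toGSp_mul g h).2 Z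

theorem det_bD_of_parabolic {η : SpZ n} (hη : η ∈ parabolic n) :
    (bD ℤ η).det = 1 ∨ (bD ℤ η).det = -1 := by
  have h := (row_rel ℤ η).2.2
  rw [bC_of_parabolic ℤ hη, transpose_zero, Matrix.mul_zero, sub_zero] at h
  have := congrArg det h
  rw [det_mul, det_transpose, det_one, mul_comm] at this
  exact Int.isUnit_iff.1 (IsUnit.of_mul_eq_one _ this)

theorem det_map_bD (R : Type*) [CommRing R] (η : SpZ n) : (bD R η).det = ((bD ℤ η).det : R) := by
  rw [map_bD, ← RingHom.mapMatrix_apply, ← RingHom.map_det]; rfl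

theorem autFactor_parabolic_mul {η : SpZ n} (hη : η ∈ parabolic n) (g : SpZ n) (Z : HalfSpace n) :
    autFactor (η * g).toGSp Z = ((bD ℤ η).det : ℂ) * autFactor g.toGSp Z := by
  rw [autFactor_toGSp_mul, autFactor_toGSp η, bC_of_parabolic ℂ hη, Matrix.zero_mul, zero_add,
    det_map_bD]

end Cocycle

/-! ### Functions and sums on P \ Sp(n, ℤ). -/

section Cosets

variable {n : ℕ}

/-- The cosets `P \ Sp(n, ℤ)`. -/
abbrev PCoset (n : ℕ) : Type := Quotient (QuotientGroup.rightRel (parabolic n))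

/-- Functions on `P \ Sp(n, ℤ)`. -/
def LeftInv {X : Type*} (f : SpZ n → X) : Prop := ∀ η ∈ parabolic n, ∀ g, f (η * g) = f g

theorem coset_eq_iff {g h : SpZ n} :
    (Quotient.mk _ g : PCoset n) = Quotient.mk _ h ↔ h * g⁻¹ ∈ parabolic n := by
  rw [Quotient.eq]; exact QuotientGroup.rightRel_apply

theorem LeftInv.eq_of_coset {X : Type*} {f : SpZ n → X} (hf : LeftInv f) {g h : SpZ n}
    (e : (Quotient.mk _ g : PCoset n) = Quotient.mk _ h) : f g = f h := by
  have := hf _ (coset_eq_iff.1 e) g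
  rw [inv_mul_cancel_right] at this
  exact this.symm

theorem LeftInv.out {X : Type*} {f : SpZ n → X} (hf : LeftInv f) (g : SpZ n) :
    f (Quotient.mk _ g : PCoset n).out = f g :=
  hf.eq_of_coset (Quotient.out_eq _)

/-- Right translation of cosets. -/
def cosetMul (γ : SpZ n) : PCoset n ≃ PCoset n where
  toFun := Quotient.map (· * γ) fun a b h => by
    rw [← Quotient.eq_iff_equiv, coset_eq_iff] at h ⊢
    simpa [mul_assoc] using h
  invFun := Quotient.map (· * γ⁻¹) fun a b h => by
    rw [← Quotient.eq_iff_equiv, coset_eq_iff] at h ⊢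
    simpa [mul_assoc] using h
  left_inv q := by
    induction q using Quotient.inductionOn with
    | _ a => simp
  right_inv q := by
    induction q using Quotient.inductionOn with
    | _ a => simp

theorem cosetMul_eq (γ : SpZ n) (q : PCoset n) : cosetMul γ q = Quotient.mk _ (q.out * γ) := by
  conv_lhs => rw [← Quotient.out_eq q]
  rfl

theorem tsum_mul_right_coset {f : SpZ n → ℂ} (hf : LeftInv f) (γ : SpZ n) :
    ∑' q : PCoset n, f (q.out * γ) = ∑' q : PCoset n, f q.out := by
  rw [← (cosetMul γ).tsum_eq (fun q => f q.out)]
  refine tsum_congr fun q => ?_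
  rw [cosetMul_eq, hf.out]

end Cosets

/-! ### Hermite reduction of positive definite matrices with bounded denominators. -/

section Reduction

variable {ι κ : Type*} [Fintype ι] [DecidableEq ι] [Fintype κ] [DecidableEq κ]

/-- The entries of `H` have a common denominator. -/
def HasDenom (H : Matrix ι ι ℝ) : Prop := ∃ N : ℕ, 0 < N ∧ ∀ a b, ∃ z : ℤ, (N : ℝ) * H a b = z

/-- A quantitative form of reducedness of a positive definite matrix: it is bounded below by its
diagonal. -/
def IsReduced (c : ℝ) (H : Matrix ι ι ℝ) : Prop :=
  (∀ x : ι → ℝ, c * ∑ a, H a a * x a ^ 2 ≤ x ⬝ᵥ (H *ᵥ x)) ∧ c * ∏ a, H a a ≤ H.det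

/-- The matrix `U H Uᵀ`. -/
def congrInt (U : Matrix ι ι ℤ) (H : Matrix ι ι ℝ) : Matrix ι ι ℝ :=
  U.map (Int.castRingHom ℝ) * H * (U.map (Int.castRingHom ℝ))ᵀ

theorem congrInt_mul (U V : Matrix ι ι ℤ) (H : Matrix ι ι ℝ) :
    congrInt (U * V) H = congrInt U (congrInt V H) := by
  simp only [congrInt, Matrix.map_mul, transpose_mul, Matrix.mul_assoc]

theorem det_map_cast (U : Matrix ι ι ℤ) : (U.map (Int.castRingHom ℝ)).det = (U.det : ℝ) :=
  (RingHom.map_det (Int.castRingHom ℝ) U).symm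

theorem isUnit_map_cast {U : Matrix ι ι ℤ} (hU : IsUnit U.det) :
    IsUnit (U.map (Int.castRingHom ℝ)) := by
  rw [Matrix.isUnit_iff_isUnit_det, det_map_cast]
  exact hU.map (Int.castRingHom ℝ)

theorem congrInt_posDef {U : Matrix ι ι ℤ} (hU : IsUnit U.det) {H : Matrix ι ι ℝ} (hH : H.PosDef) :
    (congrInt U H).PosDef := by
  have := hH.mul_mul_conjTranspose_same (B := U.map (Int.castRingHom ℝ))
    (Matrix.vecMul_injective_iff_isUnit.2 (isUnit_map_cast hU))
  rwa [conjTranspose_eq_transpose_of_trivial] at this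

theorem HasDenom.congrInt {H : Matrix ι ι ℝ} (hH : HasDenom H) (U : Matrix ι ι ℤ) :
    HasDenom (congrInt U H) := by
  obtain ⟨N, hN, h⟩ := hH
  choose z hz using h
  refine ⟨N, hN, fun a b => ⟨(U * Matrix.of z * Uᵀ) a b, ?_⟩⟩
  have e : (N : ℝ) • H = (Matrix.of z).map (Int.castRingHom ℝ) := by
    ext a b
    simpa using hz a b
  have e2 : (N : ℝ) • SiegelEis.congrInt U H = (U * Matrix.of z * Uᵀ).map (Int.castRingHom ℝ) := by
    rw [SiegelEis.congrInt, ← Matrix.smul_mul, ← Matrix.mul_smul, e, Matrix.map_mul, Matrix.map_mul,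
      transpose_map]
  exact congrFun (congrFun e2 a) b

/-- With a common denominator N the values are positive multiples of 1/N, so their minimum over
GLₙ(ℤ) is attained by well-foundedness, without any compactness argument. This is the use of
`HasDenom`. -/
theorem exists_min_congrInt {H : Matrix ι ι ℝ} (hH : H.PosDef) (hN : HasDenom H) (a : ι) :
    ∃ U : Matrix ι ι ℤ, IsUnit U.det ∧ ∀ V : Matrix ι ι ℤ, IsUnit V.det →
      congrInt U H a a ≤ congrInt V (congrInt U H) a a := by
  obtain ⟨N, hN0, h⟩ := id hN
  have hN0' : (0 : ℝ) < N := by exact_mod_cast hN0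
  have hz : ∀ V : Matrix ι ι ℤ, IsUnit V.det → ∃ m : ℕ, (N : ℝ) * congrInt V H a a = m := by
    intro V hV
    obtain ⟨N', hN', h'⟩ := hN
    choose z hz using h
    have e : (N : ℝ) • H = (Matrix.of z).map (Int.castRingHom ℝ) := by
      ext a b
      simpa using hz a b
    have e2 : (N : ℝ) • congrInt V H = (V * Matrix.of z * Vᵀ).map (Int.castRingHom ℝ) := by
      rw [congrInt, ← Matrix.smul_mul, ← Matrix.mul_smul, e, Matrix.map_mul, Matrix.map_mul,
        transpose_map]
    have e3 : (N : ℝ) * congrInt V H a a = ((V * Matrix.of z * Vᵀ) a a : ℤ) :=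
      congrFun (congrFun e2 a) a
    have hpos : (0 : ℝ) < (N : ℝ) * congrInt V H a a :=
      mul_pos hN0' (congrInt_posDef hV hH).diag_pos
    rw [e3] at hpos
    have hpos' : 0 < (V * Matrix.of z * Vᵀ) a a := by exact_mod_cast hpos
    refine ⟨((V * Matrix.of z * Vᵀ) a a).toNat, ?_⟩
    rw [e3]
    exact_mod_cast (Int.toNat_of_nonneg hpos'.le).symm
  choose f hf using hz
  obtain ⟨⟨U, hU⟩, -, hmin⟩ := (measure fun V : {V : Matrix ι ι ℤ // IsUnit V.det} =>
    f V.1 V.2).wf.has_min Set.univ ⟨⟨1, by simp⟩, trivial⟩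
  refine ⟨U, hU, fun V hV => ?_⟩
  have hVU : IsUnit (V * U).det := by rw [det_mul]; exact hV.mul hU
  have h1 : ¬ f (V * U) hVU < f U hU := hmin ⟨V * U, hVU⟩ trivial
  rw [← congrInt_mul]
  refine le_of_mul_le_mul_left ?_ hN0'
  rw [hf _ hU, hf _ hVU]
  exact_mod_cast not_lt.1 h1

/-- The unipotent matrix with lower left block `m`. -/
def lowerUni {R : Type*} [CommRing R] (m : Matrix ι (Fin 1) R) : Matrix (Fin 1 ⊕ ι) (Fin 1 ⊕ ι) R :=
  fromBlocks 1 0 m 1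

/-- The matrix with first diagonal entry `a`, off-diagonal quotients `m` and Schur complement
`K`. -/
def ldl (a : ℝ) (m : Matrix ι (Fin 1) ℝ) (K : Matrix ι ι ℝ) : Matrix (Fin 1 ⊕ ι) (Fin 1 ⊕ ι) ℝ :=
  lowerUni m * fromBlocks (a • 1) 0 0 K * (lowerUni m)ᵀ

theorem ldl_eq (a : ℝ) (m : Matrix ι (Fin 1) ℝ) (K : Matrix ι ι ℝ) :
    ldl a m K = fromBlocks (a • 1) (a • mᵀ) (a • m) (a • (m * mᵀ) + K) := by
  simp [ldl, lowerUni, fromBlocks_multiply, fromBlocks_transpose]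

theorem exists_ldl {H : Matrix (Fin 1 ⊕ ι) (Fin 1 ⊕ ι) ℝ} (hH : H.PosDef) :
    ∃ m K, H = ldl (H (.inl 0) (.inl 0)) m K ∧ K.PosDef := by
  have ha : 0 < H (.inl 0) (.inl 0) := hH.diag_pos
  set a := H (.inl 0) (.inl 0) with haa
  have hs : Hᵀ = H := by
    have := hH.isHermitian
    rwa [Matrix.IsHermitian, conjTranspose_eq_transpose_of_trivial] at this
  have e : H = ldl a (a⁻¹ • H.toBlocks₂₁)
      (H.toBlocks₂₂ - a • ((a⁻¹ • H.toBlocks₂₁) * (a⁻¹ • H.toBlocks₂₁)ᵀ)) := by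
    rw [ldl_eq]
    conv_lhs => rw [← fromBlocks_toBlocks H]
    rw [fromBlocks_inj]
    refine ⟨?_, ?_, ?_, by abel⟩
    · ext i j
      fin_cases i; fin_cases j
      simp [toBlocks₁₁, haa]
    · rw [transpose_smul, smul_smul, mul_inv_cancel₀ ha.ne', one_smul]
      ext i j
      exact (congrFun (congrFun hs _) _).symm
    · rw [smul_smul, mul_inv_cancel₀ ha.ne', one_smul]
  refine ⟨_, _, e, ?_⟩
  generalize a⁻¹ • H.toBlocks₂₁ = m at e ⊢
  generalize H.toBlocks₂₂ - a • (m * mᵀ) = K at e ⊢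
  have hu : lowerUni (-m) * lowerUni m = 1 := by
    simp [lowerUni, fromBlocks_multiply]
  have hu' : lowerUni m * lowerUni (-m) = 1 := by
    simp [lowerUni, fromBlocks_multiply]
  have e2 : lowerUni (-m) * H * (lowerUni (-m))ᵀ = fromBlocks (a • 1) 0 0 K := by
    rw [e, ldl]
    calc _ = lowerUni (-m) * lowerUni m * fromBlocks (a • 1) 0 0 K * (lowerUni (-m) * lowerUni m)ᵀ := by
          simp only [transpose_mul, Matrix.mul_assoc]
      _ = _ := by rw [hu]; simp
  have h3 := hH.mul_mul_conjTranspose_same (B := lowerUni (-m))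
    (Matrix.vecMul_injective_iff_isUnit.2 ⟨⟨_, _, hu, hu'⟩, rfl⟩)
  rw [conjTranspose_eq_transpose_of_trivial, e2] at h3
  exact h3.submatrix (e := Sum.inr) Sum.inr_injective

/-- If N is a denominator of the matrix, N²a is one of K: N²aK_{bc} is a 2 × 2 minor of the integral
matrix obtained on multiplying by N. -/
theorem HasDenom.schur {a : ℝ} {m : Matrix ι (Fin 1) ℝ} {K : Matrix ι ι ℝ} (ha : 0 < a)
    (h : HasDenom (ldl a m K)) : HasDenom K := by
  obtain ⟨N, hN, h⟩ := h
  rw [ldl_eq] at h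
  choose z hz using h
  have h0 : (N : ℝ) * a = z (.inl 0) (.inl 0) := by simpa using hz (.inl 0) (.inl 0)
  have hpos : 0 < z (.inl 0) (.inl 0) := by
    have : (0 : ℝ) < z (.inl 0) (.inl 0) := by rw [← h0]; positivity
    exact_mod_cast this
  refine ⟨N * (z (.inl 0) (.inl 0)).toNat, Nat.mul_pos hN (by omega), fun b c =>
    ⟨z (.inl 0) (.inl 0) * z (.inr b) (.inr c) - z (.inr b) (.inl 0) * z (.inr c) (.inl 0), ?_⟩⟩
  have e1 := hz (.inr b) (.inr c)
  have e2 := hz (.inr b) (.inl 0)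
  have e3 := hz (.inr c) (.inl 0)
  have e4 : (((z (.inl 0) (.inl 0)).toNat : ℕ) : ℝ) = z (.inl 0) (.inl 0) := by
    exact_mod_cast Int.toNat_of_nonneg hpos.le
  simp only [fromBlocks_apply₂₂, fromBlocks_apply₂₁, Matrix.add_apply, Matrix.smul_apply,
    Matrix.mul_apply, Finset.univ_unique, Finset.sum_singleton, transpose_apply, smul_eq_mul,
    Fin.default_eq_zero] at e1 e2 e3
  push_cast
  rw [e4, ← e1, ← e2, ← e3, ← h0]
  ring

theorem ldl_form (a : ℝ) (m : Matrix ι (Fin 1) ℝ) (K : Matrix ι ι ℝ) (x : Fin 1 ⊕ ι → ℝ) :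
    x ⬝ᵥ (ldl a m K *ᵥ x) = a * (x (.inl 0) + ∑ b, m b 0 * x (.inr b)) ^ 2 +
      (fun b => x (.inr b)) ⬝ᵥ (K *ᵥ fun b => x (.inr b)) := by
  have e : (lowerUni m)ᵀ *ᵥ x =
      Sum.elim (fun _ => x (.inl 0) + ∑ b, m b 0 * x (.inr b)) (fun b => x (.inr b)) := by
    ext b
    rcases b with b | b
    · fin_cases b
      simp [lowerUni, fromBlocks_transpose, mulVec, dotProduct]
    · simp [lowerUni, fromBlocks_transpose, mulVec, dotProduct, Matrix.one_apply]
  rw [ldl, ← mulVec_mulVec, ← mulVec_mulVec, dotProduct_mulVec, ← mulVec_transpose, e]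
  simp [fromBlocks_mulVec, dotProduct, smul_mulVec]
  ring

theorem det_ldl (a : ℝ) (m : Matrix ι (Fin 1) ℝ) (K : Matrix ι ι ℝ) :
    (ldl a m K).det = a * K.det := by
  simp [ldl, lowerUni, det_fromBlocks_zero₁₂, det_fromBlocks_zero₂₁, fromBlocks_transpose]

theorem congrInt_ldl (V : Matrix ι ι ℤ) (t : Matrix ι (Fin 1) ℤ) (a : ℝ) (m : Matrix ι (Fin 1) ℝ)
    (K : Matrix ι ι ℝ) :
    congrInt (fromBlocks 1 0 t V) (ldl a m K) =
      ldl a (t.map (Int.castRingHom ℝ) + V.map (Int.castRingHom ℝ) * m) (congrInt V K) := by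
  have e : (fromBlocks (1 : Matrix (Fin 1) (Fin 1) ℤ) 0 t V).map (Int.castRingHom ℝ) =
      fromBlocks 1 0 (t.map (Int.castRingHom ℝ)) (V.map (Int.castRingHom ℝ)) := by
    rw [fromBlocks_map]; simp [Matrix.map_zero]
  rw [congrInt, e, ldl, ldl, lowerUni, lowerUni, congrInt]
  simp [fromBlocks_multiply, fromBlocks_transpose, Matrix.mul_add, Matrix.add_mul, Matrix.mul_assoc]
  abel

/-- Minimality of a together with |m_b| ≤ 1/2 gives K_bb ≥ 3a/4. So the contributions of m, both to
the form and to the diagonal entries, are bounded by the diagonal of K, which reducedness of K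
controls. The first term of the minimum serves the inequality for the form, the second the one for
the determinant: each new diagonal entry is at most 4/3 of K_bb. -/
theorem IsReduced.ldl {c a : ℝ} {m : Matrix ι (Fin 1) ℝ} {K : Matrix ι ι ℝ} (hc : 0 < c)
    (ha : 0 < a) (hm : ∀ b, |m b 0| ≤ 1 / 2) (hK : IsReduced c K)
    (hmin : ∀ b, a ≤ a * m b 0 ^ 2 + K b b) :
    IsReduced (min (2 + (Fintype.card ι + 2) / c)⁻¹ (c * (3 / 4) ^ Fintype.card ι))
      (ldl a m K) := by
  have hm2 : ∀ b, m b 0 ^ 2 ≤ 1 / 4 := fun b => by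
    have := sq_le_sq' (by linarith [(abs_le.1 (hm b)).1]) (abs_le.1 (hm b)).2
    linarith
  have hKb : ∀ b, 3 / 4 * a ≤ K b b := fun b => by nlinarith [hmin b, hm2 b]
  have hK0 : ∀ b, 0 < K b b := fun b => by linarith [hKb b]
  have hd : ∀ b, a * m b 0 ^ 2 + K b b ≤ 4 / 3 * K b b := fun b => by nlinarith [hKb b, hm2 b]
  have hd0 : ∀ b, 0 ≤ a * m b 0 ^ 2 + K b b := fun b => by linarith [hmin b]
  have e0 : SiegelEis.ldl a m K (.inl 0) (.inl 0) = a := by simp [ldl_eq]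
  have e1 : ∀ b, SiegelEis.ldl a m K (.inr b) (.inr b) = a * m b 0 ^ 2 + K b b := fun b => by
    simp [ldl_eq, Matrix.mul_apply, sq]
  have hn : (0 : ℝ) ≤ Fintype.card ι := Nat.cast_nonneg _
  constructor
  · intro x
    rw [ldl_form, Fintype.sum_sum_type, Finset.univ_unique, Finset.sum_singleton, Fin.default_eq_zero,
      e0]
    simp only [e1]
    have hq := hK.1 fun b => x (.inr b)
    set y : ι → ℝ := fun b => x (.inr b) with hy
    set Q := y ⬝ᵥ (K *ᵥ y)
    set x0 := x (.inl 0)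
    set l := ∑ b, m b 0 * x (.inr b) with hl
    have hS : 0 ≤ ∑ b, K b b * y b ^ 2 :=
      Finset.sum_nonneg fun b _ => mul_nonneg (hK0 b).le (sq_nonneg _)
    have h1 : ∑ b, (a * m b 0 ^ 2 + K b b) * x (.inr b) ^ 2 ≤ 4 / 3 * ∑ b, K b b * y b ^ 2 := by
      rw [Finset.mul_sum]
      refine Finset.sum_le_sum fun b _ => ?_
      rw [← mul_assoc]
      exact mul_le_mul_of_nonneg_right (hd b) (sq_nonneg _)
    have h2 : a * l ^ 2 ≤ Fintype.card ι / 3 * ∑ b, K b b * y b ^ 2 := by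
      have h3 : l ^ 2 ≤ Fintype.card ι * ∑ b, (m b 0 * x (.inr b)) ^ 2 := by
        have := sq_sum_le_card_mul_sum_sq (s := Finset.univ) (f := fun b => m b 0 * x (.inr b))
        simpa using this
      calc a * l ^ 2 ≤ a * (Fintype.card ι * ∑ b, (m b 0 * x (.inr b)) ^ 2) :=
            mul_le_mul_of_nonneg_left h3 ha.le
        _ = Fintype.card ι / 3 * ∑ b, 3 * a * (m b 0 * x (.inr b)) ^ 2 := by
            rw [← Finset.mul_sum]; ring
        _ ≤ _ := by
            refine mul_le_mul_of_nonneg_left (Finset.sum_le_sum fun b _ => ?_) (by positivity)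
            rw [mul_pow]
            have := hm2 b
            have := hKb b
            have h4 : 3 * a * m b 0 ^ 2 ≤ K b b := by nlinarith
            calc _ = 3 * a * m b 0 ^ 2 * x (.inr b) ^ 2 := by ring
              _ ≤ _ := mul_le_mul_of_nonneg_right h4 (sq_nonneg _)
    have h5 : a * x0 ^ 2 ≤ 2 * (a * (x0 + l) ^ 2) + 2 * (a * l ^ 2) := by
      nlinarith [mul_nonneg ha.le (sq_nonneg (x0 + 2 * l))]
    have hA : 0 ≤ a * (x0 + l) ^ 2 := by positivity
    set S := ∑ b, K b b * y b ^ 2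
    have hT0 : 0 ≤ a * x0 ^ 2 + ∑ b, (a * m b 0 ^ 2 + K b b) * x (.inr b) ^ 2 :=
      add_nonneg (by positivity) (Finset.sum_nonneg fun b _ => mul_nonneg (hd0 b) (sq_nonneg _))
    have hSQ : S ≤ Q / c := by rw [le_div_iff₀ hc]; linarith
    have hQ0 : 0 ≤ Q := le_trans (mul_nonneg hc.le hS) hq
    have hT : a * x0 ^ 2 + ∑ b, (a * m b 0 ^ 2 + K b b) * x (.inr b) ^ 2 ≤
        (2 + (Fintype.card ι + 2) / c) * (a * (x0 + l) ^ 2 + Q) := by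
      have h6 : (Fintype.card ι + 2 : ℝ) * S ≤ (Fintype.card ι + 2) / c * Q := by
        calc _ ≤ (Fintype.card ι + 2 : ℝ) * (Q / c) := mul_le_mul_of_nonneg_left hSQ (by positivity)
          _ = _ := by ring
      have h7 : 0 ≤ (Fintype.card ι + 2 : ℝ) / c * (a * (x0 + l) ^ 2) := by positivity
      nlinarith [mul_nonneg hn hS]
    refine (mul_le_mul_of_nonneg_right (min_le_left _ _) hT0).trans ?_
    rw [inv_mul_le_iff₀ (by positivity)]
    exact hT
  · rw [det_ldl, Fintype.prod_sum_type, Finset.univ_unique, Finset.prod_singleton,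
      Fin.default_eq_zero, e0]
    simp only [e1]
    have h1 : ∏ b, (a * m b 0 ^ 2 + K b b) ≤ (4 / 3) ^ Fintype.card ι * ∏ b, K b b := by
      calc _ ≤ ∏ b, (4 / 3 * K b b) := Finset.prod_le_prod (fun b _ => hd0 b) fun b _ => hd b
        _ = _ := by rw [Finset.prod_mul_distrib, Finset.prod_const, Finset.card_univ]
    have h0 : 0 ≤ a * ∏ b, (a * m b 0 ^ 2 + K b b) :=
      mul_nonneg ha.le (Finset.prod_nonneg fun b _ => hd0 b)
    refine (mul_le_mul_of_nonneg_right (min_le_right _ _) h0).trans ?_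
    have huv : (3 / 4 : ℝ) ^ Fintype.card ι * (4 / 3) ^ Fintype.card ι = 1 := by
      rw [← mul_pow]; norm_num
    have hu : (0 : ℝ) ≤ (3 / 4) ^ Fintype.card ι := by positivity
    generalize (3 / 4 : ℝ) ^ Fintype.card ι = u at *
    generalize (4 / 3 : ℝ) ^ Fintype.card ι = v at *
    calc _ = a * (c * u * ∏ b, (a * m b 0 ^ 2 + K b b)) := by ring
      _ ≤ a * (c * u * (v * ∏ b, K b b)) := by gcongr
      _ = a * (c * ((u * v) * ∏ b, K b b)) := by ring
      _ = a * (c * ∏ b, K b b) := by rw [huv, one_mul]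
      _ ≤ _ := mul_le_mul_of_nonneg_left hK.2 ha.le

theorem IsReduced.submatrix {c : ℝ} {H : Matrix ι ι ℝ} (h : IsReduced c H) (e : κ ≃ ι) :
    IsReduced c (H.submatrix e e) := by
  constructor
  · intro x
    have := h.1 (x ∘ e.symm)
    rw [← e.sum_comp] at this
    rw [comp_equiv_symm_dotProduct] at this
    rw [submatrix_mulVec_equiv]
    simpa using this
  · rw [det_submatrix_equiv_self]
    have := h.2
    rw [← e.prod_comp] at this
    exact this

variable (ι) in
/-- Hermite's reduction theorem for the index type `ι`. -/
def HermiteReduction : Prop := ∃ c : ℝ, 0 < c ∧ ∀ H : Matrix ι ι ℝ, H.PosDef → HasDenom H →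
  ∃ U : Matrix ι ι ℤ, IsUnit U.det ∧ IsReduced c (congrInt U H)

theorem HermiteReduction.reindex (h : HermiteReduction ι) (e : κ ≃ ι) : HermiteReduction κ := by
  obtain ⟨c, hc, h⟩ := h
  refine ⟨c, hc, fun H hH hN => ?_⟩
  obtain ⟨U, hU, hr⟩ := h (H.submatrix e.symm e.symm) (hH.submatrix e.symm.injective) (by
    obtain ⟨N, hN, h⟩ := hN
    exact ⟨N, hN, fun a b => h _ _⟩)
  refine ⟨U.submatrix e e, by rwa [det_submatrix_equiv_self], ?_⟩
  have := hr.submatrix e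
  have e2 : congrInt (U.submatrix e e) H =
      (congrInt U (H.submatrix e.symm e.symm)).submatrix e e := by
    have e3 : (U.submatrix e e).map (Int.castRingHom ℝ) =
      (U.map (Int.castRingHom ℝ)).submatrix e e := rfl
    rw [congrInt, congrInt, ← submatrix_mul_equiv _ _ _ e _, ← submatrix_mul_equiv _ _ _ e _, e3]
    simp [submatrix_submatrix]
  rwa [e2]

/-- A first change of basis minimises the first diagonal entry a; then the Schur complement is
reduced by V, and the shift t rounds the off-diagonal quotients to absolute value at most 1/2.
Neither V nor t changes a, so a remains minimal. -/
theorem HermiteReduction.step (h : HermiteReduction ι) : HermiteReduction (Fin 1 ⊕ ι) := by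
  obtain ⟨c, hc, h⟩ := h
  refine ⟨min (2 + (Fintype.card ι + 2) / c)⁻¹ (c * (3 / 4) ^ Fintype.card ι),
    lt_min (by positivity) (by positivity), fun H hH hN => ?_⟩
  obtain ⟨U₁, hU₁, hmin⟩ := exists_min_congrInt hH hN (.inl 0)
  have hH₁ := congrInt_posDef hU₁ hH
  have hN₁ := hN.congrInt U₁
  obtain ⟨m, K, hK, hKpos⟩ := exists_ldl hH₁
  have ha : 0 < congrInt U₁ H (.inl 0) (.inl 0) := hH₁.diag_pos
  generalize congrInt U₁ H (.inl 0) (.inl 0) = a at *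
  obtain ⟨V, hV, hr⟩ := h K hKpos (HasDenom.schur ha (hK ▸ hN₁))
  set t : Matrix ι (Fin 1) ℤ := Matrix.of fun b _ => -round ((V.map (Int.castRingHom ℝ) * m) b 0)
    with ht
  have hU₂ : IsUnit (fromBlocks (1 : Matrix (Fin 1) (Fin 1) ℤ) 0 t V).det := by
    rw [det_fromBlocks_zero₁₂, det_one, one_mul]; exact hV
  refine ⟨fromBlocks 1 0 t V * U₁, by rw [det_mul]; exact hU₂.mul hU₁, ?_⟩
  have hmin2 : ∀ b, a ≤ congrInt (fromBlocks 1 0 t V) (congrInt U₁ H) (.inr b) (.inr b) := by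
    intro b
    -- Exchanging the first basis vector with the b-th one brings the b-th diagonal entry to the
    -- first place, where minimality of a applies.
    have hσ : IsUnit (((1 : Matrix (Fin 1 ⊕ ι) (Fin 1 ⊕ ι) ℤ).submatrix
        (Equiv.swap (Sum.inl 0) (Sum.inr b)) id) * fromBlocks 1 0 t V).det := by
      rw [det_mul]
      refine IsUnit.mul ?_ hU₂
      rw [det_permute]
      simp
    have := hmin _ hσ
    rw [congrInt_mul] at this
    convert this using 1
    generalize congrInt (fromBlocks 1 0 t V) (congrInt U₁ H) = M
    simp [congrInt, Matrix.mul_apply, Matrix.one_apply]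
  rw [congrInt_mul]
  rw [hK, congrInt_ldl] at hmin2 ⊢
  refine hr.ldl hc ha (fun b => ?_) (fun b => ?_)
  · have : (t.map (Int.castRingHom ℝ) + V.map (Int.castRingHom ℝ) * m) b 0 =
        (V.map (Int.castRingHom ℝ) * m) b 0 - round ((V.map (Int.castRingHom ℝ) * m) b 0) := by
      simp [ht]; ring
    rw [this]
    exact abs_sub_round _
  · refine (hmin2 b).trans (le_of_eq ?_)
    generalize t.map (Int.castRingHom ℝ) + V.map (Int.castRingHom ℝ) * m = m'
    simp [ldl_eq, Matrix.mul_apply, sq]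

theorem hermiteReduction (n : ℕ) : HermiteReduction (Fin n) := by
  induction n with
  | zero =>
    refine ⟨1, one_pos, fun H _ _ => ⟨1, by simp, ?_, ?_⟩⟩
    · intro x; simp
    · simp
  | succ n ih =>
    exact ih.step.reindex ((finCongr (Nat.add_comm n 1)).trans finSumFinEquiv.symm)

end Reduction

/-! ### The points g⟨i⟩: `gramD` is the inverse of the imaginary part, `realPart` the real part. -/

section Gram

variable {n : ℕ}

/-- `C Cᵀ + D Dᵀ`. -/
def gramD (g : SpZ n) : Matrix (Fin n) (Fin n) ℝ := bC ℝ g * (bC ℝ g)ᵀ + bD ℝ g * (bD ℝ g)ᵀ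

/-- `A Cᵀ + B Dᵀ`. -/
def gramAD (g : SpZ n) : Matrix (Fin n) (Fin n) ℝ := bA ℝ g * (bC ℝ g)ᵀ + bB ℝ g * (bD ℝ g)ᵀ

/-- `A Aᵀ + B Bᵀ`. -/
def gramA (g : SpZ n) : Matrix (Fin n) (Fin n) ℝ := bA ℝ g * (bA ℝ g)ᵀ + bB ℝ g * (bB ℝ g)ᵀ

/-- The real part of `g⟨i⟩`. -/
def realPart (g : SpZ n) : Matrix (Fin n) (Fin n) ℝ := gramAD g * (gramD g)⁻¹

theorem gramD_transpose (g : SpZ n) : (gramD g)ᵀ = gramD g := by simp [gramD]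

theorem gramD_posDef (g : SpZ n) : (gramD g).PosDef := by
  refine PosDef.of_dotProduct_mulVec_pos ?_ fun x hx => ?_
  · rw [Matrix.IsHermitian, conjTranspose_eq_transpose_of_trivial, gramD_transpose]
  · have e : star x ⬝ᵥ (gramD g *ᵥ x) = (bC ℝ g)ᵀ *ᵥ x ⬝ᵥ (bC ℝ g)ᵀ *ᵥ x +
        (bD ℝ g)ᵀ *ᵥ x ⬝ᵥ (bD ℝ g)ᵀ *ᵥ x := by
      rw [gramD, add_mulVec, dotProduct_add, ← mulVec_mulVec, ← mulVec_mulVec, dotProduct_mulVec,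
        dotProduct_mulVec _ (bD ℝ g), ← mulVec_transpose, ← mulVec_transpose, star_trivial]
    have n1 : ∀ y : Fin n → ℝ, 0 ≤ y ⬝ᵥ y := fun y =>
      Finset.sum_nonneg fun a _ => mul_self_nonneg _
    rw [e]
    refine lt_of_le_of_ne (add_nonneg (n1 _) (n1 _)) fun h => hx ?_
    have h1 : (bC ℝ g)ᵀ *ᵥ x = 0 := dotProduct_self_eq_zero.1
      (le_antisymm (by linarith [n1 ((bD ℝ g)ᵀ *ᵥ x)]) (n1 _))
    have h2 : (bD ℝ g)ᵀ *ᵥ x = 0 := dotProduct_self_eq_zero.1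
      (le_antisymm (by linarith [n1 ((bC ℝ g)ᵀ *ᵥ x)]) (n1 _))
    rw [← one_mulVec x, ← (row_rel ℝ g).2.2, sub_mulVec, ← mulVec_mulVec, ← mulVec_mulVec, h1, h2]
    simp

theorem gramD_entry (g : SpZ n) (a b : Fin n) :
    gramD g a b = ((bC ℤ g * (bC ℤ g)ᵀ + bD ℤ g * (bD ℤ g)ᵀ) a b : ℤ) := by
  rw [gramD, map_bC ℝ, map_bD ℝ]
  simp [Matrix.mul_apply]

theorem gramD_hasDenom (g : SpZ n) : HasDenom (gramD g) :=
  ⟨1, one_pos, fun a b => ⟨(bC ℤ g * (bC ℤ g)ᵀ + bD ℤ g * (bD ℤ g)ᵀ) a b, by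
    rw [Nat.cast_one, one_mul, gramD_entry]⟩⟩

theorem gram_mul_transpose (g : SpZ n) :
    fromBlocks (bA ℝ g) (bB ℝ g) (bC ℝ g) (bD ℝ g) *
      (fromBlocks (bA ℝ g) (bB ℝ g) (bC ℝ g) (bD ℝ g))ᵀ =
      fromBlocks (gramA g) (gramAD g) (gramAD g)ᵀ (gramD g) := by
  simp [fromBlocks_transpose, fromBlocks_multiply, gramA, gramAD, gramD]

/-- The matrix g gᵀ is again symplectic, and its blocks are the three Gram matrices. -/
theorem gram_rel (g : SpZ n) : (gramAD g)ᵀ * gramD g = gramD g * gramAD g ∧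
    gramA g * gramD g - gramAD g * gramAD g = 1 := by
  have h := (symplecticGroup (Fin n) ℝ).mul_mem (fromBlocks_mem ℝ g)
    (SymplecticGroup.transpose_mem (fromBlocks_mem ℝ g))
  rw [gram_mul_transpose, SymplecticGroup.fromBlocks_mem_iff] at h
  obtain ⟨-, h2, h3⟩ := h
  rw [gramD_transpose] at h2
  have hA : (gramA g)ᵀ = gramA g := by simp [gramA]
  rw [hA, transpose_transpose] at h3
  exact ⟨h2, h3⟩

theorem gramD_isUnit (g : SpZ n) : IsUnit (gramD g).det := (gramD_posDef g).det_pos.ne'.isUnit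

theorem realPart_transpose (g : SpZ n) : (realPart g)ᵀ = realPart g := by
  have hu := gramD_isUnit g
  rw [realPart, transpose_mul, transpose_nonsing_inv, gramD_transpose]
  calc (gramD g)⁻¹ * (gramAD g)ᵀ = (gramD g)⁻¹ * ((gramAD g)ᵀ * gramD g) * (gramD g)⁻¹ := by
        rw [Matrix.mul_assoc, Matrix.mul_assoc, mul_nonsing_inv _ hu, Matrix.mul_one]
    _ = _ := by
        rw [(gram_rel g).1, ← Matrix.mul_assoc, nonsing_inv_mul _ hu, Matrix.one_mul]

theorem gramAD_eq (g : SpZ n) : gramAD g = realPart g * gramD g := by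
  rw [realPart, Matrix.mul_assoc, nonsing_inv_mul _ (gramD_isUnit g), Matrix.mul_one]

theorem gramA_eq (g : SpZ n) :
    gramA g = (gramD g)⁻¹ + realPart g * gramD g * realPart g := by
  have hu := gramD_isUnit g
  have h := (gram_rel g).2
  rw [sub_eq_iff_eq_add] at h
  calc gramA g = gramA g * gramD g * (gramD g)⁻¹ := by
        rw [Matrix.mul_assoc, mul_nonsing_inv _ hu, Matrix.mul_one]
    _ = _ := by
        rw [h, Matrix.add_mul, Matrix.one_mul, Matrix.mul_assoc (gramAD g), ← realPart, ← gramAD_eq]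

theorem trace_fromBlocks' {R : Type*} [CommRing R] (A B C D : Matrix (Fin n) (Fin n) R) :
    trace (fromBlocks A B C D) = trace A + trace D := by
  simp [trace]

/-- The invariant distance of two points of the upper half space, for elements of `Sp(n, ℤ)`. -/
theorem trace_inv_mul (g g' : SpZ n) :
    trace ((g'⁻¹ * g).1.map (Int.castRingHom ℝ) * ((g'⁻¹ * g).1.map (Int.castRingHom ℝ))ᵀ) =
      trace ((gramD g)⁻¹ * gramD g') + trace ((gramD g')⁻¹ * gramD g) +
      trace (((realPart g - realPart g') * gramD g) * ((realPart g - realPart g') * gramD g')) := by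
  obtain ⟨i1, i2, i3, i4⟩ := blocks_inv ℝ g'
  have e1 : (g'⁻¹ * g).1.map (Int.castRingHom ℝ) = (g'⁻¹).1.map (Int.castRingHom ℝ) *
      g.1.map (Int.castRingHom ℝ) := by rw [Submonoid.coe_mul, Matrix.map_mul]
  rw [e1, transpose_mul, Matrix.mul_assoc, trace_mul_comm]
  have e2 : ((g'⁻¹).1.map (Int.castRingHom ℝ))ᵀ * (g'⁻¹).1.map (Int.castRingHom ℝ) =
      fromBlocks (gramD g') (-(gramAD g')ᵀ) (-gramAD g') (gramA g') := by
    rw [map_eq_fromBlocks, i1, i2, i3, i4]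
    simp [fromBlocks_transpose, fromBlocks_multiply, gramA, gramAD, gramD]
    exact ⟨add_comm _ _, add_comm _ _⟩
  have e3 : g.1.map (Int.castRingHom ℝ) * ((g.1.map (Int.castRingHom ℝ))ᵀ *
      ((g'⁻¹).1.map (Int.castRingHom ℝ))ᵀ) * (g'⁻¹).1.map (Int.castRingHom ℝ) =
      g.1.map (Int.castRingHom ℝ) * (g.1.map (Int.castRingHom ℝ))ᵀ *
      (((g'⁻¹).1.map (Int.castRingHom ℝ))ᵀ * (g'⁻¹).1.map (Int.castRingHom ℝ)) := by
    simp only [Matrix.mul_assoc]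
  rw [e3, e2, map_eq_fromBlocks, gram_mul_transpose, fromBlocks_multiply, trace_fromBlocks',
    trace_add, trace_add, gramA_eq g, gramA_eq g', gramAD_eq g, gramAD_eq g']
  have s := realPart_transpose g
  have s' := realPart_transpose g'
  have t := gramD_transpose g
  have t' := gramD_transpose g'
  generalize realPart g = S at *
  generalize realPart g' = S' at *
  generalize gramD g = H at *
  generalize gramD g' = H' at *
  simp only [Matrix.mul_neg, trace_neg, transpose_mul, s, s', t, t', Matrix.mul_add, Matrix.add_mul,
    Matrix.sub_mul, Matrix.mul_sub, trace_add, trace_sub]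
  rw [trace_mul_comm H H'⁻¹, trace_mul_comm H (S' * H' * S')]
  -- The cross terms agree up to transposition and cyclic permutation under the trace, all four
  -- matrices being symmetric.
  have c1 : trace (S' * H * (S * H')) = trace (S * H * (S' * H')) := by
    rw [← trace_transpose]
    simp only [transpose_mul, s, s', t, t']
    simp only [Matrix.mul_assoc]
    rw [trace_mul_comm H']
    simp only [Matrix.mul_assoc]
  have c2 : trace (H * S * (H' * S')) = trace (S * H * (S' * H')) := by
    rw [← trace_transpose]
    simp only [transpose_mul, s, s', t, t']
    rw [trace_mul_comm]
  have c3 : trace (S' * H' * S' * H) = trace (S' * H * (S' * H')) := by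
    simp only [Matrix.mul_assoc]
    rw [trace_mul_comm S']
    simp only [Matrix.mul_assoc]
    rw [trace_mul_comm H']
    simp only [Matrix.mul_assoc]
  simp only [Matrix.mul_assoc] at c1 c2 c3 ⊢
  rw [c1, c2, c3]
  ring

theorem gramD_levi_mul (W V : Matrix (Fin n) (Fin n) ℤ) (h : Wᵀ * V = 1) (g : SpZ n) :
    gramD (levi W V h * g) = congrInt V (gramD g) := by
  obtain ⟨-, -, h3, h4⟩ := blocks_levi ℝ W V h
  rw [gramD, bC_mul, bD_mul, h3, h4, gramD, congrInt]
  simp only [Matrix.zero_mul, zero_add, transpose_mul, Matrix.mul_add, Matrix.add_mul,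
    Matrix.mul_assoc]

theorem gramD_transl_mul (T : Matrix (Fin n) (Fin n) ℤ) (h : Tᵀ = T) (g : SpZ n) :
    gramD (transl T h * g) = gramD g ∧
      realPart (transl T h * g) = realPart g + T.map (Int.castRingHom ℝ) := by
  obtain ⟨h1, h2, h3, h4⟩ := blocks_transl ℝ T h
  have e : gramD (transl T h * g) = gramD g := by
    rw [gramD, bC_mul, bD_mul, h3, h4, gramD]
    simp
  refine ⟨e, ?_⟩
  have e2 : gramAD (transl T h * g) = gramAD g + T.map (Int.castRingHom ℝ) * gramD g := by
    rw [gramAD, bC_mul, bD_mul, (blocks_mul ℝ _ _).1, (blocks_mul ℝ _ _).2.1, h1, h2, h3, h4, gramD,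
      gramAD]
    simp only [Matrix.zero_mul, Matrix.one_mul, zero_add, Matrix.mul_add, Matrix.add_mul,
      Matrix.mul_assoc]
    abel
  rw [realPart, e, e2, Matrix.add_mul, Matrix.mul_assoc, mul_nonsing_inv _ (gramD_isUnit g),
    Matrix.mul_one, realPart]

variable (n) in
-- The Levi part of P acts on `gramD` by GLₙ(ℤ), so Hermite reduction applies; afterwards an
-- integral symmetric translation brings the real part close to 0 without changing `gramD`.
theorem exists_reduced_rep : ∃ c : ℝ, 0 < c ∧ ∀ g : SpZ n, ∃ η ∈ parabolic n,
    IsReduced c (gramD (η * g)) ∧ ∀ a b, |realPart (η * g) a b| ≤ 1 / 2 := by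
  obtain ⟨c, hc, h⟩ := hermiteReduction n
  refine ⟨c, hc, fun g => ?_⟩
  obtain ⟨U, hU, hr⟩ := h (gramD g) (gramD_posDef g) (gramD_hasDenom g)
  have hWV : ((U⁻¹)ᵀ)ᵀ * U = 1 := by rw [transpose_transpose, nonsing_inv_mul _ hU]
  set g₁ := levi _ U hWV * g with hg₁
  have hT : (Matrix.of fun a b => -round (realPart g₁ a b) : Matrix (Fin n) (Fin n) ℤ)ᵀ =
      Matrix.of fun a b => -round (realPart g₁ a b) := by
    ext a b
    have := congrFun (congrFun (realPart_transpose g₁) a) b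
    simp only [transpose_apply, of_apply] at this ⊢
    rw [this]
  obtain ⟨e1, e2⟩ := gramD_transl_mul _ hT g₁
  refine ⟨transl _ hT * levi _ U hWV, mul_mem (transl_mem_parabolic _ _) (levi_mem_parabolic _ _ _),
    ?_, fun a b => ?_⟩
  · rw [mul_assoc, ← hg₁, e1, hg₁, gramD_levi_mul]
    exact hr
  · rw [mul_assoc, ← hg₁, e2]
    have := abs_sub_round (realPart g₁ a b)
    simpa [sub_eq_add_neg] using this

end Gram

/-! ### Entrywise bounds for reduced points and for their invariant distance. -/

section Bounds

variable {n : ℕ}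

theorem one_le_gramD_diag (g : SpZ n) (a : Fin n) : 1 ≤ gramD g a a := by
  have h := (gramD_posDef g).diag_pos (i := a)
  rw [gramD_entry] at h ⊢
  have : 0 < (bC ℤ g * (bC ℤ g)ᵀ + bD ℤ g * (bD ℤ g)ᵀ) a a := by exact_mod_cast h
  exact_mod_cast this

/-- Entries of `X` bounded by `K u_a v_b`. -/
def EntryBound (K : ℝ) (u v : Fin n → ℝ) (X : Matrix (Fin n) (Fin n) ℝ) : Prop :=
  ∀ a b, |X a b| ≤ K * u a * v b

theorem EntryBound.mul {K L : ℝ} {u v w : Fin n → ℝ} {X Y : Matrix (Fin n) (Fin n) ℝ}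
    (hX : EntryBound K u v X) (hY : EntryBound L (fun a => (v a)⁻¹) w Y) (hv : ∀ a, 0 < v a) :
    EntryBound (n * (K * L)) u w (X * Y) := by
  intro a b
  rw [Matrix.mul_apply]
  refine (Finset.abs_sum_le_sum_abs _ _).trans ?_
  have : ∀ c ∈ Finset.univ, |X a c * Y c b| ≤ K * L * u a * w b := fun c _ => by
    rw [abs_mul]
    refine (mul_le_mul (hX a c) (hY c b) (abs_nonneg _) ((abs_nonneg _).trans (hX a c))).trans
      (le_of_eq ?_)
    have := (hv c).ne'
    field_simp
  refine (Finset.sum_le_sum this).trans (le_of_eq ?_)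
  simp
  ring

theorem EntryBound.trace_le {K : ℝ} {u v : Fin n → ℝ} {X : Matrix (Fin n) (Fin n) ℝ}
    (hX : EntryBound K u v X) (huv : ∀ a, u a * v a = 1) : trace X ≤ n * K := by
  have : ∀ a ∈ Finset.univ, X a a ≤ K := fun a _ => by
    have := (le_abs_self _).trans (hX a a)
    rwa [mul_assoc, huv, mul_one] at this
  refine (Finset.sum_le_sum this).trans (le_of_eq ?_)
  simp

/-- Positivity is applied to the two vectors τ_b e_a ± τ_a e_b, which makes the two diagonal
contributions comparable. -/
theorem entryBound_of_posDef {H : Matrix (Fin n) (Fin n) ℝ} (hH : H.PosDef) {τ : Fin n → ℝ}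
    (hτ : ∀ a, 0 < τ a) (h : ∀ a, H a a ≤ 2 * τ a ^ 2) : EntryBound 2 τ τ H := by
  intro a b
  have hs : H b a = H a b := by simpa using congrFun (congrFun hH.isHermitian a) b
  have key : ∀ e : ℝ, e ^ 2 = 1 → 0 ≤ τ b ^ 2 * H a a + τ a ^ 2 * H b b + 2 * e * τ a * τ b * H a b := by
    intro e he
    have := hH.posSemidef.dotProduct_mulVec_nonneg (Pi.single a (τ b) + Pi.single b (e * τ a))
    simp only [star_trivial, mulVec_add, mulVec_single, dotProduct_add, add_dotProduct,
      single_dotProduct, Pi.smul_apply, MulOpposite.smul_eq_mul_unop, MulOpposite.unop_op,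
      Matrix.col_apply, hs] at this
    refine this.trans (le_of_eq ?_)
    linear_combination τ a ^ 2 * H b b * he
  have h1 := key 1 (by norm_num)
  have h2 := key (-1) (by norm_num)
  have hab := mul_pos (hτ a) (hτ b)
  have h3 : τ b ^ 2 * H a a + τ a ^ 2 * H b b ≤ 4 * (τ a * τ b) ^ 2 := by
    nlinarith [mul_le_mul_of_nonneg_left (h a) (sq_nonneg (τ b)),
      mul_le_mul_of_nonneg_left (h b) (sq_nonneg (τ a))]
  rw [abs_le]
  constructor
  · refine le_of_mul_le_mul_left ?_ (mul_pos two_pos hab)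
    nlinarith
  · refine le_of_mul_le_mul_left ?_ (mul_pos two_pos hab)
    nlinarith

/-- For the column x = H⁻¹e_b, reducedness says c Σ_a H_aa x_a² ≤ x_b. The term a = b bounds x_b,
and then every term bounds its x_a. -/
theorem entryBound_inv {c : ℝ} (hc : 0 < c) {H : Matrix (Fin n) (Fin n) ℝ} (hH : H.PosDef)
    (hr : IsReduced c H) {τ : Fin n → ℝ} (hτ : ∀ a, 0 < τ a) (h : ∀ a, τ a ^ 2 ≤ H a a) :
    EntryBound c⁻¹ (fun a => (τ a)⁻¹) (fun a => (τ a)⁻¹) H⁻¹ := by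
  intro a b
  have hu : IsUnit H.det := hH.det_pos.ne'.isUnit
  set x : Fin n → ℝ := H⁻¹ *ᵥ Pi.single b 1 with hx
  have hxa : ∀ a, x a = H⁻¹ a b := fun a => by simp [hx]
  have hHx : H *ᵥ x = Pi.single b 1 := by
    rw [hx, mulVec_mulVec, mul_nonsing_inv _ hu, one_mulVec]
  have h1 := hr.1 x
  rw [hHx, dotProduct_single, mul_one] at h1
  have h2 : ∀ a, c * (τ a * x a) ^ 2 ≤ x b := fun a => by
    refine le_trans (mul_le_mul_of_nonneg_left ?_ hc.le) h1
    calc (τ a * x a) ^ 2 = τ a ^ 2 * x a ^ 2 := mul_pow _ _ _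
      _ ≤ H a a * x a ^ 2 := mul_le_mul_of_nonneg_right (h a) (sq_nonneg _)
      _ ≤ _ := Finset.single_le_sum (f := fun a => H a a * x a ^ 2)
          (fun a _ => mul_nonneg ((sq_nonneg _).trans (h a)) (sq_nonneg _)) (Finset.mem_univ a)
  have hb : c * τ b ^ 2 * x b ≤ 1 := by
    have h3 := h2 b
    rcases le_or_gt (x b) 0 with h0 | h0
    · nlinarith [mul_pos hc (pow_pos (hτ b) 2)]
    · refine le_of_mul_le_mul_right ?_ h0
      nlinarith
  rw [← hxa]
  have h4 : (c * τ a * τ b * x a) ^ 2 ≤ 1 := by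
    calc (c * τ a * τ b * x a) ^ 2 = c * τ b ^ 2 * (c * (τ a * x a) ^ 2) := by ring
      _ ≤ c * τ b ^ 2 * x b := mul_le_mul_of_nonneg_left (h2 a) (by positivity)
      _ ≤ 1 := hb
  have h5 := (sq_le_one_iff_abs_le_one _).1 h4
  have hp : 0 < c * τ a * τ b := mul_pos (mul_pos hc (hτ a)) (hτ b)
  rw [abs_mul, abs_of_pos hp] at h5
  rw [← mul_inv, ← mul_inv, ← one_div, le_div_iff₀ hp, mul_comm]
  exact h5

/-- Two reduced points with diagonal entries of the same size τ_a² and real parts agreeing up to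
1/(τ_a τ_b) have bounded invariant distance. The powers of τ cancel in each trace, so g'⁻¹g is
bounded independently of τ. -/
theorem trace_inv_mul_le {c : ℝ} (hc : 0 < c) {g g' : SpZ n} (hr : IsReduced c (gramD g))
    (hr' : IsReduced c (gramD g')) {τ : Fin n → ℝ} (hτ : ∀ a, 0 < τ a)
    (h1 : ∀ a, τ a ^ 2 ≤ gramD g a a ∧ gramD g a a ≤ 2 * τ a ^ 2)
    (h1' : ∀ a, τ a ^ 2 ≤ gramD g' a a ∧ gramD g' a a ≤ 2 * τ a ^ 2)
    (h2 : ∀ a b, a ≤ b → |realPart g a b - realPart g' a b| * (τ a * τ b) ≤ 1) :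
    trace ((g'⁻¹ * g).1.map (Int.castRingHom ℝ) * ((g'⁻¹ * g).1.map (Int.castRingHom ℝ))ᵀ) ≤
      n * (n * (c⁻¹ * 2)) + n * (n * (c⁻¹ * 2)) +
        n * (n * (n * (1 * 2) * (n * (1 * 2)))) := by
  have hτi : ∀ a, 0 < (τ a)⁻¹ := fun a => inv_pos.2 (hτ a)
  have b1 := entryBound_of_posDef (gramD_posDef g) hτ fun a => (h1 a).2
  have b1' := entryBound_of_posDef (gramD_posDef g') hτ fun a => (h1' a).2
  have b2 := entryBound_inv hc (gramD_posDef g) hr hτ fun a => (h1 a).1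
  have b2' := entryBound_inv hc (gramD_posDef g') hr' hτ fun a => (h1' a).1
  have b3 : EntryBound 1 (fun a => (τ a)⁻¹) (fun a => (τ a)⁻¹) (realPart g - realPart g') := by
    have key : ∀ a b, a ≤ b → |(realPart g - realPart g') a b| ≤ 1 * (τ a)⁻¹ * (τ b)⁻¹ := by
      intro a b hab
      rw [one_mul, ← mul_inv, ← one_div, le_div_iff₀ (mul_pos (hτ a) (hτ b)), Matrix.sub_apply]
      exact h2 a b hab
    intro a b
    rcases le_total a b with hab | hab
    · exact key a b hab
    · have hs : (realPart g - realPart g') a b = (realPart g - realPart g') b a := by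
        have e1 := congrFun (congrFun (realPart_transpose g) a) b
        have e2 := congrFun (congrFun (realPart_transpose g') a) b
        rw [transpose_apply] at e1 e2
        rw [Matrix.sub_apply, Matrix.sub_apply, e1, e2]
      rw [hs]
      exact (key b a hab).trans (le_of_eq (by ring))
  have hii : (fun a => ((fun a => (τ a)⁻¹) a)⁻¹) = τ := by ext a; simp
  have hinv : ∀ a, (τ a)⁻¹ * τ a = 1 := fun a => inv_mul_cancel₀ (hτ a).ne'
  rw [trace_inv_mul]
  have c1 := EntryBound.mul b2 (hii ▸ b1') hτi
  have c1' := EntryBound.mul b2' (hii ▸ b1) hτi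
  have c2 := EntryBound.mul b3 (hii ▸ b1) hτi
  have c2' := EntryBound.mul b3 (hii ▸ b1') hτi
  rw [hii] at c1 c1' c2 c2'
  have c3 := EntryBound.mul c2 c2' hτ
  exact add_le_add (add_le_add (c1.trace_le hinv) (c1'.trace_le hinv)) (c3.trace_le hinv)

theorem finite_trace_le (R : ℝ) : {g : SpZ n |
    trace (g.1.map (Int.castRingHom ℝ) * (g.1.map (Int.castRingHom ℝ))ᵀ) ≤ R}.Finite := by
  have hf : {M : Matrix (Idx n) (Idx n) ℤ | ∀ a b, M a b ∈ Set.Icc (-⌈R⌉) ⌈R⌉}.Finite := by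
    have := Set.Finite.pi' (fun _ : Idx n => Set.Finite.pi' fun _ : Idx n =>
      Set.finite_Icc (-⌈R⌉) ⌈R⌉)
    exact this
  refine Set.Finite.of_finite_image (f := Subtype.val) (hf.subset ?_) Subtype.val_injective.injOn
  rintro _ ⟨g, hg, rfl⟩ a b
  have h1 : ((g.1 a b : ℤ) : ℝ) ^ 2 ≤ R := by
    refine le_trans ?_ hg
    rw [trace]
    simp only [diag_apply, Matrix.mul_apply, transpose_apply, map_apply, ← sq]
    refine le_trans ?_ (Finset.single_le_sum (f := fun a => ∑ b, ((Int.castRingHom ℝ) (g.1 a b)) ^ 2)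
      (fun a _ => Finset.sum_nonneg fun b _ => sq_nonneg _) (Finset.mem_univ a))
    exact Finset.single_le_sum (f := fun b => ((Int.castRingHom ℝ) (g.1 a b)) ^ 2)
      (fun b _ => sq_nonneg _) (Finset.mem_univ b)
  have h2 : g.1 a b ^ 2 ≤ ⌈R⌉ := by
    have := h1.trans (Int.le_ceil R)
    exact_mod_cast this
  have h3 : |g.1 a b| ≤ ⌈R⌉ := by
    rcases eq_or_ne (g.1 a b) 0 with h0 | h0
    · rw [h0] at h2 ⊢
      simpa using h2
    refine le_trans ?_ h2
    rw [← sq_abs]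
    exact le_self_pow₀ (Int.one_le_abs h0) two_ne_zero
  exact Set.mem_Icc.2 (abs_le.1 h3)

end Bounds

/-! ### Elementary counting and summation lemmas. -/

section Counting

theorem summable_prod_pow (n : ℕ) {ρ : ℝ} (h0 : 0 ≤ ρ) (h1 : ρ < 1) :
    Summable fun m : Fin n → ℕ => ∏ a, ρ ^ m a := by
  refine summable_of_sum_le (c := ((1 - ρ)⁻¹) ^ n)
    (fun m => Finset.prod_nonneg fun a _ => pow_nonneg h0 _) fun u => ?_
  have hsub : u ⊆ Fintype.piFinset fun _ => Finset.range (u.sup (fun m => Finset.univ.sup m) + 1) := by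
    intro m hm
    rw [Fintype.mem_piFinset]
    intro a
    rw [Finset.mem_range, Nat.lt_succ_iff]
    exact (Finset.le_sup (f := m) (Finset.mem_univ a)).trans
      (Finset.le_sup (f := fun m : Fin n → ℕ => Finset.univ.sup m) hm)
  refine (Finset.sum_le_sum_of_subset_of_nonneg hsub fun m _ _ =>
    Finset.prod_nonneg fun a _ => pow_nonneg h0 _).trans ?_
  rw [← Finset.prod_univ_sum]
  refine (Finset.prod_le_prod (fun a _ => Finset.sum_nonneg fun _ _ => pow_nonneg h0 _)
    (g := fun _ => (1 - ρ)⁻¹) fun a _ => ?_).trans (le_of_eq (by simp))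
  rw [← tsum_geometric_of_lt_one h0 h1]
  exact (summable_geometric_of_lt_one h0 h1).sum_le_tsum _ fun _ _ => pow_nonneg h0 _

theorem summable_of_fiber_bound {α β : Type*} [DecidableEq β] (φ : α → β) {F N : β → ℝ}
    (hF : ∀ b, 0 ≤ F b) (hN : ∀ b, 0 ≤ N b)
    (h : ∀ b (u : Finset α), (∀ a ∈ u, φ a = b) → (u.card : ℝ) ≤ N b)
    (hs : Summable fun b => N b * F b) : Summable fun a => F (φ a) := by
  refine summable_of_sum_le (c := ∑' b, N b * F b) (fun a => hF _) fun u => ?_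
  rw [← Finset.sum_fiberwise_of_maps_to (t := u.image φ) (g := φ)
    fun a ha => Finset.mem_image_of_mem φ ha]
  refine le_trans (Finset.sum_le_sum fun b _ => ?_)
    (hs.sum_le_tsum _ fun b _ => mul_nonneg (hN b) (hF b))
  have e : ∀ a ∈ u.filter (fun a => φ a = b), F (φ a) = F b := fun a ha => by
    rw [(Finset.mem_filter.1 ha).2]
  rw [Finset.sum_congr rfl e, Finset.sum_const, nsmul_eq_mul]
  exact mul_le_mul_of_nonneg_right (h b _ fun a ha => (Finset.mem_filter.1 ha).2) (hF b)

/-- Each index lies in n pairs a ≤ b, and in the pair (a, a) it counts twice. -/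
theorem prod_pairs {n : ℕ} (τ : Fin n → ℝ) :
    ∏ x : {x : Fin n × Fin n // x.1 ≤ x.2}, τ x.1.1 * τ x.1.2 = ∏ a, τ a ^ (n + 1) := by
  have e1 : ∏ x : {x : Fin n × Fin n // x.1 ≤ x.2}, τ x.1.1 * τ x.1.2 =
      ∏ a, ∏ b, if a ≤ b then τ a * τ b else 1 := by
    rw [← Fintype.prod_prod_type', ← Finset.prod_filter]
    exact (Finset.prod_subtype (Finset.univ.filter fun x : Fin n × Fin n => x.1 ≤ x.2)
      (fun x => by simp) fun x => τ x.1 * τ x.2).symm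
  have e2 : ∏ a : Fin n, ∏ b : Fin n, (if a ≤ b then τ a * τ b else 1) =
      (∏ a, ∏ b, if a ≤ b then τ a else 1) * ∏ a, ∏ b, if b ≤ a then τ a else 1 := by
    rw [Finset.prod_comm (f := fun a b : Fin n => if b ≤ a then τ a else 1), ← Finset.prod_mul_distrib]
    refine Finset.prod_congr rfl fun a _ => ?_
    rw [← Finset.prod_mul_distrib]
    refine Finset.prod_congr rfl fun b _ => ?_
    split_ifs <;> simp
  rw [e1, e2, ← Finset.prod_mul_distrib]
  refine Finset.prod_congr rfl fun a _ => ?_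
  rw [← Finset.prod_mul_distrib]
  have e3 : ∀ b : Fin n, (if a ≤ b then τ a else 1) * (if b ≤ a then τ a else 1) =
      τ a * if b = a then τ a else 1 := by
    intro b
    rcases lt_trichotomy a b with h | rfl | h
    · simp [h.le, not_le.2 h, h.ne']
    · simp
    · simp [h.le, not_le.2 h, h.ne]
  simp only [e3, Finset.prod_mul_distrib, Finset.prod_const, Finset.card_univ, Fintype.card_fin,
    Finset.prod_ite_eq', Finset.mem_univ, if_true, pow_succ]

/-- The count is below y + 2, and y + 2 ≤ 3y because y ≥ 1. -/
theorem card_Icc_floor_le {y : ℝ} (hy : 1 ≤ y) :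
    ((Finset.Icc ⌊-(y / 2)⌋ ⌊y / 2⌋).card : ℝ) ≤ 3 * y := by
  have h1 : (⌊y / 2⌋ : ℝ) ≤ y / 2 := Int.floor_le _
  have h2 : -(y / 2) - 1 < (⌊-(y / 2)⌋ : ℝ) := Int.sub_one_lt_floor _
  have h3 : ⌊-(y / 2)⌋ ≤ ⌊y / 2⌋ := Int.floor_le_floor (by linarith)
  rw [Int.card_Icc]
  have h4 : (((⌊y / 2⌋ + 1 - ⌊-(y / 2)⌋).toNat : ℕ) : ℤ) = ⌊y / 2⌋ + 1 - ⌊-(y / 2)⌋ :=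
    Int.toNat_of_nonneg (by omega)
  have h5 : (((⌊y / 2⌋ + 1 - ⌊-(y / 2)⌋).toNat : ℕ) : ℝ) = ⌊y / 2⌋ + 1 - ⌊-(y / 2)⌋ := by
    exact_mod_cast h4
  rw [h5]
  linarith

end Counting

/-! ### Convergence of the sum of det(C Cᵀ + D Dᵀ)^{-σ} over P \ Sp(n, ℤ). -/

section Summability

variable {n : ℕ}

/-- The square roots of the dyadic parts of the diagonal entries of `C Cᵀ + D Dᵀ`. -/
def dyadic (m : Fin n → ℕ) (a : Fin n) : ℝ := Real.sqrt 2 ^ m a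

theorem one_le_dyadic (m : Fin n → ℕ) (a : Fin n) : 1 ≤ dyadic m a :=
  one_le_pow₀ (Real.one_le_sqrt.2 one_le_two)

theorem dyadic_pos (m : Fin n → ℕ) (a : Fin n) : 0 < dyadic m a :=
  one_pos.trans_le (one_le_dyadic m a)

theorem dyadic_sq (m : Fin n → ℕ) (a : Fin n) : dyadic m a ^ 2 = 2 ^ m a := by
  rw [dyadic, ← pow_mul, mul_comm, pow_mul, Real.sq_sqrt zero_le_two]

/-- The binary logarithms of the diagonal entries of `C Cᵀ + D Dᵀ`. -/
def logDiag (g : SpZ n) (a : Fin n) : ℕ := Nat.log 2 ⌊gramD g a a⌋₊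

theorem logDiag_bounds (g : SpZ n) (a : Fin n) : dyadic (logDiag g) a ^ 2 ≤ gramD g a a ∧
    gramD g a a ≤ 2 * dyadic (logDiag g) a ^ 2 := by
  have h1 := one_le_gramD_diag g a
  have h0 : ⌊gramD g a a⌋₊ ≠ 0 := (Nat.floor_pos.2 h1).ne'
  rw [dyadic_sq]
  constructor
  · have := Nat.pow_log_le_self 2 h0
    have h2 : ((2 ^ logDiag g a : ℕ) : ℝ) ≤ (⌊gramD g a a⌋₊ : ℝ) := by exact_mod_cast this
    have h3 := Nat.floor_le (zero_le_one.trans h1)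
    push_cast at h2
    exact h2.trans h3
  · have := Nat.lt_pow_succ_log_self one_lt_two ⌊gramD g a a⌋₊
    have h2 := (Nat.floor_lt (zero_le_one.trans h1)).1 this
    rw [pow_succ] at h2
    push_cast at h2
    rw [mul_comm]
    exact h2.le

variable (n) in
-- The real parts are sorted into boxes with sides 1/(τ_a τ_b). There are at most ∏ 3 τ_a τ_b boxes.
-- Inside one box, comparison with a fixed g' maps g injectively to g'⁻¹g, which lies in a finite
-- set not depending on τ.
theorem exists_card_bound {c : ℝ} (hc : 0 < c) : ∃ K : ℝ, 0 ≤ K ∧ ∀ (m : Fin n → ℕ)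
    (u : Finset (SpZ n)), (∀ g ∈ u, IsReduced c (gramD g) ∧ (∀ a b, |realPart g a b| ≤ 1 / 2) ∧
      logDiag g = m) → (u.card : ℝ) ≤ K * ∏ a, dyadic m a ^ (n + 1) := by
  classical
  set R : ℝ := n * (n * (c⁻¹ * 2)) + n * (n * (c⁻¹ * 2)) + n * (n * (n * (1 * 2) * (n * (1 * 2))))
    with hR
  set B := (finite_trace_le (n := n) R).toFinset with hB
  refine ⟨B.card * 3 ^ Fintype.card {x : Fin n × Fin n // x.1 ≤ x.2}, by positivity,
    fun m u hu => ?_⟩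
  set f : SpZ n → {x : Fin n × Fin n // x.1 ≤ x.2} → ℤ := fun g x =>
    ⌊realPart g x.1.1 x.1.2 * (dyadic m x.1.1 * dyadic m x.1.2)⌋ with hf
  have h1 : u.card ≤ B.card * (u.image f).card := by
    refine Finset.card_le_mul_card_image u _ fun b _ => ?_
    rcases (u.filter fun g => f g = b).eq_empty_or_nonempty with he | ⟨g', hg'⟩
    · rw [he]; simp
    · refine Finset.card_le_card_of_injOn (fun g => g'⁻¹ * g) (fun g hg => ?_)
        fun x _ y _ h => mul_left_cancel h
      obtain ⟨hgu, hgb⟩ := Finset.mem_filter.1 hg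
      obtain ⟨hgu', hgb'⟩ := Finset.mem_filter.1 hg'
      obtain ⟨r1, r2, r3⟩ := hu g hgu
      obtain ⟨r1', r2', r3'⟩ := hu g' hgu'
      simp only [hB, Set.Finite.coe_toFinset]
      refine trace_inv_mul_le hc r1 r1' (dyadic_pos m) (fun a => r3 ▸ logDiag_bounds g a)
        (fun a => r3' ▸ logDiag_bounds g' a) fun a b hab => ?_
      have e : f g ⟨(a, b), hab⟩ = f g' ⟨(a, b), hab⟩ := by rw [hgb, hgb']
      have := (Int.abs_sub_lt_one_of_floor_eq_floor e).le
      rwa [← sub_mul, abs_mul, abs_of_pos (mul_pos (dyadic_pos m a) (dyadic_pos m b))] at this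
  have h2 : u.image f ⊆ Fintype.piFinset fun x : {x : Fin n × Fin n // x.1 ≤ x.2} =>
      Finset.Icc ⌊-(dyadic m x.1.1 * dyadic m x.1.2 / 2)⌋ ⌊dyadic m x.1.1 * dyadic m x.1.2 / 2⌋ := by
    intro b hb
    obtain ⟨g, hg, rfl⟩ := Finset.mem_image.1 hb
    rw [Fintype.mem_piFinset]
    intro x
    have hy := mul_pos (dyadic_pos m x.1.1) (dyadic_pos m x.1.2)
    have := abs_le.1 ((hu g hg).2.1 x.1.1 x.1.2)
    rw [Finset.mem_Icc]
    constructor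
    · exact Int.floor_le_floor (by nlinarith)
    · exact Int.floor_le_floor (by nlinarith)
  have h3 : ((u.image f).card : ℝ) ≤ 3 ^ Fintype.card {x : Fin n × Fin n // x.1 ≤ x.2} *
      ∏ a, dyadic m a ^ (n + 1) := by
    have h4 := Finset.card_le_card h2
    rw [Fintype.card_piFinset] at h4
    calc ((u.image f).card : ℝ) ≤ ∏ x : {x : Fin n × Fin n // x.1 ≤ x.2},
          ((Finset.Icc ⌊-(dyadic m x.1.1 * dyadic m x.1.2 / 2)⌋
            ⌊dyadic m x.1.1 * dyadic m x.1.2 / 2⌋).card : ℝ) := by exact_mod_cast h4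
      _ ≤ ∏ x : {x : Fin n × Fin n // x.1 ≤ x.2}, 3 * (dyadic m x.1.1 * dyadic m x.1.2) :=
          Finset.prod_le_prod (fun _ _ => Nat.cast_nonneg _) fun x _ => card_Icc_floor_le
            (one_le_mul_of_one_le_of_one_le (one_le_dyadic m _) (one_le_dyadic m _))
      _ = _ := by
          rw [Finset.prod_mul_distrib, Finset.prod_const, Finset.card_univ, prod_pairs]
  calc (u.card : ℝ) ≤ B.card * (u.image f).card := by exact_mod_cast h1
    _ ≤ B.card * (3 ^ Fintype.card {x : Fin n × Fin n // x.1 ≤ x.2} *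
      ∏ a, dyadic m a ^ (n + 1)) := mul_le_mul_of_nonneg_left h3 (Nat.cast_nonneg _)
    _ = _ := by ring

theorem gramD_parabolic_mul {η : SpZ n} (hη : η ∈ parabolic n) (g : SpZ n) :
    (gramD (η * g)).det = (gramD g).det := by
  have h : gramD (η * g) = bD ℝ η * gramD g * (bD ℝ η)ᵀ := by
    rw [gramD, bC_mul, bD_mul, bC_of_parabolic ℝ hη, gramD]
    simp only [Matrix.zero_mul, zero_add, transpose_mul, Matrix.mul_add, Matrix.add_mul,
      Matrix.mul_assoc]
  rw [h, det_mul, det_mul, det_transpose, det_map_bD]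
  rcases det_bD_of_parabolic hη with h | h <;> simp [h]

/-- The reduced representatives with diagonal exponents m number O(∏ 2^{m_a(n+1)/2}), and each has
determinant at least c ∏ 2^{m_a}. The resulting geometric series have ratio 2^{(n+1)/2 - σ}; this is
the origin of the bound 2σ > n + 1. -/
theorem summable_det_gramD {σ : ℝ} (hσ : (n : ℝ) + 1 < 2 * σ) :
    Summable fun q : PCoset n => (gramD q.out).det ^ (-σ) := by
  classical
  have hσ0 : 0 < σ := by linarith [(Nat.cast_nonneg n : (0 : ℝ) ≤ n)]
  obtain ⟨c, hc, h⟩ := exists_reduced_rep n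
  choose η hη hr using h
  have hinv : LeftInv fun g : SpZ n => (gramD g).det := fun η hη g => gramD_parabolic_mul hη g
  set ρ : PCoset n → SpZ n := fun q => η q.out * q.out with hρ
  have hρinj : Function.Injective ρ := by
    intro q q' h
    have e : ∀ q, (Quotient.mk _ (ρ q) : PCoset n) = q := fun q => by
      conv_rhs => rw [← Quotient.out_eq q]
      rw [coset_eq_iff, hρ]
      simpa using inv_mem (hη q.out)
    rw [← e q, ← e q', h]
  obtain ⟨K, hK, hcard⟩ := exists_card_bound n hc
  have h2 : (2 : ℝ) ^ (((n : ℝ) + 1) / 2 - σ) < 1 :=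
    Real.rpow_lt_one_of_one_lt_of_neg one_lt_two (by linarith)
  have hmain : Summable fun q : PCoset n => ∏ a, ((2 : ℝ) ^ (-σ)) ^ logDiag (ρ q) a := by
    refine summable_of_fiber_bound (fun q => logDiag (ρ q))
      (F := fun m => ∏ a, ((2 : ℝ) ^ (-σ)) ^ m a) (N := fun m => K * ∏ a, dyadic m a ^ (n + 1))
      (fun m => Finset.prod_nonneg fun a _ => by positivity)
      (fun m => mul_nonneg hK (Finset.prod_nonneg fun a _ => pow_nonneg (dyadic_pos m a).le _))
      (fun m u hu => ?_) ?_
    · have := hcard m (u.image ρ) fun g hg => by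
        obtain ⟨q, hq, rfl⟩ := Finset.mem_image.1 hg
        exact ⟨(hr q.out).1, (hr q.out).2, hu q hq⟩
      rwa [Finset.card_image_of_injective _ hρinj] at this
    · have e : ∀ m : Fin n → ℕ, K * ∏ a, dyadic m a ^ (n + 1) * ((2 : ℝ) ^ (-σ)) ^ m a =
          K * ∏ a, ((2 : ℝ) ^ (((n : ℝ) + 1) / 2 - σ)) ^ m a := by
        intro m
        congr 1
        refine Finset.prod_congr rfl fun a _ => ?_
        rw [dyadic, ← pow_mul, mul_comm (m a), pow_mul, ← mul_pow, sub_eq_add_neg,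
          Real.rpow_add two_pos, Real.sqrt_eq_rpow, ← Real.rpow_natCast _ (n + 1),
          ← Real.rpow_mul zero_le_two]
        congr 3
        push_cast
        ring
      simp only [mul_assoc, ← Finset.prod_mul_distrib, e]
      exact (summable_prod_pow n (by positivity) h2).mul_left K
  refine Summable.of_nonneg_of_le (fun q => Real.rpow_nonneg (gramD_posDef _).det_pos.le _)
    (fun q => ?_) (hmain.mul_left (c ^ (-σ)))
  have e1 : (gramD q.out).det = (gramD (ρ q)).det := (gramD_parabolic_mul (hη _) _).symm
  have e2 : c * ∏ a, (2 : ℝ) ^ logDiag (ρ q) a ≤ (gramD (ρ q)).det := by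
    refine le_trans (mul_le_mul_of_nonneg_left (Finset.prod_le_prod (fun a _ => by positivity)
      fun a _ => ?_) hc.le) (hr q.out).1.2
    rw [← dyadic_sq]
    exact (logDiag_bounds _ a).1
  have hp : 0 < ∏ a, (2 : ℝ) ^ logDiag (ρ q) a := Finset.prod_pos fun a _ => by positivity
  rw [e1]
  refine (Real.rpow_le_rpow_of_nonpos (mul_pos hc hp) e2 (by linarith)).trans (le_of_eq ?_)
  rw [Real.mul_rpow hc.le hp.le, ← Real.finsetProd_rpow _ _ fun a _ => by positivity]
  congr 1
  refine Finset.prod_congr rfl fun a _ => ?_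
  rw [← Real.rpow_natCast, ← Real.rpow_natCast, ← Real.rpow_mul zero_le_two,
    ← Real.rpow_mul zero_le_two, mul_comm]

end Summability

/-! ### Comparison of automorphy factors at different points, uniformly in g. -/

section Comparison

variable {n : ℕ}

/-- A lower bound of the imaginary part of a point of the upper half space. -/
def ImLower (ε : ℝ) (Z : HalfSpace n) : Prop :=
  ∀ v : Fin n → ℂ, ε * ∑ a, ‖v a‖ ^ 2 ≤ ‖star v ⬝ᵥ (Z.imag.map Complex.ofReal *ᵥ v)‖

theorem exists_imLower (Z : HalfSpace n) : ∃ ε : ℝ, 0 < ε ∧ ImLower ε Z := by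
  set f : (Fin n → ℂ) → ℝ := fun v => ‖star v ⬝ᵥ (Z.imag.map Complex.ofReal *ᵥ v)‖ with hf
  have hcont : Continuous f := by
    simp only [hf, dotProduct, mulVec]
    fun_prop
  rcases (Metric.sphere (0 : Fin n → ℂ) 1).eq_empty_or_nonempty with he | hne
  -- An empty unit sphere means n = 0.
  · refine ⟨1, one_pos, fun v => ?_⟩
    have hv : v = 0 := by
      by_contra h
      have : (‖v‖⁻¹ : ℂ) • v ∈ Metric.sphere (0 : Fin n → ℂ) 1 := by
        rw [mem_sphere_zero_iff_norm]
        exact_mod_cast norm_smul_inv_norm (𝕜 := ℂ) h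
      rw [he] at this
      exact this
    simp [hv]
  · obtain ⟨v₀, hv₀, hmin⟩ := (isCompact_sphere (0 : Fin n → ℂ) 1).exists_isMinOn hne
      hcont.continuousOn
    have hv₀0 : v₀ ≠ 0 := by
      rintro rfl
      simp at hv₀
    obtain ⟨t, ht, hteq⟩ := posDef_complex Z.2.2 hv₀0
    have hft : f v₀ = t := by
      simp only [hf]
      change ‖star v₀ ⬝ᵥ ((Z.1.map Complex.im).map Complex.ofReal *ᵥ v₀)‖ = t
      rw [hteq, Complex.norm_real, Real.norm_of_nonneg ht.le]
    -- The norm on `Fin n → ℂ` is the sup norm, hence the loss of a factor n; n + 1 keeps the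
    -- denominator visibly positive.
    refine ⟨t / (n + 1), by positivity, fun v => ?_⟩
    have h1 : ∑ a, ‖v a‖ ^ 2 ≤ n * ‖v‖ ^ 2 := by
      have : ∀ a ∈ Finset.univ, ‖v a‖ ^ 2 ≤ ‖v‖ ^ 2 := fun a _ =>
        pow_le_pow_left₀ (norm_nonneg _) (norm_le_pi_norm v a) 2
      refine (Finset.sum_le_sum this).trans (le_of_eq ?_)
      simp
    have h2 : t * ‖v‖ ^ 2 ≤ f v := by
      rcases eq_or_ne v 0 with rfl | hv
      · simp [hf]
      · have hv' : ‖v‖ ≠ 0 := norm_ne_zero_iff.2 hv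
        have hmem : (‖v‖⁻¹ : ℂ) • v ∈ Metric.sphere (0 : Fin n → ℂ) 1 := by
          rw [mem_sphere_zero_iff_norm]
          exact_mod_cast norm_smul_inv_norm (𝕜 := ℂ) hv
        have h3 := hmin hmem
        rw [Set.mem_ofPred_eq, hft] at h3
        have h4 : f ((‖v‖⁻¹ : ℂ) • v) = (‖v‖ ^ 2)⁻¹ * f v := by
          simp only [hf, mulVec_smul, dotProduct_smul, star_smul, smul_dotProduct, norm_smul]
          simp
          ring
        rw [h4, le_inv_mul_iff₀ (by positivity)] at h3
        linarith
    calc t / (n + 1) * ∑ a, ‖v a‖ ^ 2 ≤ t / (n + 1) * (n * ‖v‖ ^ 2) :=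
          mul_le_mul_of_nonneg_left h1 (by positivity)
      _ ≤ t / (n + 1) * ((n + 1) * ‖v‖ ^ 2) := by gcongr; linarith
      _ = t * ‖v‖ ^ 2 := by field_simp
      _ ≤ _ := h2

/-- The matrix `(CZ + D)⁻¹ C`. -/
def denInvC (g : SpZ n) (Z : HalfSpace n) : Matrix (Fin n) (Fin n) ℂ :=
  (bC ℂ g * Z.1 + bD ℂ g)⁻¹ * bC ℂ g

theorem isUnit_det_den (g : SpZ n) (Z : HalfSpace n) : IsUnit (bC ℂ g * Z.1 + bD ℂ g).det := by
  rw [← autFactor_toGSp]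
  exact (autFactor_ne_zero _ _).isUnit

theorem bC_conjTranspose (g : SpZ n) : (bC ℂ g)ᴴ = (bC ℂ g)ᵀ ∧ (bD ℂ g)ᴴ = (bD ℂ g)ᵀ := by
  constructor <;>
  · ext a b
    simp [bC, bD]

/-- Multiplication by N = CZ + D on the left and by N* on the right turns both sides into -2i C Y
Cᵀ, since C Dᵀ is symmetric. -/
theorem denInvC_sub_conjTranspose (g : SpZ n) (Z : HalfSpace n) :
    denInvC g Z - (denInvC g Z)ᴴ =
      -(2 * Complex.I) • (denInvC g Z * Z.imag.map Complex.ofReal * (denInvC g Z)ᴴ) := by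
  have hu := isUnit_det_den g Z
  obtain ⟨hC, hD⟩ := bC_conjTranspose g
  have hZ : Z.1ᴴ = Z.1 - (2 * Complex.I) • Z.imag.map Complex.ofReal := by
    rw [← Z.sub_conj, sub_sub_cancel]; rfl
  set N := bC ℂ g * Z.1 + bD ℂ g with hN
  have hNM : N * denInvC g Z = bC ℂ g := by
    rw [denInvC, ← Matrix.mul_assoc, mul_nonsing_inv _ hu, Matrix.one_mul]
  have hMN : (denInvC g Z)ᴴ * Nᴴ = (bC ℂ g)ᵀ := by rw [← conjTranspose_mul, hNM, hC]
  have hNh : Nᴴ = Z.1ᴴ * (bC ℂ g)ᵀ + (bD ℂ g)ᵀ := by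
    rw [hN, conjTranspose_add, conjTranspose_mul, hC, hD]
  have e : N * (denInvC g Z - (denInvC g Z)ᴴ) * Nᴴ = N * (-(2 * Complex.I) •
      (denInvC g Z * Z.imag.map Complex.ofReal * (denInvC g Z)ᴴ)) * Nᴴ := by
    calc _ = N * denInvC g Z * Nᴴ - N * ((denInvC g Z)ᴴ * Nᴴ) := by noncomm_ring
      _ = -(2 * Complex.I) • (N * denInvC g Z * Z.imag.map Complex.ofReal *
          ((denInvC g Z)ᴴ * Nᴴ)) := by
        rw [hNM, hMN, hNh, hZ, hN, Matrix.mul_add, (row_rel ℂ g).2.1, Matrix.sub_mul, Matrix.mul_sub,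
          Matrix.add_mul, Matrix.smul_mul, Matrix.mul_smul, neg_smul]
        simp only [Matrix.mul_assoc]
        abel
      _ = _ := by simp only [Matrix.mul_smul, Matrix.smul_mul, Matrix.mul_assoc]
  have huh : IsUnit Nᴴ.det := by rw [det_conjTranspose]; exact hu.star
  have h2 := congrArg (fun X => N⁻¹ * X * Nᴴ⁻¹) e
  simp only [Matrix.mul_assoc, mul_nonsing_inv _ huh, Matrix.mul_one] at h2
  simp only [← Matrix.mul_assoc, nonsing_inv_mul _ hu, Matrix.one_mul] at h2
  exact h2

/-- The diagonal entries of the preceding identity give ε Σ_b |M_ab|² ≤ |M_aa|. This bounds M_aa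
first, and then its whole row. The bound does not involve g. -/
theorem norm_denInvC_le {ε : ℝ} (hε : 0 < ε) {Z : HalfSpace n} (hZ : ImLower ε Z) (g : SpZ n)
    (a b : Fin n) : ‖denInvC g Z a b‖ ≤ ε⁻¹ := by
  set M := denInvC g Z with hM
  have h1 : ε * ∑ b, ‖M a b‖ ^ 2 ≤ ‖M a a‖ := by
    have h := hZ fun b => conj (M a b)
    simp only [RCLike.norm_conj] at h
    refine h.trans ?_
    have e1 : star (fun b => conj (M a b)) ⬝ᵥ (Z.imag.map Complex.ofReal *ᵥ fun b => conj (M a b)) =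
        (M * Z.imag.map Complex.ofReal * Mᴴ) a a := by
      rw [Matrix.mul_assoc, Matrix.mul_apply]
      simp [dotProduct, mulVec, Matrix.mul_apply, Finset.mul_sum]
    have e2 := congrFun (congrFun (denInvC_sub_conjTranspose g Z) a) a
    rw [← hM, Matrix.smul_apply, ← e1, Matrix.sub_apply, conjTranspose_apply] at e2
    have e3 := congrArg norm e2
    rw [smul_eq_mul, norm_mul] at e3
    have e4 : ‖-(2 * Complex.I)‖ = 2 := by simp
    rw [e4] at e3
    have e5 : ‖M a a - star (M a a)‖ ≤ ‖M a a‖ + ‖M a a‖ := by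
      refine (norm_sub_le _ _).trans ?_
      rw [norm_star]
    linarith
  have h2 : ∀ b, ε * ‖M a b‖ ^ 2 ≤ ‖M a a‖ := fun b => by
    refine le_trans (mul_le_mul_of_nonneg_left ?_ hε.le) h1
    exact Finset.single_le_sum (f := fun b => ‖M a b‖ ^ 2) (fun _ _ => sq_nonneg _)
      (Finset.mem_univ b)
  have h3 : ε * ‖M a a‖ ≤ 1 := by
    rcases (norm_nonneg (M a a)).eq_or_lt with h0 | h0
    · rw [← h0, mul_zero]; exact zero_le_one
    · refine le_of_mul_le_mul_right ?_ h0
      have := h2 a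
      nlinarith
  have h4 : (ε * ‖M a b‖) ^ 2 ≤ 1 := by
    have := h2 b
    nlinarith
  have h5 := (sq_le_one_iff₀ (by positivity)).1 h4
  rwa [← one_div, le_div_iff₀ hε, mul_comm]

theorem autFactor_ratio (g : SpZ n) (Z : HalfSpace n) (W : Matrix (Fin n) (Fin n) ℂ) :
    (bC ℂ g * W + bD ℂ g).det =
      autFactor g.toGSp Z * (1 + denInvC g Z * (W - Z.1)).det := by
  have hu := isUnit_det_den g Z
  rw [autFactor_toGSp, ← det_mul, denInvC, Matrix.mul_add, Matrix.mul_one, ← Matrix.mul_assoc,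
    ← Matrix.mul_assoc, mul_nonsing_inv _ hu, Matrix.one_mul]
  congr 1
  noncomm_ring

/-- The quotient of the two factors is det(1 + M(W - Z)) with M = (CZ + D)⁻¹C, whose entries are
bounded independently of g; the determinant is estimated by its n! terms. -/
theorem norm_autFactor_le {ε : ℝ} (hε : 0 < ε) {Z : HalfSpace n} (hZ : ImLower ε Z)
    (W : HalfSpace n) {B : ℝ} (hB : ∀ a b, ‖(W.1 - Z.1) a b‖ ≤ B) (g : SpZ n) :
    ‖autFactor g.toGSp W‖ ≤ n.factorial * (1 + n * (ε⁻¹ * B)) ^ n * ‖autFactor g.toGSp Z‖ := by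
  rw [autFactor_toGSp g W, autFactor_ratio g Z, norm_mul, mul_comm]
  refine mul_le_mul_of_nonneg_right ?_ (norm_nonneg _)
  have key : ∀ a b, ‖(1 + denInvC g Z * (W.1 - Z.1)) a b‖ ≤ 1 + n * (ε⁻¹ * B) := by
    intro a b
    rw [Matrix.add_apply]
    refine (norm_add_le _ _).trans (add_le_add ?_ ?_)
    · rw [Matrix.one_apply]; split_ifs <;> simp
    · rw [Matrix.mul_apply]
      refine (norm_sum_le _ _).trans ?_
      have : ∀ c ∈ Finset.univ, ‖denInvC g Z a c * (W.1 - Z.1) c b‖ ≤ ε⁻¹ * B := fun c _ => by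
        rw [norm_mul]
        exact mul_le_mul (norm_denInvC_le hε hZ g a c) (hB c b) (norm_nonneg _) (by positivity)
      refine (Finset.sum_le_sum this).trans (le_of_eq ?_)
      simp
  have := Matrix.det_le (abv := NormedField.toAbsoluteValue ℂ) (A := 1 + denInvC g Z * (W.1 - Z.1))
    (x := 1 + n * (ε⁻¹ * B)) key
  rw [Fintype.card_fin, nsmul_eq_mul] at this
  exact this

/-- The point `i y`. -/
def imPoint (n : ℕ) (y : ℝ) (hy : 0 < y) : HalfSpace n :=
  ⟨(y * Complex.I) • 1, by simp, by
    have : ((y * Complex.I) • (1 : Matrix (Fin n) (Fin n) ℂ)).map Complex.im = diagonal fun _ => y := by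
      ext a b
      by_cases h : a = b <;> simp [h]
    rw [this, posDef_diagonal_iff]
    exact fun _ => hy⟩

theorem imPoint_imag (y : ℝ) (hy : 0 < y) : (imPoint n y hy).imag = diagonal fun _ => y := by
  ext a b
  by_cases h : a = b <;> simp [h, HalfSpace.imag, imPoint]

theorem imLower_imPoint (y : ℝ) (hy : 0 < y) : ImLower y (imPoint n y hy) := by
  intro v
  have : star v ⬝ᵥ ((imPoint n y hy).imag.map Complex.ofReal *ᵥ v) =
      ((y * ∑ a, ‖v a‖ ^ 2 : ℝ) : ℂ) := by
    rw [imPoint_imag, diagonal_map (by simp), dotProduct]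
    simp only [mulVec_diagonal]
    push_cast
    rw [Finset.mul_sum]
    refine Finset.sum_congr rfl fun a _ => ?_
    rw [← Complex.conj_mul', Pi.star_apply, RCLike.star_def]
    ring
  rw [this, Complex.norm_real]
  exact le_abs_self _

/-- The symmetry of C Dᵀ cancels the mixed terms of (Ci + D)(Ci + D)*, leaving C Cᵀ + D Dᵀ. -/
theorem norm_autFactor_imPoint_one (g : SpZ n) :
    ‖autFactor g.toGSp (imPoint n 1 one_pos)‖ ^ 2 = (gramD g).det := by
  obtain ⟨hC, hD⟩ := bC_conjTranspose g
  have e : (bC ℂ g * (imPoint n 1 one_pos).1 + bD ℂ g) *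
      (bC ℂ g * (imPoint n 1 one_pos).1 + bD ℂ g)ᴴ = (gramD g).map Complex.ofRealHom := by
    have h1 : (gramD g).map Complex.ofRealHom = bC ℂ g * (bC ℂ g)ᵀ + bD ℂ g * (bD ℂ g)ᵀ := by
      rw [gramD]
      ext a b
      simp [Matrix.mul_apply, bC, bD]
    have h2 := (row_rel ℂ g).2.1
    rw [h1]
    simp only [imPoint, Complex.ofReal_one, one_mul, Matrix.mul_smul, Matrix.mul_one,
      conjTranspose_add, conjTranspose_smul, hC, hD, RCLike.star_def, Complex.conj_I,
      Matrix.add_mul, Matrix.mul_add, Matrix.smul_mul, h2]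
    have h3 : ∀ X : Matrix (Fin n) (Fin n) ℂ, -Complex.I • Complex.I • X = X := fun X => by
      rw [smul_smul]; simp
    rw [smul_add, h3, neg_smul]
    abel
  have h3 := congrArg det e
  rw [det_mul, det_conjTranspose, ← RingHom.mapMatrix_apply, ← RingHom.map_det, ← autFactor_toGSp,
    RCLike.star_def, Complex.mul_conj'] at h3
  rw [Complex.ofRealHom_eq_coe] at h3
  exact_mod_cast h3

/-- Absolute convergence of the Siegel Eisenstein series. -/
theorem summable_norm_autFactor {σ : ℝ} (hσ : (n : ℝ) + 1 < 2 * σ) (Z : HalfSpace n) :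
    Summable fun q : PCoset n => ‖autFactor q.out.toGSp Z‖ ^ (-2 * σ) := by
  have hσ0 : 0 < σ := by linarith [(Nat.cast_nonneg n : (0 : ℝ) ≤ n)]
  obtain ⟨ε, hε, hZ⟩ := exists_imLower Z
  have hB : ∃ B : ℝ, 0 ≤ B ∧ ∀ a b, ‖((imPoint n 1 one_pos).1 - Z.1) a b‖ ≤ B := by
    refine ⟨∑ a, ∑ b, ‖((imPoint n 1 one_pos).1 - Z.1) a b‖, Finset.sum_nonneg fun _ _ =>
      Finset.sum_nonneg fun _ _ => norm_nonneg _, fun a b => ?_⟩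
    refine le_trans (Finset.single_le_sum
      (f := fun b => ‖((imPoint n 1 one_pos).1 - Z.1) a b‖) (fun _ _ => norm_nonneg _)
      (Finset.mem_univ b)) ?_
    exact Finset.single_le_sum
      (f := fun a => ∑ b, ‖((imPoint n 1 one_pos).1 - Z.1) a b‖)
      (fun _ _ => Finset.sum_nonneg fun _ _ => norm_nonneg _) (Finset.mem_univ a)
  obtain ⟨B, hB0, hB⟩ := hB
  set K : ℝ := n.factorial * (1 + n * (ε⁻¹ * B)) ^ n with hK
  have hK0 : 0 < K := by positivity
  refine Summable.of_nonneg_of_le (fun q => Real.rpow_nonneg (norm_nonneg _) _) (fun q => ?_)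
    ((summable_det_gramD hσ).mul_left (K ^ (2 * σ)))
  have h1 := norm_autFactor_le hε hZ _ hB q.out
  rw [← hK] at h1
  have h0 : 0 < ‖autFactor q.out.toGSp (imPoint n 1 one_pos)‖ :=
    norm_pos_iff.2 (autFactor_ne_zero _ _)
  have h2 : ‖autFactor q.out.toGSp (imPoint n 1 one_pos)‖ / K ≤ ‖autFactor q.out.toGSp Z‖ := by
    rw [div_le_iff₀ hK0, mul_comm]; exact h1
  refine (Real.rpow_le_rpow_of_nonpos (by positivity) h2 (by linarith)).trans (le_of_eq ?_)
  rw [Real.div_rpow h0.le hK0.le, ← norm_autFactor_imPoint_one, ← Real.rpow_natCast,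
    ← Real.rpow_mul h0.le, div_eq_mul_inv, ← Real.rpow_neg hK0.le, mul_comm]
  congr 2
  · ring
  · push_cast; ring

end Comparison

/-! ### The Eisenstein series as sums over P \ Sp(n, ℤ), and their automorphy. -/

section Automorphy

variable {n p : ℕ} [Fact p.Prime] {ψ : DirichletCharacter ℂ p}

variable (p ψ) in
/-- The function `ψ*` on `Sp(n, ℤ)`, in terms of the reduction modulo `p`. -/
def chi (r : ℕ) (g : SpZ n) : ℂ := pairChar ψ r (bC (ZMod p) g) (bD (ZMod p) g)

theorem chi_parabolic_mul (hψ : ψ ^ 2 = 1) {η : SpZ n} (hη : η ∈ parabolic n) (r : ℕ) (g : SpZ n) :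
    chi p ψ r (η * g) = ψ ((bD ℤ η).det : ZMod p) * chi p ψ r g := by
  have hu : IsUnit (bD (ZMod p) η).det := by
    rw [det_map_bD]
    rcases det_bD_of_parabolic hη with h | h <;> simp [h]
  rw [chi, bC_mul, bD_mul, bC_of_parabolic (ZMod p) hη, Matrix.zero_mul, Matrix.zero_mul, zero_add,
    zero_add, pairChar_mul_left hψ hu, det_map_bD]
  rfl

theorem gamma0_rel {κ : SpZ n} (hκ : κ ∈ Gamma0 n p) :
    (bA (ZMod p) κ)ᵀ * bD (ZMod p) κ = 1 ∧
      ((bD (ZMod p) κ)ᵀ * bB (ZMod p) κ)ᵀ = (bD (ZMod p) κ)ᵀ * bB (ZMod p) κ ∧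
      bA (ZMod p) κ * ((bD (ZMod p) κ)ᵀ * bB (ZMod p) κ) = bB (ZMod p) κ := by
  have h0 := (mem_Gamma0_iff κ).1 hκ
  obtain ⟨-, h2, h3⟩ := col_rel (ZMod p) κ
  obtain ⟨-, -, h5⟩ := row_rel (ZMod p) κ
  simp only [h0, transpose_zero, Matrix.zero_mul, Matrix.mul_zero, sub_zero] at h3 h5
  refine ⟨h3, ?_, ?_⟩
  · rw [transpose_mul, transpose_transpose, h2]
  · rw [← Matrix.mul_assoc, h5, Matrix.one_mul]

theorem chi_mul_gamma0 (hψ : ψ ^ 2 = 1) {κ : SpZ n} (hκ : κ ∈ Gamma0 n p) (r : ℕ) (g : SpZ n) :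
    chi p ψ r (g * κ) = charD ψ κ * chi p ψ r g := by
  obtain ⟨h1, h2, h3⟩ := gamma0_rel hκ
  have h := pairChar_mul_right (C := bC (ZMod p) g) (D := bD (ZMod p) g) hψ h1 h2 r
  rw [Matrix.mul_assoc, h3] at h
  rw [chi, bC_mul, bD_mul, (mem_Gamma0_iff κ).1 hκ, Matrix.mul_zero, add_zero, h, charD_eq]
  rfl

theorem charD_sq (hψ : ψ ^ 2 = 1) {κ : SpZ n} (hκ : κ ∈ Gamma0 n p) :
    charD ψ κ * charD ψ κ = 1 := by
  rw [charD_eq]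
  refine MulChar.apply_sq hψ fun h => ?_
  have := congrArg det (gamma0_rel hκ).1
  rw [det_mul, h, mul_zero, det_one] at this
  exact zero_ne_one this

theorem norm_chi_le (hψ : ψ ^ 2 = 1) (r : ℕ) (g : SpZ n) : ‖chi p ψ r g‖ ≤ 1 := by
  by_cases h : ∃ I U W V T, I.card = r ∧ NF (bC (ZMod p) g) (bD (ZMod p) g) I U W V T
  · obtain ⟨I, U, W, V, T, hr, h⟩ := h
    rw [chi, pairChar_eq hψ h hr, norm_mul]
    exact mul_le_one₀ (DirichletCharacter.norm_le_one ψ _) (norm_nonneg _)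
      (DirichletCharacter.norm_le_one ψ _)
  · rw [chi, pairChar_eq_zero h, norm_zero]
    exact zero_le_one

variable (p ψ) in
/-- The summand of the Eisenstein series as a function on `Sp(n, ℤ)`. -/
def eisFun (k : ℤ) (r : ℕ) (Z : HalfSpace n) (s : ℂ) (g : SpZ n) : ℂ :=
  chi p ψ r g * wt k s (autFactor g.toGSp Z)

/-- The parity condition ψ(-1) = (-1)^k makes the summand invariant under P: for det D = -1 the sign
of ψ* cancels that of the weight. -/
theorem char_mul_wt (hψ : ψ ^ 2 = 1) {k : ℤ} (hk : ψ (-1) = (-1) ^ k) (s : ℂ) {d : ℤ}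
    (hd : d = 1 ∨ d = -1) : ψ ((d : ℤ) : ZMod p) * wt k s ((d : ℤ) : ℂ) = 1 := by
  rcases hd with rfl | rfl
  · simp [wt_one]
  · have h1 : ψ (-1) * ψ (-1) = 1 := MulChar.apply_sq hψ (neg_ne_zero.2 one_ne_zero)
    push_cast
    rw [wt_neg_one, ← hk, h1]

theorem eisFun_leftInv (hψ : ψ ^ 2 = 1) {k : ℤ} (hk : ψ (-1) = (-1) ^ k) (r : ℕ) (Z : HalfSpace n)
    (s : ℂ) : LeftInv (eisFun p ψ k r Z s) := by
  intro η hη g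
  rw [eisFun, chi_parabolic_mul hψ hη, autFactor_parabolic_mul hη, wt_mul, eisFun]
  linear_combination chi p ψ r g * wt k s (autFactor g.toGSp Z) *
    char_mul_wt hψ hk s (det_bD_of_parabolic hη)

theorem norm_eisFun_le (hψ : ψ ^ 2 = 1) (k : ℤ) (r : ℕ) (Z : HalfSpace n) (s : ℂ) (g : SpZ n) :
    ‖eisFun p ψ k r Z s g‖ ≤ ‖autFactor g.toGSp Z‖ ^ (-2 * s.re) := by
  rw [eisFun, norm_mul, norm_wt _ _ (autFactor_ne_zero _ _)]
  exact mul_le_of_le_one_left (Real.rpow_nonneg (norm_nonneg _) _) (norm_chi_le hψ r g)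

theorem summable_eisFun (hψ : ψ ^ 2 = 1) (k : ℤ) (r : ℕ) (Z : HalfSpace n) {s : ℂ}
    (hs : (n : ℝ) + 1 < 2 * s.re) : Summable fun q : PCoset n => eisFun p ψ k r Z s q.out :=
  Summable.of_norm_bounded (summable_norm_autFactor hs Z) fun _ => norm_eisFun_le hψ k r Z s _

theorem eisTerm_eq (hψ : ψ ^ 2 = 1) (k : ℤ) {r : ℕ} (hr : r ≤ n) (Z : HalfSpace n) (s : ℂ)
    (g : SpZ n) : eisTerm n p ψ k r Z s g = eisFun p ψ k r Z s g := by
  rw [eisTerm, psiStar_eq hψ hr, eisFun, chi, wt, mul_assoc]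

theorem summable_eisTerm (hψ : ψ ^ 2 = 1) (k : ℤ) {r : ℕ} (hr : r ≤ n) (Z : HalfSpace n) {s : ℂ}
    (hs : (n : ℝ) + 1 < 2 * s.re) :
    Summable fun q : cellCosets n p r => eisTerm n p ψ k r Z s q.1.out := by
  simp only [eisTerm_eq hψ k hr]
  exact (summable_eisFun hψ k r Z hs).subtype _

theorem mem_cellCosets_of_chi_ne_zero {r : ℕ} (hr : r ≤ n) {q : PCoset n}
    (h : chi p ψ r q.out ≠ 0) : q ∈ cellCosets n p r := by
  obtain ⟨I, U, W, V, T, hI, h⟩ := pairChar_ne_zero h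
  obtain ⟨η, hη, κ, hκ, e⟩ := exists_decomp hr h hI
  refine ⟨q.out, ?_, Quotient.out_eq q⟩
  rw [cell, DoubleCoset.mem_doubleCoset]
  exact ⟨η, hη, κ, hκ, e⟩

/-- ψ* vanishes off the cell, so the sum may be extended to all cosets. All cusps then share one
index set on which Sp(n, ℤ) acts. -/
theorem eisSeries_eq (hψ : ψ ^ 2 = 1) (k : ℤ) {r : ℕ} (hr : r ≤ n) (Z : HalfSpace n) (s : ℂ) :
    eisSeries n p ψ k r Z s = ((Z.imag.det : ℝ) : ℂ) ^ (s - k / 2) *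
      ∑' q : PCoset n, eisFun p ψ k r Z s q.out := by
  rw [eisSeries]
  simp only [eisTerm_eq hψ k hr]
  rw [tsum_subtype_eq_of_support_subset (f := fun q : PCoset n => eisFun p ψ k r Z s q.out)]
  intro q hq
  exact mem_cellCosets_of_chi_ne_zero hr (left_ne_zero_of_mul hq)

/-- As det Im g⟨Z⟩ = |j|⁻² det Y, the exponent s - k/2 supplies exactly the factor |j|^{-2s+k}
missing from the weight. -/
theorem autFactor_mul_det_cpow (g : GSpPos n) (Z : HalfSpace n) (k : ℤ) (s : ℂ) :
    autFactor g Z ^ (-k) * (((act g Z).imag.det : ℝ) : ℂ) ^ (s - k / 2) =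
      wt k s (autFactor g Z) * ((Z.imag.det : ℝ) : ℂ) ^ (s - k / 2) := by
  have h0 : 0 < ‖autFactor g Z‖ := norm_pos_iff.2 (autFactor_ne_zero g Z)
  have h1 : ((‖autFactor g Z‖ : ℝ) : ℂ) ≠ 0 := by exact_mod_cast h0.ne'
  rw [← det_imag_act g Z, wt, Complex.ofReal_mul,
    Complex.mul_cpow_ofReal_nonneg (by positivity) (act g Z).det_imag_pos.le, Complex.ofReal_pow,
    ← Complex.cpow_nat_mul' (x := ((‖autFactor g Z‖ : ℝ) : ℂ)) (n := 2)]
  · have e : ((‖autFactor g Z‖ : ℝ) : ℂ) ^ (-2 * s + k) *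
        ((‖autFactor g Z‖ : ℝ) : ℂ) ^ (((2 : ℕ) : ℂ) * (s - k / 2)) = 1 := by
      rw [← Complex.cpow_add _ _ h1]
      convert Complex.cpow_zero _ using 2
      push_cast
      ring
    linear_combination (-(autFactor g Z ^ (-k) * (((act g Z).imag.det : ℝ) : ℂ) ^ (s - k / 2))) * e
  · rw [Complex.arg_ofReal_of_nonneg h0.le]; simp [Real.pi_pos]
  · rw [Complex.arg_ofReal_of_nonneg h0.le]; simp [Real.pi_pos.le]

theorem eisFun_mul (k : ℤ) (r : ℕ) (Z : HalfSpace n) (s : ℂ) (g h : SpZ n) :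
    eisFun p ψ k r Z s (g * h) =
      chi p ψ r (g * h) * (wt k s (autFactor g.toGSp (act h.toGSp Z)) * wt k s (autFactor h.toGSp Z)) := by
  rw [eisFun, autFactor_toGSp_mul, wt_mul]

theorem slash_eisSeries (hψ : ψ ^ 2 = 1) {k : ℤ} (hk : ψ (-1) = (-1) ^ k) {r : ℕ} (hr : r ≤ n)
    (s : ℂ) {κ : SpZ n} (hκ : κ ∈ Gamma0 n p) (Z : HalfSpace n) :
    slash k (fun W => eisSeries n p ψ k r W s) κ.toGSp Z =
      charD ψ κ * eisSeries n p ψ k r Z s := by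
  have h1 : ∑' q : PCoset n, eisFun p ψ k r Z s q.out =
      charD ψ κ * wt k s (autFactor κ.toGSp Z) *
        ∑' q : PCoset n, eisFun p ψ k r (act κ.toGSp Z) s q.out := by
    rw [← tsum_mul_right_coset (eisFun_leftInv hψ hk r Z s) κ, ← tsum_mul_left]
    refine tsum_congr fun q => ?_
    rw [eisFun_mul, chi_mul_gamma0 hψ hκ, eisFun]
    ring
  rw [slash, eisSeries_eq hψ k hr, eisSeries_eq hψ k hr, h1, ← mul_assoc, autFactor_mul_det_cpow]
  linear_combination (-(wt k s (autFactor κ.toGSp Z) * ((Z.imag.det : ℝ) : ℂ) ^ (s - k / 2) *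
    ∑' q : PCoset n, eisFun p ψ k r (act κ.toGSp Z) s q.out)) * charD_sq hψ hκ

end Automorphy

/-! ### Sign changes in a pair, needed since w_n⁻¹ takes (C, D) to (-D, C). -/

section NegPairs

variable {ι : Type*} [Fintype ι] [DecidableEq ι] {F : Type*} [Field F] {ψ : MulChar F ℂ}
  {C D : Matrix ι ι F}

theorem NF.neg_right {I : Finset ι} {U W V T : Matrix ι ι F} (h : NF C D I U W V T) :
    NF C (-D) I (U * (idem F I - idem F Iᶜ)) W V (-T) := by
  have e1 : (idem F I - idem F Iᶜ) * idem F I = idem F I := by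
    rw [Matrix.sub_mul, idem_mul_self, idem_compl_mul, sub_zero]
  have e2 : (idem F I - idem F Iᶜ) * idem F Iᶜ = -idem F Iᶜ := by
    rw [Matrix.sub_mul, idem_mul_self, idem_mul_compl, zero_sub]
  have e3 : (idem F I - idem F Iᶜ) * (idem F I - idem F Iᶜ) = 1 := by
    rw [Matrix.mul_sub, e1, e2, sub_neg_eq_add, idem_add_compl]
  refine ⟨?_, ?_, ?_, h.hWV, by rw [transpose_neg, h.hT]⟩
  · rw [Matrix.mul_assoc U, e1, h.hC]
  · have e : U * (idem F I - idem F Iᶜ) * (idem F I * W * -T + idem F Iᶜ * V) =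
        U * (((idem F I - idem F Iᶜ) * idem F I) * W * -T +
          ((idem F I - idem F Iᶜ) * idem F Iᶜ) * V) := by
      simp only [Matrix.mul_assoc, Matrix.mul_add]
    rw [e, e1, e2, h.hD, ← Matrix.mul_neg]
    congr 1
    simp only [Matrix.mul_neg, Matrix.neg_mul, neg_add_rev]
    abel
  · rw [det_mul]
    refine h.hU.mul (IsUnit.of_mul_eq_one (idem F I - idem F Iᶜ).det ?_)
    rw [← det_mul, e3, det_one]

theorem det_idem_sub (I : Finset ι) :
    (idem F I - idem F Iᶜ).det = (-1) ^ (Fintype.card ι - I.card) := by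
  have : idem F I - idem F Iᶜ = diagonal fun a => if a ∈ I then (1 : F) else -1 := by
    rw [idem, idem, diagonal_sub]
    congr 1
    ext a
    by_cases h : a ∈ I <;> simp [h]
  rw [this, det_diagonal, Finset.prod_ite]
  simp only [Finset.prod_const_one, one_mul, Finset.prod_const]
  rw [← Finset.card_compl]
  congr 2
  ext a
  simp

theorem pairChar_neg_right (hψ : ψ ^ 2 = 1) (r : ℕ) (C D : Matrix ι ι F) :
    pairChar ψ r C (-D) = ψ (-1) ^ (Fintype.card ι - r) * pairChar ψ r C D := by
  by_cases h : ∃ I U W V T, I.card = r ∧ NF C D I U W V T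
  · obtain ⟨I, U, W, V, T, hr, h⟩ := h
    rw [pairChar_eq hψ h.neg_right hr, pairChar_eq hψ h hr, det_mul, map_mul, det_idem_sub, map_pow,
      hr]
    ring
  · rw [pairChar_eq_zero h, mul_zero, pairChar_eq_zero]
    rintro ⟨I, U, W, V, T, hr, h'⟩
    have := h'.neg_right
    rw [neg_neg] at this
    exact h ⟨I, _, W, V, _, hr, this⟩

theorem pairChar_neg_left (hψ : ψ ^ 2 = 1) {r : ℕ} (hr : r ≤ Fintype.card ι) (C D : Matrix ι ι F) :
    pairChar ψ r (-C) D = ψ (-1) ^ r * pairChar ψ r C D := by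
  have h1 : IsUnit (-1 : Matrix ι ι F).det := by simp [det_neg]
  have h2 := pairChar_mul_left (C := C) (D := -D) hψ h1 r
  rw [Matrix.neg_mul, Matrix.one_mul, Matrix.neg_mul, Matrix.one_mul, neg_neg, det_neg, det_one,
    mul_one, map_pow, pairChar_neg_right hψ, ← mul_assoc, ← pow_add] at h2
  rw [h2]
  have hsq : ψ (-1) * ψ (-1) = 1 := MulChar.apply_sq hψ (neg_ne_zero.2 one_ne_zero)
  congr 1
  obtain ⟨m, hm⟩ := Nat.exists_eq_add_of_le hr
  rw [hm, Nat.add_sub_cancel_left, add_assoc, pow_add, ← two_mul, pow_mul, pow_two, hsq, one_pow,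
    mul_one]

end NegPairs

/-! ### Conjugation by diag(1, p) and the correspondence (C, pD) = N (C', D'). -/

section Conjugation

variable {n p : ℕ} [hp : Fact p.Prime]

theorem exists_bC_eq {κ : SpZ n} (hκ : κ ∈ Gamma0 n p) :
    ∃ C₁ : Matrix (Fin n) (Fin n) ℤ, bC ℤ κ = (p : ℤ) • C₁ := by
  choose c hc using hκ
  refine ⟨Matrix.of c, ?_⟩
  ext a b
  simpa [bC] using hc a b

/-- Conjugation of `Γ₀(p)` by `diag(1, p)`. -/
theorem exists_conj_down {κ : SpZ n} (hκ : κ ∈ Gamma0 n p) : ∃ κ' : SpZ n,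
    bA ℤ κ' = bA ℤ κ ∧ bB ℤ κ' = (p : ℤ) • bB ℤ κ ∧ bC ℤ κ = (p : ℤ) • bC ℤ κ' ∧
      bD ℤ κ' = bD ℤ κ := by
  obtain ⟨C₁, hC⟩ := exists_bC_eq hκ
  have hp0 : (p : ℤ) ≠ 0 := by exact_mod_cast hp.out.ne_zero
  obtain ⟨h1, h2, h3⟩ := col_rel ℤ κ
  rw [hC] at h1 h3
  refine ⟨mkSp (bA ℤ κ) ((p : ℤ) • bB ℤ κ) C₁ (bD ℤ κ) ?_ ?_ ?_, map_castRingHom_eq _,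
    map_castRingHom_eq _, ?_, map_castRingHom_eq _⟩
  · rw [Matrix.mul_smul, transpose_smul, Matrix.smul_mul] at h1
    exact smul_right_injective _ hp0 h1
  · rw [transpose_smul, Matrix.smul_mul, Matrix.mul_smul, h2]
  · rw [← h3, transpose_smul, Matrix.smul_mul, Matrix.mul_smul]
  · rw [hC]
    exact congrArg _ (map_castRingHom_eq _).symm

/-- Conjugation by `diag(1, p)` of the elements with upper right block divisible by `p`. -/
theorem exists_conj_up {β : SpZ n} {B₁ : Matrix (Fin n) (Fin n) ℤ} (hB : bB ℤ β = (p : ℤ) • B₁) :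
    ∃ δ ∈ Gamma0 n p, bA ℤ δ = bA ℤ β ∧ bB ℤ β = (p : ℤ) • bB ℤ δ ∧ bC ℤ δ = (p : ℤ) • bC ℤ β ∧
      bD ℤ δ = bD ℤ β := by
  have hp0 : (p : ℤ) ≠ 0 := by exact_mod_cast hp.out.ne_zero
  obtain ⟨h1, h2, h3⟩ := col_rel ℤ β
  rw [hB] at h2 h3
  refine ⟨mkSp (bA ℤ β) B₁ ((p : ℤ) • bC ℤ β) (bD ℤ β) ?_ ?_ ?_, ?_, map_castRingHom_eq _, ?_,
    map_castRingHom_eq _, map_castRingHom_eq _⟩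
  · rw [transpose_smul, Matrix.smul_mul, Matrix.mul_smul, h1]
  · rw [Matrix.mul_smul, transpose_smul, Matrix.smul_mul] at h2
    exact smul_right_injective _ hp0 h2
  · rw [← h3, transpose_smul, Matrix.smul_mul, Matrix.mul_smul]
  · intro a b
    change (p : ℤ) ∣ ((p : ℤ) • bC ℤ β) a b
    rw [Matrix.smul_apply, smul_eq_mul]
    exact dvd_mul_right _ _
  · rw [hB]
    exact congrArg _ (map_castRingHom_eq _).symm

theorem map_bA (R : Type*) [CommRing R] (g : SpZ n) : bA R g = (bA ℤ g).map (Int.castRingHom R) := by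
  ext; simp [bA]

theorem map_bB (R : Type*) [CommRing R] (g : SpZ n) : bB R g = (bB ℤ g).map (Int.castRingHom R) := by
  ext; simp [bB]

theorem map_zsmul_cast (R : Type*) [CommRing R] (m : ℕ) (M : Matrix (Fin n) (Fin n) ℤ) :
    ((m : ℤ) • M).map (Int.castRingHom R) = (m : R) • M.map (Int.castRingHom R) := by
  ext a b
  rw [map_apply, Matrix.smul_apply, Matrix.smul_apply, smul_eq_mul, smul_eq_mul, map_mul, map_apply]
  simp

theorem bottom_w_mul (F : Type*) [Field F] {η : SpZ n} (hη : η ∈ parabolic n) (r : ℕ) (κ : SpZ n) :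
    bC F (η * w n r * κ) =
      bD F η * (idem F (headSet n r) * bA F κ + idem F (headSet n r)ᶜ * bC F κ) ∧
    bD F (η * w n r * κ) =
      bD F η * (idem F (headSet n r) * bB F κ + idem F (headSet n r)ᶜ * bD F κ) := by
  obtain ⟨-, -, w3, w4⟩ := blocks_w F n r
  rw [bC_mul F (η * w n r), bD_mul F (η * w n r), bC_mul F η, bD_mul F η, bC_of_parabolic F hη, w3, w4]
  simp only [Matrix.zero_mul, zero_add, Matrix.mul_add, Matrix.mul_assoc, and_self]

variable {ψ : DirichletCharacter ℂ p}

variable (p ψ) in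
/-- The function `ψ*` of the pair `(D, C)`. -/
def chiOpp (r : ℕ) (g : SpZ n) : ℂ := pairChar ψ r (bD (ZMod p) g) (bC (ZMod p) g)

variable (p ψ) in
/-- The relation `(C, pD) = N (C', D')` between bottom rows, with `det N = p^(n-r)`. -/
def HeckeRel (r : ℕ) (γ γ' : SpZ n) : Prop :=
  (∃ N : Matrix (Fin n) (Fin n) ℂ, N.det = (p : ℂ) ^ (n - r) ∧ bC ℂ γ = N * bC ℂ γ' ∧
    (p : ℂ) • bD ℂ γ = N * bD ℂ γ') ∧ chi p ψ r γ = chiOpp p ψ (n - r) γ'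

/-- Here κ' is the conjugate of κ by diag(1, p), and N = D_η (E + pE') D_η⁻¹: the rows in E' acquire
the factor p, hence det N = p^{n-r}. Modulo p the upper right block of κ' vanishes, which puts (D',
C') in normal form with the complementary index set; the characters agree because ψ(det A) = ψ(det
D) for κ'. -/
theorem heckeRel_core (hψ : ψ ^ 2 = 1) {r : ℕ} (hr : r ≤ n) {η κ κ' : SpZ n}
    (hη : η ∈ parabolic n) (hκ : κ ∈ Gamma0 n p) (hA : bA ℤ κ' = bA ℤ κ)
    (hB : bB ℤ κ' = (p : ℤ) • bB ℤ κ) (hC : bC ℤ κ = (p : ℤ) • bC ℤ κ')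
    (hD : bD ℤ κ' = bD ℤ κ) : HeckeRel p ψ r (η * w n r * κ) (η * w n r * κ') := by
  have hp0 : (p : ℂ) ≠ 0 := by exact_mod_cast hp.out.ne_zero
  constructor
  · set E := idem ℂ (headSet n r) with hE
    set E' := idem ℂ (headSet n r)ᶜ with hE'
    have hu : IsUnit (bD ℂ η).det := by
      rw [det_map_bD]
      rcases det_bD_of_parabolic hη with h | h <;> simp [h]
    refine ⟨bD ℂ η * (E + (p : ℂ) • E') * (bD ℂ η)⁻¹, ?_, ?_, ?_⟩
    · rw [det_mul, det_mul, mul_right_comm, ← det_mul, mul_nonsing_inv _ hu, det_one, one_mul, hE, hE',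
        idem, idem, ← diagonal_smul, diagonal_add, det_diagonal]
      have : ∀ a ∈ Finset.univ, ((if a ∈ headSet n r then (1 : ℂ) else 0) +
          ((p : ℂ) • fun a => if a ∈ (headSet n r)ᶜ then (1 : ℂ) else 0) a) =
          if a ∈ (headSet n r)ᶜ then (p : ℂ) else 1 := fun a _ => by
        by_cases h : a ∈ headSet n r <;> simp [h]
      rw [Finset.prod_congr rfl this, Finset.prod_ite_mem, Finset.univ_inter, Finset.prod_const,
        Finset.card_compl, card_headSet hr, Fintype.card_fin]
    · have hC' : bC ℂ κ = (p : ℂ) • bC ℂ κ' := by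
        rw [map_bC ℂ κ, hC, map_zsmul_cast, ← map_bC]
      rw [(bottom_w_mul ℂ hη r κ).1, (bottom_w_mul ℂ hη r κ').1, Matrix.mul_assoc (bD ℂ η * _),
        ← Matrix.mul_assoc (bD ℂ η)⁻¹, nonsing_inv_mul _ hu, Matrix.one_mul, Matrix.mul_assoc,
        map_bA ℂ κ', hA, ← map_bA, hC', ← hE, ← hE']
      congr 1
      simp only [Matrix.add_mul, Matrix.mul_add, Matrix.smul_mul, Matrix.mul_smul,
        ← Matrix.mul_assoc, hE, hE', idem_mul_self, idem_mul_compl, idem_compl_mul, smul_zero, add_zero,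
        zero_add]
    · have hB' : bB ℂ κ' = (p : ℂ) • bB ℂ κ := by
        rw [map_bB ℂ κ', hB, map_zsmul_cast, ← map_bB]
      rw [(bottom_w_mul ℂ hη r κ).2, (bottom_w_mul ℂ hη r κ').2, Matrix.mul_assoc (bD ℂ η * _),
        ← Matrix.mul_assoc (bD ℂ η)⁻¹, nonsing_inv_mul _ hu, Matrix.one_mul, Matrix.mul_assoc,
        map_bD ℂ κ', hD, ← map_bD, hB', ← hE, ← hE', ← Matrix.mul_smul]
      congr 1
      simp only [Matrix.add_mul, Matrix.mul_add, Matrix.smul_mul, Matrix.mul_smul, smul_add,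
        ← Matrix.mul_assoc, hE, hE', idem_mul_self, idem_mul_compl, idem_compl_mul, smul_zero, add_zero,
        zero_add]
  · have hB0 : bB (ZMod p) κ' = 0 := by
      rw [map_bB, hB, map_zsmul_cast]; simp
    obtain ⟨c1, c2, c3⟩ := col_rel (ZMod p) κ'
    obtain ⟨r1, r2, r3⟩ := row_rel (ZMod p) κ'
    have r4 := row_rel' (ZMod p) κ'
    simp only [hB0, transpose_zero, Matrix.mul_zero, Matrix.zero_mul, sub_zero] at c3 r3 r4
    have hu : IsUnit (bD (ZMod p) η).det := by
      rw [det_map_bD]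
      rcases det_bD_of_parabolic hη with h | h <;> simp [h]
    have hN : NF (bD (ZMod p) (η * w n r * κ')) (bC (ZMod p) (η * w n r * κ')) (headSet n r)ᶜ
        (bD (ZMod p) η) (bD (ZMod p) κ') (bA (ZMod p) κ') ((bA (ZMod p) κ')ᵀ * bC (ZMod p) κ') := by
      refine ⟨?_, ?_, hu, ?_, ?_⟩
      · rw [(bottom_w_mul (ZMod p) hη r κ').2, hB0, Matrix.mul_zero, zero_add, Matrix.mul_assoc]
      · rw [(bottom_w_mul (ZMod p) hη r κ').1, compl_compl, Matrix.mul_assoc (idem _ _),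
          ← Matrix.mul_assoc (bD (ZMod p) κ'), r4, Matrix.one_mul, add_comm]
      · rw [← transpose_transpose (bA (ZMod p) κ'), ← transpose_mul, c3, transpose_one]
      · rw [transpose_mul, transpose_transpose, c1]
    rw [chi, chiOpp, pairChar_eq hψ (NF_of_decomp hη hκ) (card_headSet hr),
      pairChar_eq hψ hN (by rw [Finset.card_compl, card_headSet hr, Fintype.card_fin])]
    have e : bD (ZMod p) κ = bD (ZMod p) κ' := by rw [map_bD, ← hD, ← map_bD]
    rw [e]
    congr 1
    have h1 := congrArg (fun M => ψ M.det) c3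
    simp only [det_mul, det_transpose, det_one, map_mul, map_one] at h1
    have h2 : ψ (bD (ZMod p) κ').det * ψ (bD (ZMod p) κ').det = 1 :=
      MulChar.apply_sq hψ fun h => by rw [h, MulChar.map_zero, mul_zero] at h1; exact zero_ne_one h1
    calc ψ (bD (ZMod p) κ').det = (ψ (bA (ZMod p) κ').det * ψ (bD (ZMod p) κ').det) *
          ψ (bD (ZMod p) κ').det := by rw [h1, one_mul]
      _ = _ := by rw [mul_assoc, h2, mul_one]

theorem exists_heckeRel_left (hψ : ψ ^ 2 = 1) {r : ℕ} (hr : r ≤ n) {γ : SpZ n}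
    (h : chi p ψ r γ ≠ 0) : ∃ γ', HeckeRel p ψ r γ γ' := by
  obtain ⟨I, U, W, V, T, hI, h⟩ := pairChar_ne_zero h
  obtain ⟨η, hη, κ, hκ, rfl⟩ := exists_decomp hr h hI
  obtain ⟨κ', hA, hB, hC, hD⟩ := exists_conj_down hκ
  exact ⟨_, heckeRel_core hψ hr hη hκ hA hB hC hD⟩

theorem mul_w_inv (R : Type*) [Field R] (g : SpZ n) : bC R (g * (w n n)⁻¹) = -bD R g ∧
    bD R (g * (w n n)⁻¹) = bC R g := by
  obtain ⟨w1, w2, w3, w4⟩ := blocks_w R n n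
  have hh : headSet n n = Finset.univ := by ext a; simp [headSet]
  have hid : idem R (Finset.univ : Finset (Fin n)) = 1 := by
    rw [idem, ← diagonal_one]; simp
  have hid0 : idem R ((Finset.univ : Finset (Fin n))ᶜ) = 0 := by
    rw [idem]; ext a b; by_cases h : a = b <;> simp [h]
  rw [hh, hid0] at w1 w4
  rw [hh, hid] at w2 w3
  obtain ⟨i1, i2, i3, i4⟩ := blocks_inv R (w n n)
  rw [bC_mul, bD_mul, i1, i2, i3, i4, w1, w2, w3, w4]
  simp

/-- The preceding construction is applied to γ' w_n, where C and D are exchanged up to sign. It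
yields a matrix M running in the opposite direction, and pM⁻¹ is the required N. -/
theorem exists_heckeRel_right (hψ : ψ ^ 2 = 1) {r : ℕ} (hr : r ≤ n) {γ' : SpZ n}
    (h : chiOpp p ψ (n - r) γ' ≠ 0) : ∃ γ, HeckeRel p ψ r γ γ' := by
  have hp0 : (p : ℂ) ≠ 0 := by exact_mod_cast hp.out.ne_zero
  obtain ⟨m, hm, η, hη, κ, hκ, e⟩ := exists_decomp_of_card (p := p) (γ' * w n n)
  obtain ⟨κ', hA, hB, hC, hD⟩ := exists_conj_down hκ
  obtain ⟨⟨M, hM, hM1, hM2⟩, hM3⟩ := heckeRel_core hψ hm hη hκ hA hB hC hD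
  have hγ' : γ' = η * w n m * κ * (w n n)⁻¹ := by rw [← e, mul_inv_cancel_right]
  have hN := NF_of_decomp (p := p) (r := m) hη hκ
  set g := η * w n m * κ' with hg
  set f := η * w n m * κ with hf
  have hopp : chiOpp p ψ (n - r) γ' = ψ (-1) ^ (n - (n - r)) * chi p ψ (n - r) f := by
    rw [chiOpp, hγ', (mul_w_inv _ _).1, (mul_w_inv _ _).2, pairChar_neg_right hψ, Fintype.card_fin]
    rfl
  have hmr : m = n - r := by
    by_contra hne
    apply h
    rw [hopp, chi, pairChar_of_ne hN (by rwa [card_headSet hm]), mul_zero]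
  have hr' : r = n - m := by omega
  have hMu : IsUnit M.det := by rw [hM]; exact (pow_ne_zero _ hp0).isUnit
  have hMi : M⁻¹ * M = 1 := nonsing_inv_mul _ hMu
  refine ⟨g * (w n n)⁻¹, ⟨(p : ℂ) • M⁻¹, ?_, ?_, ?_⟩, ?_⟩
  · rw [det_smul, Fintype.card_fin, ← hmr, det_nonsing_inv, hM, Ring.inverse_eq_inv',
      ← div_eq_mul_inv, div_eq_iff (pow_ne_zero _ hp0), ← pow_add, Nat.add_sub_cancel' hm]
  · rw [hγ', (mul_w_inv _ _).1, (mul_w_inv _ _).1, Matrix.mul_neg, Matrix.smul_mul, ← Matrix.mul_smul,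
      hM2, ← Matrix.mul_assoc, hMi, Matrix.one_mul]
  · rw [hγ', (mul_w_inv _ _).2, (mul_w_inv _ _).2, hM1, Matrix.smul_mul, ← Matrix.mul_assoc, hMi,
      Matrix.one_mul]
  · have e1 : n - (n - r) = r := by omega
    rw [hopp, ← hmr, hM3, chi, (mul_w_inv _ _).1, (mul_w_inv _ _).2,
      pairChar_neg_left hψ (by rwa [Fintype.card_fin]), hmr, e1]
    rfl

/-- The lower left block of hg⁻¹ is C_h D_gᵀ - D_h C_gᵀ. Equality of cosets is thus a bilinear
condition on bottom rows, which the matrices N of `HeckeRel` respect although they are not integral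
symplectic data. -/
theorem coset_eq_iff_bottom {g h : SpZ n} : (Quotient.mk _ g : PCoset n) = Quotient.mk _ h ↔
    bC ℂ h * (bD ℂ g)ᵀ = bD ℂ h * (bC ℂ g)ᵀ := by
  obtain ⟨i1, i2, i3, i4⟩ := blocks_inv ℂ g
  have e : bC ℂ (h * g⁻¹) = bC ℂ h * (bD ℂ g)ᵀ - bD ℂ h * (bC ℂ g)ᵀ := by
    rw [bC_mul, i1, i3, Matrix.mul_neg, sub_eq_add_neg]
  rw [coset_eq_iff]
  constructor
  · intro hm
    rw [← sub_eq_zero, ← e, bC_of_parabolic ℂ hm]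
  · intro hm
    exact mem_parabolic_of_bC ℂ (by rw [e, hm, sub_self])

theorem HeckeRel.left_unique {r : ℕ} {γ₁ γ₂ γ₁' γ₂' : SpZ n} (h₁ : HeckeRel p ψ r γ₁ γ₁')
    (h₂ : HeckeRel p ψ r γ₂ γ₂') (h : (Quotient.mk _ γ₁' : PCoset n) = Quotient.mk _ γ₂') :
    (Quotient.mk _ γ₁ : PCoset n) = Quotient.mk _ γ₂ := by
  have hp0 : (p : ℂ) ≠ 0 := by exact_mod_cast hp.out.ne_zero
  obtain ⟨⟨N₁, -, c₁, d₁⟩, -⟩ := h₁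
  obtain ⟨⟨N₂, -, c₂, d₂⟩, -⟩ := h₂
  rw [coset_eq_iff_bottom] at h ⊢
  apply smul_right_injective _ hp0
  change (p : ℂ) • _ = (p : ℂ) • _
  rw [← Matrix.mul_smul, ← transpose_smul, d₁, ← Matrix.smul_mul, d₂, c₁, c₂, transpose_mul,
    transpose_mul, Matrix.mul_assoc, Matrix.mul_assoc, ← Matrix.mul_assoc (bC ℂ γ₂'),
    h, Matrix.mul_assoc]

theorem HeckeRel.right_unique {r : ℕ} {γ₁ γ₂ γ₁' γ₂' : SpZ n} (h₁ : HeckeRel p ψ r γ₁ γ₁')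
    (h₂ : HeckeRel p ψ r γ₂ γ₂') (h : (Quotient.mk _ γ₁ : PCoset n) = Quotient.mk _ γ₂) :
    (Quotient.mk _ γ₁' : PCoset n) = Quotient.mk _ γ₂' := by
  have hp0 : (p : ℂ) ≠ 0 := by exact_mod_cast hp.out.ne_zero
  obtain ⟨⟨N₁, e₁, c₁, d₁⟩, -⟩ := h₁
  obtain ⟨⟨N₂, e₂, c₂, d₂⟩, -⟩ := h₂
  have u₁ : IsUnit N₁ᵀ.det := by rw [det_transpose, e₁]; exact (pow_ne_zero _ hp0).isUnit
  have u₂ : IsUnit N₂.det := by rw [e₂]; exact (pow_ne_zero _ hp0).isUnit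
  rw [coset_eq_iff_bottom] at h ⊢
  have key : N₂ * (bC ℂ γ₂' * (bD ℂ γ₁')ᵀ) * N₁ᵀ = N₂ * (bD ℂ γ₂' * (bC ℂ γ₁')ᵀ) * N₁ᵀ := by
    calc _ = N₂ * bC ℂ γ₂' * (N₁ * bD ℂ γ₁')ᵀ := by simp only [transpose_mul, Matrix.mul_assoc]
      _ = N₂ * bD ℂ γ₂' * (N₁ * bC ℂ γ₁')ᵀ := by
          rw [← c₂, ← d₁, ← c₁, ← d₂, transpose_smul, Matrix.mul_smul, Matrix.smul_mul, h]
      _ = _ := by simp only [transpose_mul, Matrix.mul_assoc]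
  have h2 := congrArg (fun X => N₂⁻¹ * X * N₁ᵀ⁻¹) key
  simp only [Matrix.mul_assoc, mul_nonsing_inv _ u₁, Matrix.mul_one] at h2
  simp only [← Matrix.mul_assoc, nonsing_inv_mul _ u₂, Matrix.one_mul] at h2
  exact h2

end Conjugation

/-! ### Representatives ((1, S), (0, p)) of the double coset and their action. -/

section HeckeReps

variable {n p : ℕ} [hp : Fact p.Prime]

theorem val_eq_fromBlocks (g : SpZ n) : g.1 = fromBlocks (bA ℤ g) (bB ℤ g) (bC ℤ g) (bD ℤ g) := by
  rw [← map_eq_fromBlocks]; ext; simp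

theorem parabolic_le_gamma0 : parabolic n ≤ Gamma0 n p := fun g hg =>
  (mem_Gamma0_iff g).2 (bC_of_parabolic _ hg)

/-- The translation lifting a symmetric matrix modulo `p`. -/
def translLift (S : SymMat (Fin n) (ZMod p)) : SpZ n := transl (liftSym S.1) (liftSym_transpose S.2)

theorem translLift_mem (S : SymMat (Fin n) (ZMod p)) : translLift S ∈ Gamma0 n p :=
  parabolic_le_gamma0 (transl_mem_parabolic _ _)

/-- The representative `((1, S), (0, p))`. -/
def heckeRep (S : SymMat (Fin n) (ZMod p)) : Matrix (Idx n) (Idx n) ℤ :=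
  fromBlocks 1 (liftSym S.1) 0 ((p : ℤ) • 1)

theorem heckeRep_eq (S : SymMat (Fin n) (ZMod p)) : heckeRep S = tau n p * (translLift S).1 := by
  rw [heckeRep, translLift, transl, mkSp, tau, fromBlocks_multiply]
  simp

theorem heckeRep_mem (S : SymMat (Fin n) (ZMod p)) : heckeRep S ∈ heckeSet n p :=
  ⟨1, one_mem _, translLift S, translLift_mem S, by rw [heckeRep_eq]; simp⟩

/-- Removing the translation S = DᵀB modulo p from β leaves β' with upper right block divisible by
p; then τ_p β' = δ τ_p with δ in Γ₀(p). -/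
theorem exists_heckeRep {M : Matrix (Idx n) (Idx n) ℤ} (hM : M ∈ heckeSet n p) :
    ∃ S : SymMat (Fin n) (ZMod p), ∃ δ ∈ Gamma0 n p, M = δ.1 * heckeRep S := by
  obtain ⟨α, hα, β, hβ, rfl⟩ := hM
  obtain ⟨-, h2, h3⟩ := gamma0_rel hβ
  set S : SymMat (Fin n) (ZMod p) := ⟨(bD (ZMod p) β)ᵀ * bB (ZMod p) β, h2⟩ with hS
  set β' := β * (translLift S)⁻¹ with hβ'
  have hB : bB (ZMod p) β' = 0 := by
    obtain ⟨t1, t2, t3, t4⟩ := blocks_transl (ZMod p) (liftSym S.1) (liftSym_transpose S.2)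
    obtain ⟨i1, i2, i3, i4⟩ := blocks_inv (ZMod p) (translLift S)
    rw [hβ', (blocks_mul _ _ _).2.1, i2, i4]
    change _ * -(bB (ZMod p) (transl _ _))ᵀ + _ * (bA (ZMod p) (transl _ _))ᵀ = 0
    rw [t1, t2, liftSym_map, S.2, transpose_one, Matrix.mul_one, Matrix.mul_neg, hS, h3,
      neg_add_cancel]
  have hB1 : ∃ B₁ : Matrix (Fin n) (Fin n) ℤ, bB ℤ β' = (p : ℤ) • B₁ := by
    have : ∀ a b, ∃ c, bB ℤ β' a b = (p : ℤ) * c := fun a b => by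
      have := congrFun (congrFun hB a) b
      rw [map_bB] at this
      exact (ZMod.intCast_zmod_eq_zero_iff_dvd _ _).1 this
    choose B₁ h using this
    exact ⟨Matrix.of B₁, by ext a b; exact h a b⟩
  obtain ⟨B₁, hB1⟩ := hB1
  obtain ⟨δ, hδ, d1, d2, d3, d4⟩ := exists_conj_up hB1
  refine ⟨S, α * δ, mul_mem hα hδ, ?_⟩
  have e1 : tau n p * β'.1 = δ.1 * tau n p := by
    rw [val_eq_fromBlocks β', val_eq_fromBlocks δ, tau, fromBlocks_multiply, fromBlocks_multiply,
      d1, d2, d3, d4]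
    simp only [Matrix.one_mul, Matrix.zero_mul, Matrix.mul_one, Matrix.mul_zero, add_zero, zero_add,
      Matrix.smul_mul, Matrix.mul_smul, smul_zero]
  have e2 : β.1 = β'.1 * (translLift S).1 := by
    rw [← Submonoid.coe_mul, hβ', inv_mul_cancel_right]
  rw [e2, heckeRep_eq, show (α * δ).1 = α.1 * δ.1 from rfl, Matrix.mul_assoc, ← Matrix.mul_assoc (tau n p), e1]
  simp only [Matrix.mul_assoc]

theorem heckeRep_injective {S S' : SymMat (Fin n) (ZMod p)} {δ : SpZ n}
    (h : heckeRep S' = δ.1 * heckeRep S) : S = S' := by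
  rw [val_eq_fromBlocks δ, heckeRep, heckeRep, fromBlocks_multiply, fromBlocks_inj] at h
  obtain ⟨h1, h2, -, -⟩ := h
  rw [Matrix.mul_one, Matrix.mul_zero, add_zero] at h1
  rw [← h1, Matrix.one_mul, Matrix.mul_smul, Matrix.mul_one] at h2
  have h3 := congrArg (fun M => M.map (Int.castRingHom (ZMod p))) h2
  simp only [Matrix.map_add _ (map_add (Int.castRingHom (ZMod p))), liftSym_map,
    map_zsmul_cast] at h3
  apply Subtype.ext
  rw [h3]
  simp

/-- The cosets of the double coset of `diag(1, p)` are indexed by symmetric matrices modulo `p`. -/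
def heckeEquiv : SymMat (Fin n) (ZMod p) ≃ Quotient (heckeSetoid n p) :=
  Equiv.ofBijective (fun S => Quotient.mk _ ⟨heckeRep S, heckeRep_mem S⟩) ⟨fun S S' h => by
    obtain ⟨δ, -, e⟩ := Quotient.exact h
    exact heckeRep_injective e, fun q => by
    obtain ⟨M, rfl⟩ := Quotient.exists_rep q
    obtain ⟨S, δ, hδ, e⟩ := exists_heckeRep M.2
    exact ⟨S, Quotient.sound ⟨δ, hδ, e⟩⟩⟩

/-- The representative `((1, S), (0, p))` as a real similitude. -/
def heckeG (S : SymMat (Fin n) (ZMod p)) : GSpPos n :=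
  ofInt (heckeRep S) p (by exact_mod_cast hp.out.pos) (heckeSet_sim n p (heckeRep_mem S))

variable {ψ : DirichletCharacter ℂ p}

theorem charA_mul_charD {δ : SpZ n} (hδ : δ ∈ Gamma0 n p) :
    ψ ((bA ℤ δ).det : ZMod p) * charD ψ δ = 1 := by
  have h := congrArg (fun M => ψ M.det) (gamma0_rel hδ).1
  simp only [det_mul, det_transpose, det_one, map_mul, map_one] at h
  rw [charD_eq, ← h]
  congr 2
  rw [map_bA (ZMod p) δ, ← RingHom.mapMatrix_apply, ← RingHom.map_det]
  rfl

/-- Automorphy of f allows any representatives: changing one by δ produces ψ(det A_δ) ψ(det D_δ) =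
1. The chosen ones have A = 1, so the character disappears from the sum. -/
theorem Up_eq {k : ℤ} {f : HalfSpace n → ℂ} (hf : f ∈ autForms n p k ψ) (Z : HalfSpace n) :
    Up n p k ψ f Z = (p : ℂ) ^ ((n : ℂ) * k / 2 - (n : ℂ) * (n + 1) / 2) *
      ∑ S : SymMat (Fin n) (ZMod p), slash k f (heckeG S) Z := by
  rw [Up, ← finsum_comp_equiv heckeEquiv, finsum_eq_sum_of_fintype]
  congr 1
  refine Finset.sum_congr rfl fun S _ => ?_
  have h1 : (Quotient.mk (heckeSetoid n p) ⟨heckeRep S, heckeRep_mem S⟩) =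
      Quotient.mk (heckeSetoid n p) (heckeEquiv S).out := (Quotient.out_eq (heckeEquiv S)).symm
  obtain ⟨δ, hδ, e⟩ := Quotient.exact h1
  have key : ∀ M : heckeSet n p, M.1 = δ.1 * heckeRep S → ψ ((M.1.toBlocks₁₁.det : ℤ) : ZMod p) *
      slash k f (ofInt M.1 p (by exact_mod_cast hp.out.pos) (heckeSet_sim n p M.2)) Z =
        slash k f (heckeG S) Z := by
    rintro ⟨M, hM⟩ e
    simp only at e ⊢
    subst e
    have e1 : (δ.1 * heckeRep S).toBlocks₁₁ = bA ℤ δ := by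
      rw [val_eq_fromBlocks δ, heckeRep, fromBlocks_multiply]
      simp
    rw [e1, slash_mul k f (g₁ := δ.toGSp) (g₂ := heckeG S), hf δ hδ, slash, Pi.smul_apply,
      smul_eq_mul]
    · linear_combination (autFactor (heckeG S) Z ^ (-k) * f (act (heckeG S) Z)) *
        charA_mul_charD (ψ := ψ) hδ
    · simp only [ofInt, SpZ.toGSp, heckeG, Matrix.map_mul]
    · simp [ofInt, SpZ.toGSp, heckeG]
  exact key _ e

theorem heckeG_blocks (S : SymMat (Fin n) (ZMod p)) (Z : HalfSpace n) :
    (heckeG S).num Z.1 = Z.1 + (liftSym S.1).map (Int.castRingHom ℂ) ∧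
      (heckeG S).den Z.1 = (p : ℂ) • 1 := by
  have h1 : (heckeG S).A = 1 := by
    ext a b
    rcases eq_or_ne a b with rfl | h
    · simp [heckeG, ofInt, GSpPos.A, heckeRep, toBlocks₁₁]
    · simp [heckeG, ofInt, GSpPos.A, heckeRep, toBlocks₁₁, h]
  have h2 : (heckeG S).B = (liftSym S.1).map (Int.castRingHom ℂ) := by
    ext a b
    simp [heckeG, ofInt, GSpPos.B, heckeRep, toBlocks₁₂]
  have h3 : (heckeG S).C = 0 := by
    ext a b
    simp [heckeG, ofInt, GSpPos.C, heckeRep, toBlocks₂₁]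
  have h4 : (heckeG S).D = (p : ℂ) • 1 := by
    ext a b
    change (((((p : ℤ) • (1 : Matrix (Fin n) (Fin n) ℤ)) a b : ℤ) : ℝ) : ℂ) =
      ((p : ℂ) • (1 : Matrix (Fin n) (Fin n) ℂ)) a b
    rw [Matrix.smul_apply, Matrix.smul_apply, smul_eq_mul, smul_eq_mul]
    rcases eq_or_ne a b with rfl | h
    · simp
    · simp [h]
  rw [GSpPos.num, GSpPos.den, h1, h2, h3, h4]
  simp

theorem autFactor_heckeG (S : SymMat (Fin n) (ZMod p)) (Z : HalfSpace n) :
    autFactor (heckeG S) Z = (((p : ℝ) ^ ((n : ℝ) / 2) : ℝ) : ℂ) := by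
  have hp0 : (0 : ℝ) < p := by exact_mod_cast hp.out.pos
  rw [autFactor, (heckeG_blocks S Z).2, det_smul, det_one, mul_one, Fintype.card_fin]
  have : (heckeG S).mu = p := by simp [heckeG, ofInt]
  rw [this, ← Complex.ofReal_natCast p, ← Complex.ofReal_pow, ← Complex.ofReal_mul,
    ← Real.rpow_natCast, ← Real.rpow_add hp0]
  congr 2
  ring

theorem act_heckeG (S : SymMat (Fin n) (ZMod p)) (Z : HalfSpace n) :
    (act (heckeG S) Z).1 = (p : ℂ)⁻¹ • (Z.1 + (liftSym S.1).map (Int.castRingHom ℂ)) := by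
  have hp0 : (p : ℂ) ≠ 0 := by exact_mod_cast hp.out.ne_zero
  change (heckeG S).num Z.1 * ((heckeG S).den Z.1)⁻¹ = _
  have : ((p : ℂ) • (1 : Matrix (Fin n) (Fin n) ℂ))⁻¹ = (p : ℂ)⁻¹ • 1 := by
    apply inv_eq_left_inv
    rw [Matrix.smul_mul, Matrix.one_mul, smul_smul, inv_mul_cancel₀ hp0, one_smul]
  rw [(heckeG_blocks S Z).1, (heckeG_blocks S Z).2, this, Matrix.mul_smul, Matrix.mul_one]

theorem bottom_translLift (R : Type*) [CommRing R] (S : SymMat (Fin n) (ZMod p)) (g : SpZ n) :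
    bC R (g * translLift S) = bC R g ∧
      bD R (g * translLift S) = bC R g * (liftSym S.1).map (Int.castRingHom R) + bD R g := by
  obtain ⟨t1, t2, t3, t4⟩ := blocks_transl R (liftSym S.1) (liftSym_transpose S.2)
  rw [bC_mul, bD_mul]
  change bC R g * bA R (transl _ _) + bD R g * bC R (transl _ _) = _ ∧
    bC R g * bB R (transl _ _) + bD R g * bD R (transl _ _) = _
  rw [t1, t2, t3, t4]
  simp

/-- The point is (Z + S)/p, and C(Z + S)/p + D = p⁻¹ N (C'(Z + S) + D'). The determinant of p⁻¹N is
p^{-n} p^{n-r} = p^{-r}. -/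
theorem HeckeRel.autFactor_eq {r : ℕ} (hr : r ≤ n) {γ γ' : SpZ n} (h : HeckeRel p ψ r γ γ')
    (S : SymMat (Fin n) (ZMod p)) (Z : HalfSpace n) :
    autFactor γ.toGSp (act (heckeG S) Z) =
      (((p : ℝ) ^ (-(r : ℝ)) : ℝ) : ℂ) * autFactor (γ' * translLift S).toGSp Z := by
  have hp0 : (p : ℂ) ≠ 0 := by exact_mod_cast hp.out.ne_zero
  have hp0' : (0 : ℝ) < p := by exact_mod_cast hp.out.pos
  obtain ⟨⟨N, hN, h1, h2⟩, -⟩ := h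
  have e : bC ℂ γ * (act (heckeG S) Z).1 + bD ℂ γ =
      (p : ℂ)⁻¹ • (N * (bC ℂ γ' * Z.1 + (bC ℂ γ' * (liftSym S.1).map (Int.castRingHom ℂ) +
        bD ℂ γ'))) := by
    have h3 : bD ℂ γ = (p : ℂ)⁻¹ • ((p : ℂ) • bD ℂ γ) := by
      rw [smul_smul, inv_mul_cancel₀ hp0, one_smul]
    rw [h3, h2, h1, act_heckeG, Matrix.mul_smul, ← smul_add]
    congr 1
    noncomm_ring
  rw [autFactor_toGSp, autFactor_toGSp, e, (bottom_translLift ℂ S γ').1, (bottom_translLift ℂ S γ').2,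
    det_smul, det_mul, hN, ← mul_assoc, Fintype.card_fin]
  congr 1
  rw [Real.rpow_neg hp0'.le, Real.rpow_natCast]
  push_cast
  rw [inv_pow, inv_mul_eq_iff_eq_mul₀ (pow_ne_zero _ hp0), eq_mul_inv_iff_mul_eq₀ (pow_ne_zero _ hp0),
    ← pow_add, Nat.sub_add_cancel hr]

theorem chiOpp_parabolic_mul (hψ : ψ ^ 2 = 1) {η : SpZ n} (hη : η ∈ parabolic n) (r : ℕ) (g : SpZ n) :
    chiOpp p ψ r (η * g) = ψ ((bD ℤ η).det : ZMod p) * chiOpp p ψ r g := by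
  have hu : IsUnit (bD (ZMod p) η).det := by
    rw [det_map_bD]
    rcases det_bD_of_parabolic hη with h | h <;> simp [h]
  rw [chiOpp, bC_mul, bD_mul, bC_of_parabolic (ZMod p) hη, Matrix.zero_mul, Matrix.zero_mul, zero_add,
    zero_add, pairChar_mul_left hψ hu, det_map_bD]
  rfl

theorem chiOpp_leftInv (hψ : ψ ^ 2 = 1) {k : ℤ} (hk : ψ (-1) = (-1) ^ k) (r : ℕ) (Z : HalfSpace n)
    (s : ℂ) (t u : SpZ n) :
    LeftInv fun g : SpZ n => chiOpp p ψ r (g * t) * wt k s (autFactor (g * u).toGSp Z) := by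
  intro η hη g
  simp only [mul_assoc η]
  rw [chiOpp_parabolic_mul hψ hη, autFactor_parabolic_mul hη, wt_mul]
  linear_combination chiOpp p ψ r (g * t) * wt k s (autFactor (g * u).toGSp Z) *
    char_mul_wt hψ hk s (det_bD_of_parabolic hη)

theorem wt_ne_zero (k : ℤ) (s : ℂ) {z : ℂ} (hz : z ≠ 0) : wt k s z ≠ 0 := by
  rw [← norm_pos_iff, norm_wt k s hz]
  exact Real.rpow_pos_of_pos (norm_pos_iff.2 hz) _

/-- The Hecke correspondence on the index set of the Eisenstein series. -/
theorem tsum_heckeG (hψ : ψ ^ 2 = 1) {k : ℤ} (hk : ψ (-1) = (-1) ^ k) {r : ℕ} (hr : r ≤ n)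
    (S : SymMat (Fin n) (ZMod p)) (Z : HalfSpace n) (s : ℂ) :
    ∑' q : PCoset n, eisFun p ψ k r (act (heckeG S) Z) s q.out =
      wt k s (((p : ℝ) ^ (-(r : ℝ)) : ℝ) : ℂ) * ∑' q : PCoset n,
        chiOpp p ψ (n - r) (q.out * (translLift S)⁻¹) * wt k s (autFactor q.out.toGSp Z) := by
  have hL := chiOpp_leftInv (p := p) hψ hk (n - r) Z s 1 (translLift S)
  have hL' := chiOpp_leftInv (p := p) hψ hk (n - r) Z s (translLift S)⁻¹ 1
  have hE := eisFun_leftInv (p := p) hψ hk r (act (heckeG S) Z) s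
  simp only [mul_one] at hL hL'
  rw [← tsum_mul_right_coset hL' (translLift S), ← tsum_mul_left]
  simp only [mul_inv_cancel_right]
  set g : PCoset n → ℂ := fun q => wt k s (((p : ℝ) ^ (-(r : ℝ)) : ℝ) : ℂ) *
    (chiOpp p ψ (n - r) q.out * wt k s (autFactor (q.out * translLift S).toGSp Z)) with hg
  have hex : ∀ q : Function.support g, ∃ γ, HeckeRel p ψ r γ q.1.out := fun q =>
    exists_heckeRel_right hψ hr fun h => q.2 (by simp [hg, h])
  choose φ hφ using hex
  have hval : ∀ {γ γ' : SpZ n}, HeckeRel p ψ r γ γ' → eisFun p ψ k r (act (heckeG S) Z) s γ =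
      wt k s (((p : ℝ) ^ (-(r : ℝ)) : ℝ) : ℂ) *
        (chiOpp p ψ (n - r) γ' * wt k s (autFactor (γ' * translLift S).toGSp Z)) := by
    intro γ γ' h
    rw [eisFun, h.autFactor_eq hr, h.2, wt_mul]
    ring
  -- `HeckeRel` pairs cosets only where the summands do not vanish, so the bijection is one between
  -- supports; its injectivity and surjectivity are the two uniqueness lemmas.
  refine tsum_eq_tsum_of_ne_zero_bij (fun q => Quotient.mk _ (φ q)) ?_ ?_ ?_
  · intro q q' h
    have := (hφ q).right_unique (hφ q') h
    rwa [Quotient.out_eq, Quotient.out_eq, Subtype.coe_inj] at this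
  · intro q hq
    obtain ⟨γ', hγ'⟩ := exists_heckeRel_left (p := p) hψ hr (left_ne_zero_of_mul hq)
    have hq' : g (Quotient.mk _ γ') ≠ 0 := by
      have : g (Quotient.mk _ γ') = eisFun p ψ k r (act (heckeG S) Z) s q.out :=
        (congrArg (wt k s (((p : ℝ) ^ (-(r : ℝ)) : ℝ) : ℂ) * ·) (hL.out γ')).trans (hval hγ').symm
      rw [this]
      exact hq
    refine ⟨⟨_, hq'⟩, ?_⟩
    have := (hφ ⟨_, hq'⟩).left_unique hγ' (Quotient.out_eq _)
    exact this.trans (Quotient.out_eq q)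
  · intro q
    rw [hE.out, hval (hφ q)]

end HeckeReps

/-! ### The matrix of U(p) in the domain of convergence. -/

section HeckeEisenstein

variable {n p : ℕ} [hp : Fact p.Prime] {ψ : DirichletCharacter ℂ p}

theorem chiOpp_mul_translLift_inv (r : ℕ) (S : SymMat (Fin n) (ZMod p)) (g : SpZ n) :
    chiOpp p ψ r (g * (translLift S)⁻¹) =
      pairChar ψ r (bD (ZMod p) g - bC (ZMod p) g * S.1) (bC (ZMod p) g) := by
  obtain ⟨h1, h2⟩ := bottom_translLift (ZMod p) S (g * (translLift S)⁻¹)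
  rw [inv_mul_cancel_right] at h1 h2
  rw [liftSym_map, ← h1] at h2
  rw [chiOpp, ← h1, h2, add_sub_cancel_left]

theorem norm_chiOpp_le (hψ : ψ ^ 2 = 1) (r : ℕ) (g : SpZ n) : ‖chiOpp p ψ r g‖ ≤ 1 := by
  by_cases h : ∃ I U W V T, I.card = r ∧ NF (bD (ZMod p) g) (bC (ZMod p) g) I U W V T
  · obtain ⟨I, U, W, V, T, hr, h⟩ := h
    rw [chiOpp, pairChar_eq hψ h hr, norm_mul]
    exact mul_le_one₀ (DirichletCharacter.norm_le_one ψ _) (norm_nonneg _)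
      (DirichletCharacter.norm_le_one ψ _)
  · rw [chiOpp, pairChar_eq_zero h, norm_zero]
    exact zero_le_one

theorem eisSeries_mem_autForms (hψ : ψ ^ 2 = 1) {k : ℤ} (hk : ψ (-1) = (-1) ^ k) {r : ℕ}
    (hr : r ≤ n) (s : ℂ) : (fun Z => eisSeries n p ψ k r Z s) ∈ autForms n p k ψ := by
  intro κ hκ
  funext Z
  exact slash_eisSeries hψ hk hr s hκ Z

theorem sum_chiOpp (hψ : ψ ^ 2 = 1) {i : ℕ} (hi : i ≤ n) (g : SpZ n) :
    ∑ S : SymMat (Fin n) (ZMod p), chiOpp p ψ (n - i) (g * (translLift S)⁻¹) =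
      ∑ j ∈ Finset.Icc i n, (p : ℂ) ^ (n * (n + 1) / 2) / (p : ℂ) ^ (j * (j + 1) / 2) *
        symSum (F := ZMod p) ψ (j - i) (Fin j) * chi p ψ j g := by
  simp only [chiOpp_mul_translLift_inv]
  have hXY : bC (ZMod p) g * -(bB (ZMod p) g)ᵀ + bD (ZMod p) g * (bA (ZMod p) g)ᵀ = 1 := by
    rw [← row_rel' (ZMod p) g, Matrix.mul_neg]; abel
  have := sum_pairChar hψ (row_rel (ZMod p) g).2.1 hXY (i := i) (by rwa [Fintype.card_fin])
  rw [Fintype.card_fin] at this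
  rw [this]
  refine Finset.sum_congr rfl fun j _ => ?_
  rw [card_symMat_fin, card_symMat_fin, ZMod.card, chi]
  push_cast
  rfl

theorem cpow_half_choose (x : ℂ) (m : ℕ) :
    x ^ ((m : ℂ) * (m + 1) / 2) = x ^ (m * (m + 1) / 2) := by
  rw [← Complex.cpow_natCast, Nat.cast_div_charZero (Nat.even_mul_succ_self m).two_dvd]
  push_cast
  rfl

/-- The action of `U(p)` on the Eisenstein series in the domain of absolute convergence. -/
theorem Up_eisSeries (hψ : ψ = 1 ∨ ψ = quadChar p) {k : ℤ}
    (hk : ψ (-1) = (-1) ^ k) {i : ℕ} (hi : i ≤ n) {s : ℂ} (hs : (n : ℝ) + 1 < 2 * s.re)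
    (Z : HalfSpace n) :
    Up n p k ψ (fun W => eisSeries n p ψ k i W s) Z = (p : ℂ) ^ ((n : ℂ) * ((k : ℂ) / 2 - s)) *
      ∑ j ∈ Finset.Icc i n, mCoeff p ψ s i j * eisSeries n p ψ k j Z s := by
  have hp0 : (p : ℂ) ≠ 0 := by exact_mod_cast hp.out.ne_zero
  have hp0' : (0 : ℝ) < p := by exact_mod_cast hp.out.pos
  have hψ2 : ψ ^ 2 = 1 := by
    rcases hψ with rfl | rfl
    · exact one_pow 2
    · exact quadChar_sq p
  rw [Up_eq (eisSeries_mem_autForms hψ2 hk hi s)]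
  set Y : ℂ := ((Z.imag.det : ℝ) : ℂ) ^ (s - k / 2) with hY
  set c : ℂ := wt k s (((p : ℝ) ^ ((n : ℝ) / 2) : ℝ) : ℂ) *
    wt k s (((p : ℝ) ^ (-(i : ℝ)) : ℝ) : ℂ) with hc
  have hsum : ∀ S : SymMat (Fin n) (ZMod p), Summable fun q : PCoset n =>
      chiOpp p ψ (n - i) (q.out * (translLift S)⁻¹) * wt k s (autFactor q.out.toGSp Z) := fun S =>
    Summable.of_norm_bounded (summable_norm_autFactor hs Z) fun q => by
      rw [norm_mul, norm_wt _ _ (autFactor_ne_zero _ _)]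
      exact mul_le_of_le_one_left (Real.rpow_nonneg (norm_nonneg _) _) (norm_chiOpp_le hψ2 _ _)
  have h1 : ∀ S : SymMat (Fin n) (ZMod p),
      slash k (fun W => eisSeries n p ψ k i W s) (heckeG S) Z = Y * c * ∑' q : PCoset n,
        chiOpp p ψ (n - i) (q.out * (translLift S)⁻¹) * wt k s (autFactor q.out.toGSp Z) := by
    intro S
    rw [slash, eisSeries_eq hψ2 k hi, ← mul_assoc, autFactor_mul_det_cpow, tsum_heckeG hψ2 hk hi,
      autFactor_heckeG]
    ring
  -- After translation by S the weight no longer depends on S, so the finite sum over S may be taken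
  -- first and acts on the characters alone.
  have h2 : ∑ S : SymMat (Fin n) (ZMod p), ∑' q : PCoset n,
        chiOpp p ψ (n - i) (q.out * (translLift S)⁻¹) * wt k s (autFactor q.out.toGSp Z) =
      ∑ j ∈ Finset.Icc i n, (p : ℂ) ^ (n * (n + 1) / 2) / (p : ℂ) ^ (j * (j + 1) / 2) *
        symSum (F := ZMod p) ψ (j - i) (Fin j) * ∑' q : PCoset n, eisFun p ψ k j Z s q.out := by
    rw [← Summable.tsum_finsetSum fun S _ => hsum S]
    simp only [← Finset.sum_mul, sum_chiOpp hψ2 hi]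
    simp only [Finset.sum_mul, mul_assoc]
    rw [Summable.tsum_finsetSum]
    · refine Finset.sum_congr rfl fun j _ => ?_
      simp only [tsum_mul_left]
      rfl
    · exact fun j _ => ((summable_eisFun hψ2 k j Z hs).mul_left _).mul_left _
  -- The factor p^{n/2} comes from the automorphy factor of the representative, p^{-i} from the
  -- correspondence of bottom rows; raising p^{n/2-i} to the power -2s gives the exponent.
  have hcc : c = (p : ℂ) ^ (-(n : ℂ) * s + 2 * s * i) := by
    rw [hc, ← wt_mul, ← Complex.ofReal_mul, ← Real.rpow_add hp0',
      wt_ofReal (Real.rpow_pos_of_pos hp0' _),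
      ← Complex.cpow_mul_ofReal_nonneg hp0'.le, Complex.ofReal_natCast]
    congr 1
    push_cast
    ring
  simp only [h1]
  rw [← Finset.mul_sum, h2, hcc, Finset.mul_sum, Finset.mul_sum, Finset.mul_sum]
  refine Finset.sum_congr rfl fun j hj => ?_
  rw [Finset.mem_Icc] at hj
  rw [mCoeff_eq p hψ s hj.1, eisSeries_eq hψ2 k hj.2, ← hY, ← cpow_half_choose,
    ← cpow_half_choose]
  -- The number p^{n(n+1)/2} of symmetric matrices modulo p cancels against the normalising factor
  -- of U(p).
  have e : (p : ℂ) ^ ((n : ℂ) * k / 2 - (n : ℂ) * (n + 1) / 2) * (p : ℂ) ^ (-(n : ℂ) * s + 2 * s * i) *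
      (p : ℂ) ^ ((n : ℂ) * (n + 1) / 2) * ((p : ℂ) ^ ((j : ℂ) * (j + 1) / 2))⁻¹ =
      (p : ℂ) ^ ((n : ℂ) * ((k : ℂ) / 2 - s)) * (p : ℂ) ^ (2 * s * i - (j : ℂ) * (j + 1) / 2) := by
    rw [← Complex.cpow_neg, ← Complex.cpow_add _ _ hp0, ← Complex.cpow_add _ _ hp0, ← Complex.cpow_add _ _ hp0,
      ← Complex.cpow_add _ _ hp0]
    congr 1
    ring
  linear_combination (Y * symSum (F := ZMod p) ψ (j - i) (Fin j) *
    ∑' q : PCoset n, eisFun p ψ k j Z s q.out) * e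

end HeckeEisenstein

/-! ### The eigenvectors of the triangular matrix of U(p). -/

section Eigenvector

variable (p : ℕ) [hp : Fact p.Prime]

theorem mCoeff_self (ψ : DirichletCharacter ℂ p) (s : ℂ) (i : ℕ) :
    mCoeff p ψ s i i = (p : ℂ) ^ (2 * s * i - (i : ℂ) * (i + 1) / 2) := by
  simp [mCoeff, mTriv, mQuad]

theorem bCoeff_self (ψ : DirichletCharacter ℂ p) (s : ℂ) (i : ℕ) : bCoeff p ψ s i i = 1 := by
  rw [bCoeff]
  simp

theorem bCoeff_of_lt (ψ : DirichletCharacter ℂ p) (s : ℂ) {i j : ℕ} (hij : i < j) :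
    bCoeff p ψ s i j = -((p : ℂ) ^ (-2 * s * i + (i : ℂ) * (i + 1) / 2) /
        ((p : ℂ) ^ (((j : ℂ) - i) * (2 * s - ((j : ℂ) + i + 1) / 2)) - 1)) *
      ∑ r ∈ Finset.Ico i j, mCoeff p ψ s r j * bCoeff p ψ s i r := by
  rw [bCoeff, if_neg hij.not_gt, if_neg hij.ne']
  congr 1
  exact Finset.sum_attach (Finset.Ico i j) fun r => mCoeff p ψ s r j * bCoeff p ψ s i r

/-- This is the j-th column of the equation b·m = m_ii b for the row b = (b_ij)_j. Isolating b_ij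
leaves the coefficient m_jj - m_ii = m_ii (p^{(j-i)(2s-(j+i+1)/2)} - 1), and division by it is the
recursion. -/
theorem sum_bCoeff_mul_mCoeff (ψ : DirichletCharacter ℂ p) (s : ℂ) {i j : ℕ} (hij : i ≤ j)
    (h : i < j → (p : ℂ) ^ (((j : ℂ) - i) * (2 * s - ((j : ℂ) + i + 1) / 2)) ≠ 1) :
    ∑ r ∈ Finset.Icc i j, bCoeff p ψ s i r * mCoeff p ψ s r j =
      mCoeff p ψ s i i * bCoeff p ψ s i j := by
  have hp0 : (p : ℂ) ≠ 0 := by exact_mod_cast hp.out.ne_zero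
  rcases hij.eq_or_lt with rfl | hlt
  · simp [mul_comm]
  have e1 : mCoeff p ψ s j j = mCoeff p ψ s i i *
      (p : ℂ) ^ (((j : ℂ) - i) * (2 * s - ((j : ℂ) + i + 1) / 2)) := by
    rw [mCoeff_self, mCoeff_self, ← Complex.cpow_add _ _ hp0]
    congr 1
    ring
  have e2 : mCoeff p ψ s i i * (p : ℂ) ^ (-2 * s * i + (i : ℂ) * (i + 1) / 2) = 1 := by
    rw [mCoeff_self, ← Complex.cpow_add _ _ hp0]
    ring_nf
    exact Complex.cpow_zero _
  have e3 : ∑ r ∈ Finset.Ico i j, bCoeff p ψ s i r * mCoeff p ψ s r j =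
      ∑ r ∈ Finset.Ico i j, mCoeff p ψ s r j * bCoeff p ψ s i r :=
    Finset.sum_congr rfl fun r _ => mul_comm _ _
  have hden := sub_ne_zero.2 (h hlt)
  rw [← Finset.Ico_insert_right hij, Finset.sum_insert (by simp), e1, e3]
  have hb := bCoeff_of_lt p ψ s hlt
  set X := (p : ℂ) ^ (((j : ℂ) - i) * (2 * s - ((j : ℂ) + i + 1) / 2)) with hX
  set T := ∑ r ∈ Finset.Ico i j, mCoeff p ψ s r j * bCoeff p ψ s i r with hT
  have hb' : bCoeff p ψ s i j * (X - 1) =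
      -((p : ℂ) ^ (-2 * s * i + (i : ℂ) * (i + 1) / 2)) * T := by
    rw [hb]
    field_simp
  linear_combination mCoeff p ψ s i i * hb' - T * e2

theorem sum_bCoeff_sum_mCoeff (ψ : DirichletCharacter ℂ p) (s : ℂ) {i n : ℕ}
    (h : ∀ j : ℕ, i < j → j ≤ n →
      (p : ℂ) ^ (((j : ℂ) - i) * (2 * s - ((j : ℂ) + i + 1) / 2)) ≠ 1) (e : ℕ → ℂ) :
    ∑ r ∈ Finset.Icc i n, bCoeff p ψ s i r * ∑ j ∈ Finset.Icc r n, mCoeff p ψ s r j * e j =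
      mCoeff p ψ s i i * ∑ j ∈ Finset.Icc i n, bCoeff p ψ s i j * e j := by
  simp only [Finset.mul_sum]
  rw [Finset.sum_comm' (t' := Finset.Icc i n) (s' := fun j => Finset.Icc i j)
    (by intro a b; simp only [Finset.mem_Icc]; omega)]
  refine Finset.sum_congr rfl fun j hj => ?_
  rw [Finset.mem_Icc] at hj
  rw [← mul_assoc, ← sum_bCoeff_mul_mCoeff p ψ s hj.1 (fun hlt => h j hlt hj.2), Finset.sum_mul]
  exact Finset.sum_congr rfl fun r _ => (mul_assoc _ _ _).symm

/-- The real part of the exponent is positive, because 2 Re(s) > j + 1 > (j + i + 1)/2; so the power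
has absolute value greater than 1. -/
theorem bCoeff_denom_ne_one {s : ℂ} {i j : ℕ} (hij : i < j) (hs : (j : ℝ) + 1 < 2 * s.re)  :
    (p : ℂ) ^ (((j : ℂ) - i) * (2 * s - ((j : ℂ) + i + 1) / 2)) ≠ 1 := by
  intro h
  have hp1 : (1 : ℝ) < p := by exact_mod_cast hp.out.one_lt
  have h1 := congrArg norm h
  rw [norm_one, Complex.norm_natCast_cpow_of_pos hp.out.pos] at h1
  have hji : (i : ℝ) + 1 ≤ j := by exact_mod_cast hij
  have e : (((j : ℂ) - i) * (2 * s - ((j : ℂ) + i + 1) / 2)).re =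
      ((j : ℝ) - i) * (2 * s.re - ((j : ℝ) + i + 1) / 2) := by
    have : (((j : ℂ) - i) * (2 * s - ((j : ℂ) + i + 1) / 2)) =
      (((j : ℝ) - i : ℝ) : ℂ) * (2 * s - (((j : ℝ) + i + 1) / 2 : ℝ)) := by push_cast; rfl
    rw [this, Complex.re_ofReal_mul]
    simp
  rw [e] at h1
  exact (Real.one_lt_rpow hp1 (mul_pos (by linarith) (by linarith))).ne' h1

variable {p} {n : ℕ} {ψ : DirichletCharacter ℂ p}

theorem Up_sum_mul (k : ℤ) {ι : Type*} (t : Finset ι) (c : ι → ℂ) (f : ι → HalfSpace n → ℂ)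
    (Z : HalfSpace n) :
    Up n p k ψ (fun W => ∑ a ∈ t, c a * f a W) Z = ∑ a ∈ t, c a * Up n p k ψ (f a) Z := by
  have : Finite (Quotient (heckeSetoid n p)) := Finite.of_equiv _ (heckeEquiv (n := n) (p := p))
  have := Fintype.ofFinite (Quotient (heckeSetoid n p))
  simp only [Up, finsum_eq_sum_of_fintype, slash, Finset.mul_sum]
  rw [Finset.sum_comm]
  refine Finset.sum_congr rfl fun a _ => Finset.sum_congr rfl fun q _ => ?_
  ring

theorem eigenEis_eq (k : ℤ) {i : ℕ} (hi : i ≤ n) (s : ℂ) (Z : HalfSpace n) :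
    eigenEis p n ψ k i s Z = ∑ j ∈ Finset.Icc i n, bCoeff p ψ s i j * eisenstein n p ψ k j Z s := by
  rw [eigenEis, ← Finset.insert_Icc_add_one_left_eq_Icc hi, Finset.sum_insert (by simp),
    bCoeff_self, one_mul]

theorem eigenEis_mem_autForms {k : ℤ} {i : ℕ} (hi : i ≤ n) {s : ℂ}
    (h : ∀ j ∈ Finset.Icc i n, (fun Z => eisenstein n p ψ k j Z s) ∈ autForms n p k ψ) :
    eigenEis p n ψ k i s ∈ autForms n p k ψ := by
  have : eigenEis p n ψ k i s =
      ∑ j ∈ Finset.Icc i n, bCoeff p ψ s i j • fun Z => eisenstein n p ψ k j Z s := by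
    funext Z
    rw [eigenEis_eq k hi, Finset.sum_apply]
    rfl
  rw [this]
  exact Submodule.sum_mem _ fun j hj => Submodule.smul_mem _ _ (h j hj)

/-- The matrix of `U(p)` on the Eisenstein series at `(Z, s)`. -/
def HeckeIdentity (n p : ℕ) [Fact p.Prime] (ψ : DirichletCharacter ℂ p) (k : ℤ) (i : ℕ)
    (Z : HalfSpace n) (s : ℂ) : Prop :=
  Up n p k ψ (fun W => eisenstein n p ψ k i W s) Z =
    (p : ℂ) ^ ((n : ℂ) * ((k : ℂ) / 2 - s)) *
      ∑ j ∈ Finset.Icc i n, mCoeff p ψ s i j * eisenstein n p ψ k j Z s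

theorem eigenvalue_eq (k : ℤ) (i : ℕ) (s : ℂ) : eigenvalue p n k i s =
    (p : ℂ) ^ ((n : ℂ) * ((k : ℂ) / 2 - s)) * mCoeff p ψ s i i := by
  have hp0 : (p : ℂ) ≠ 0 := by exact_mod_cast hp.out.ne_zero
  rw [mCoeff_self, eigenvalue, ← Complex.cpow_add _ _ hp0]
  congr 1
  ring

theorem Up_eigenEis {k : ℤ} {i : ℕ} (hi : i ≤ n) {s : ℂ} {Z : HalfSpace n}
    (h : ∀ j ∈ Finset.Icc i n, HeckeIdentity n p ψ k j Z s)
    (hd : ∀ j : ℕ, i < j → j ≤ n →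
      (p : ℂ) ^ (((j : ℂ) - i) * (2 * s - ((j : ℂ) + i + 1) / 2)) ≠ 1) :
    Up n p k ψ (eigenEis p n ψ k i s) Z = eigenvalue p n k i s * eigenEis p n ψ k i s Z := by
  have e : eigenEis p n ψ k i s = fun W => ∑ j ∈ Finset.Icc i n,
      bCoeff p ψ s i j * eisenstein n p ψ k j W s := funext fun W => eigenEis_eq k hi s W
  rw [e, Up_sum_mul, eigenvalue_eq (ψ := ψ), mul_assoc, ← sum_bCoeff_sum_mCoeff p ψ s hd,
    Finset.mul_sum]
  refine Finset.sum_congr rfl fun j hj => ?_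
  rw [h j hj]
  ring

theorem eisenstein_of_lt (k : ℤ) (r : ℕ) (Z : HalfSpace n) {s : ℂ} (hs : (n : ℝ) + 1 < 2 * s.re) :
    eisenstein n p ψ k r Z s = eisSeries n p ψ k r Z s := if_pos hs

theorem eisenstein_mem_autForms_of_lt (hψ2 : ψ ^ 2 = 1) {k : ℤ} (hk : ψ (-1) = (-1) ^ k) {r : ℕ}
    (hr : r ≤ n) {s : ℂ} (hs : (n : ℝ) + 1 < 2 * s.re) :
    (fun Z => eisenstein n p ψ k r Z s) ∈ autForms n p k ψ := by
  simp only [eisenstein_of_lt k r _ hs]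
  exact eisSeries_mem_autForms hψ2 hk hr s

theorem heckeIdentity_of_lt (hψ : ψ = 1 ∨ ψ = quadChar p) {k : ℤ}
    (hk : ψ (-1) = (-1) ^ k) {r : ℕ} (hr : r ≤ n) (Z : HalfSpace n) {s : ℂ}
    (hs : (n : ℝ) + 1 < 2 * s.re) : HeckeIdentity n p ψ k r Z s := by
  simp only [HeckeIdentity, eisenstein_of_lt k _ _ hs]
  exact Up_eisSeries hψ hk hr hs Z

end Eigenvector

/-! ### Extension to all s by the identity theorem. -/

section Continuation

open Filter Topology

/-- Identity theorem: the order of f - g is infinite at a point of the half plane, hence at every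
point since ℂ is connected. For meromorphic functions this yields agreement on punctured
neighbourhoods only. -/
theorem Meromorphic.eventually_eq_of_halfPlane {f g : ℂ → ℂ} (hf : Meromorphic f)
    (hg : Meromorphic g) (c : ℝ) (h : ∀ s : ℂ, c < 2 * s.re → f s = g s) (x : ℂ) :
    f =ᶠ[𝓝[≠] x] g := by
  have hsub : MeromorphicOn (f - g) Set.univ := fun y _ => (hf y).sub (hg y)
  by_contra hne
  have hx : meromorphicOrderAt (f - g) x ≠ ⊤ := by
    rw [Ne, meromorphicOrderAt_eq_top_iff]
    exact fun h0 => hne (h0.mono fun z hz => sub_eq_zero.1 hz)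
  have h1 := hsub.meromorphicOrderAt_ne_top_of_isPreconnected (y := ((c : ℂ) / 2 + 1))
    isPreconnected_univ (Set.mem_univ x) (Set.mem_univ _) hx
  refine h1 (meromorphicOrderAt_eq_top_iff.2 ?_)
  have hopen : IsOpen {s : ℂ | c < 2 * s.re} :=
    isOpen_lt continuous_const (continuous_const.mul Complex.continuous_re)
  have hmem : ((c : ℂ) / 2 + 1) ∈ {s : ℂ | c < 2 * s.re} := by
    have e : ((c : ℂ) / 2 + 1) = ((c / 2 + 1 : ℝ) : ℂ) := by push_cast; rfl
    rw [e, Set.mem_ofPred_eq, Complex.ofReal_re]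
    linarith
  refine nhdsWithin_le_nhds ?_
  filter_upwards [hopen.mem_nhds hmem] with z hz
  exact sub_eq_zero.2 (h z hz)

variable (p : ℕ) [hp : Fact p.Prime]

theorem differentiable_natCast_cpow {f : ℂ → ℂ} (hf : Differentiable ℂ f) :
    Differentiable ℂ fun s => (p : ℂ) ^ f s :=
  hf.const_cpow (Or.inl (by exact_mod_cast hp.out.ne_zero))

theorem differentiable_mCoeff {ψ : DirichletCharacter ℂ p} (hψ : ψ = 1 ∨ ψ = quadChar p)
    {i j : ℕ} (hij : i ≤ j) : Differentiable ℂ fun s => mCoeff p ψ s i j := by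
  simp only [mCoeff_eq p hψ _ hij]
  exact (differentiable_natCast_cpow p (by fun_prop)).mul_const _

variable {p} {n : ℕ} {ψ : DirichletCharacter ℂ p}

/-- The coefficients and the points do not depend on f. So U(p), applied to a family of functions at
fixed Z, preserves meromorphy and continuity in the parameter s. -/
theorem Up_eq_sum (k : ℤ) (Z : HalfSpace n) : ∃ (m : ℕ) (a : Fin m → ℂ) (W : Fin m → HalfSpace n),
    ∀ f, Up n p k ψ f Z = ∑ x, a x * f (W x) := by
  have : Finite (Quotient (heckeSetoid n p)) := Finite.of_equiv _ (heckeEquiv (n := n) (p := p))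
  have := Fintype.ofFinite (Quotient (heckeSetoid n p))
  let e := (Fintype.equivFin (Quotient (heckeSetoid n p))).symm
  let G : Quotient (heckeSetoid n p) → GSpPos n := fun q =>
    ofInt q.out.1 p (by exact_mod_cast (Fact.out : p.Prime).pos) (heckeSet_sim n p q.out.2)
  refine ⟨_, fun x => (p : ℂ) ^ ((n : ℂ) * k / 2 - (n : ℂ) * (n + 1) / 2) *
    (ψ (((e x).out.1.toBlocks₁₁.det : ℤ) : ZMod p) * autFactor (G (e x)) Z ^ (-k)),
    fun x => act (G (e x)) Z, fun f => ?_⟩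
  rw [Up, finsum_eq_sum_of_fintype, Finset.mul_sum, ← e.sum_comp]
  refine Finset.sum_congr rfl fun x _ => ?_
  simp only [slash, G]
  ring

theorem Up_zero (k : ℤ) (Z : HalfSpace n) : Up n p k ψ (fun _ => 0) Z = 0 := by
  obtain ⟨m, a, W, h⟩ := Up_eq_sum (ψ := ψ) k Z
  simp [h]

/-- The two alternatives are the branches in the definition of `eisenstein`. In the first, the
normal form of the chosen continuation differs from it only on a discrete set, so it is meromorphic;
in the second, the value outside the half plane is 0 by definition. -/
theorem meromorphic_eisenstein_or (k : ℤ) :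
    (∀ j ≤ n, ∀ Z : HalfSpace n, Meromorphic fun s => eisenstein n p ψ k j Z s) ∨
      ∀ j, ∀ Z : HalfSpace n, ∀ s : ℂ, ¬ (n : ℝ) + 1 < 2 * s.re → eisenstein n p ψ k j Z s = 0 := by
  by_cases h : ∃ F : ℕ → HalfSpace n → ℂ → ℂ, ∀ j ≤ n, ∀ W, Meromorphic (F j W) ∧
      ∀ t : ℂ, (n : ℝ) + 1 < 2 * t.re → F j W t = eisSeries n p ψ k j W t
  · refine Or.inl fun j hj Z x => ?_
    obtain ⟨h1, h2⟩ := h.choose_spec j hj Z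
    have h3 := MeromorphicOn.toMeromorphicNFOn_eq_self_on_nhdsNE
      (meromorphicOn_univ.2 h1) (Set.mem_univ x)
    refine (h1 x).congr (h3.mono fun t ht => ?_)
    change h.choose j Z t = eisenstein n p ψ k j Z t
    by_cases hlt : (n : ℝ) + 1 < 2 * t.re
    · rw [eisenstein_of_lt k j Z hlt, h2 t hlt]
    · rw [eisenstein, if_neg hlt, dif_pos h, ht]
  · exact Or.inr fun j Z s hs => by rw [eisenstein, if_neg hs, dif_neg h]

theorem MeromorphicAt.Up {k : ℤ} {f : HalfSpace n → ℂ → ℂ} {s : ℂ}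
    (hf : ∀ Z, MeromorphicAt (f Z) s) (Z : HalfSpace n) :
    MeromorphicAt (fun t => Up n p k ψ (fun W => f W t) Z) s := by
  obtain ⟨m, a, W, h⟩ := Up_eq_sum (ψ := ψ) k Z
  simp only [h]
  exact MeromorphicAt.fun_sum fun x _ => (MeromorphicAt.const _ _).mul (hf (W x))

theorem ContinuousAt.Up {k : ℤ} {f : HalfSpace n → ℂ → ℂ} {s : ℂ}
    (hf : ∀ Z, ContinuousAt (f Z) s) (Z : HalfSpace n) :
    ContinuousAt (fun t => Up n p k ψ (fun W => f W t) Z) s := by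
  obtain ⟨m, a, W, h⟩ := Up_eq_sum (ψ := ψ) k Z
  simp only [h]
  exact tendsto_finsetSum _ fun x _ => continuousAt_const.mul (hf (W x))

theorem eventually_heckeIdentity (hψ : ψ = 1 ∨ ψ = quadChar p) {k : ℤ} (hk : ψ (-1) = (-1) ^ k)
    (hm : ∀ j ≤ n, ∀ Z : HalfSpace n, Meromorphic fun s => eisenstein n p ψ k j Z s)
    {i : ℕ} (hi : i ≤ n) (Z : HalfSpace n) (s : ℂ) :
    ∀ᶠ t in 𝓝[≠] s, HeckeIdentity n p ψ k i Z t := by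
  refine Meromorphic.eventually_eq_of_halfPlane (fun x => MeromorphicAt.Up (fun W => hm i hi W x) Z)
    (fun x => ?_) (n + 1) (fun t ht => heckeIdentity_of_lt hψ hk hi Z ht) s
  refine MeromorphicAt.mul ?_ (MeromorphicAt.fun_sum fun j hj => MeromorphicAt.mul ?_ ?_)
  · exact ((differentiable_natCast_cpow p (by fun_prop)).analyticAt x).meromorphicAt
  · exact ((differentiable_mCoeff p hψ (Finset.mem_Icc.1 hj).1).analyticAt x).meromorphicAt
  · exact hm j (Finset.mem_Icc.1 hj).2 Z x

theorem eventually_denom_ne_one {i j : ℕ} (hij : i < j) (s : ℂ) :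
    ∀ᶠ t in 𝓝[≠] s, (p : ℂ) ^ (((j : ℂ) - i) * (2 * t - ((j : ℂ) + i + 1) / 2)) ≠ 1 := by
  have hd : Differentiable ℂ fun t =>
      (p : ℂ) ^ (((j : ℂ) - i) * (2 * t - ((j : ℂ) + i + 1) / 2)) - 1 :=
    (differentiable_natCast_cpow p (by fun_prop)).sub_const 1
  have hm : MeromorphicOn (fun t => (p : ℂ) ^ (((j : ℂ) - i) * (2 * t - ((j : ℂ) + i + 1) / 2)) - 1)
      Set.univ := fun x _ => (hd.analyticAt x).meromorphicAt
  -- At the point j + 1 the power has absolute value greater than 1, so the function is not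
  -- identically zero.
  have hy : meromorphicOrderAt
      (fun t => (p : ℂ) ^ (((j : ℂ) - i) * (2 * t - ((j : ℂ) + i + 1) / 2)) - 1)
      ((j + 1 : ℝ) : ℂ) ≠ ⊤ := by
    rw [meromorphicOrderAt_ne_top_iff_eventually_ne_zero (hm _ (Set.mem_univ _))]
    refine nhdsWithin_le_nhds ((hd.continuous.continuousAt).eventually_ne (sub_ne_zero.2 ?_))
    refine bCoeff_denom_ne_one p hij ?_
    rw [Complex.ofReal_re]
    have : (0 : ℝ) ≤ j := j.cast_nonneg
    linarith
  have hs := hm.meromorphicOrderAt_ne_top_of_isPreconnected (y := s)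
    isPreconnected_univ (Set.mem_univ _) (Set.mem_univ s) hy
  rw [meromorphicOrderAt_ne_top_iff_eventually_ne_zero (hm _ (Set.mem_univ _))] at hs
  exact hs.mono fun t ht => sub_ne_zero.1 ht

theorem eigenEis_eq_zero {k : ℤ}
    (h0 : ∀ j, ∀ Z : HalfSpace n, ∀ s : ℂ, ¬ (n : ℝ) + 1 < 2 * s.re → eisenstein n p ψ k j Z s = 0)
    {i : ℕ} {s : ℂ} (hs : ¬ (n : ℝ) + 1 < 2 * s.re) : eigenEis p n ψ k i s = fun _ => 0 := by
  funext Z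
  simp [eigenEis, h0 _ Z s hs]

theorem Up_eigenEis_of_lt (hψ : ψ = 1 ∨ ψ = quadChar p) {k : ℤ} (hk : ψ (-1) = (-1) ^ k)
    {i : ℕ} (hi : i ≤ n) {s : ℂ} (hs : (n : ℝ) + 1 < 2 * s.re) (Z : HalfSpace n) :
    Up n p k ψ (eigenEis p n ψ k i s) Z = eigenvalue p n k i s * eigenEis p n ψ k i s Z := by
  refine Up_eigenEis hi (fun j hj => heckeIdentity_of_lt hψ hk (Finset.mem_Icc.1 hj).2 Z hs)
    fun j hij hj => bCoeff_denom_ne_one p hij ?_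
  have : (j : ℝ) ≤ n := by exact_mod_cast hj
  linarith

/-- The eigenvalue equation as an identity of meromorphic functions. -/
theorem Up_eigenEis_codiscrete (hψ : ψ = 1 ∨ ψ = quadChar p) {k : ℤ} (hk : ψ (-1) = (-1) ^ k)
    {i : ℕ} (hi : i ≤ n) (Z : HalfSpace n) :
    (fun s => Up n p k ψ (eigenEis p n ψ k i s) Z) =ᶠ[codiscrete ℂ]
      fun s => eigenvalue p n k i s * eigenEis p n ψ k i s Z := by
  rcases meromorphic_eisenstein_or (n := n) (ψ := ψ) k with hm | h0
  · refine mem_codiscreteWithin_iff_forall_mem_nhdsNE.2 fun s _ => ?_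
    have h1 : ∀ᶠ t in 𝓝[≠] s, ∀ j ∈ Finset.Icc i n, HeckeIdentity n p ψ k j Z t :=
      (Finset.eventually_all _).2 fun j hj =>
        eventually_heckeIdentity hψ hk hm (Finset.mem_Icc.1 hj).2 Z s
    have h2 : ∀ᶠ t in 𝓝[≠] s, ∀ j ∈ Finset.Ioc i n,
        (p : ℂ) ^ (((j : ℂ) - i) * (2 * t - ((j : ℂ) + i + 1) / 2)) ≠ 1 :=
      (Finset.eventually_all _).2 fun j hj => eventually_denom_ne_one (Finset.mem_Ioc.1 hj).1 s
    filter_upwards [h1, h2] with t ht1 ht2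
    exact Or.inl (Up_eigenEis hi ht1 fun j hij hj => ht2 j (Finset.mem_Ioc.2 ⟨hij, hj⟩))
  · refine Eventually.of_forall fun s => ?_
    by_cases hs : (n : ℝ) + 1 < 2 * s.re
    · exact Up_eigenEis_of_lt hψ hk hi hs Z
    · change Up n p k ψ (eigenEis p n ψ k i s) Z = eigenvalue p n k i s * eigenEis p n ψ k i s Z
      rw [eigenEis_eq_zero h0 hs, Up_zero, mul_zero]

/-- The identity theorem gives the transformation law on a punctured neighbourhood of s; both sides
are continuous at s, so it holds at s itself. -/
theorem eisenstein_mem_autForms_of_analyticAt (hψ2 : ψ ^ 2 = 1) {k : ℤ} (hk : ψ (-1) = (-1) ^ k)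
    (hm : ∀ j ≤ n, ∀ Z : HalfSpace n, Meromorphic fun s => eisenstein n p ψ k j Z s)
    {r : ℕ} (hr : r ≤ n) {s : ℂ}
    (ha : ∀ Z : HalfSpace n, AnalyticAt ℂ (fun t => eisenstein n p ψ k r Z t) s) :
    (fun Z => eisenstein n p ψ k r Z s) ∈ autForms n p k ψ := by
  intro κ hκ
  funext Z
  have h1 : (fun t => slash k (fun W => eisenstein n p ψ k r W t) κ.toGSp Z) =ᶠ[𝓝[≠] s]
      fun t => charD ψ κ * eisenstein n p ψ k r Z t := by
    refine Meromorphic.eventually_eq_of_halfPlane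
      (fun x => (MeromorphicAt.const _ _).mul (hm r hr _ x))
      (fun x => (MeromorphicAt.const _ _).mul (hm r hr Z x)) (n + 1) (fun t ht => ?_) s
    exact congrFun (eisenstein_mem_autForms_of_lt hψ2 hk hr ht κ hκ) Z
  have h2 := (ContinuousAt.eventuallyEq_nhds_iff_eventuallyEq_nhdsNE
    (continuousAt_const.mul (ha _).continuousAt) (continuousAt_const.mul (ha Z).continuousAt)).1 h1
  exact h2.eq_of_nhds

theorem heckeIdentity_of_analyticAt (hψ : ψ = 1 ∨ ψ = quadChar p) {k : ℤ} (hk : ψ (-1) = (-1) ^ k)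
    (hm : ∀ j ≤ n, ∀ Z : HalfSpace n, Meromorphic fun s => eisenstein n p ψ k j Z s)
    {i : ℕ} (hi : i ≤ n) {s : ℂ} (ha : ∀ j, i ≤ j → j ≤ n → ∀ Z : HalfSpace n,
      AnalyticAt ℂ (fun t => eisenstein n p ψ k j Z t) s) (Z : HalfSpace n) :
    HeckeIdentity n p ψ k i Z s := by
  have h := eventually_heckeIdentity hψ hk hm hi Z s
  refine Filter.EventuallyEq.eq_of_nhds
    ((ContinuousAt.eventuallyEq_nhds_iff_eventuallyEq_nhdsNE ?_ ?_).1 h)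
  · exact ContinuousAt.Up (fun W => (ha i le_rfl hi W).continuousAt) Z
  · refine ContinuousAt.mul ?_ (tendsto_finsetSum _ fun j hj => ContinuousAt.mul ?_ ?_)
    · exact (differentiable_natCast_cpow p (by fun_prop)).continuous.continuousAt
    · exact (differentiable_mCoeff p hψ (Finset.mem_Icc.1 hj).1).continuous.continuousAt
    · exact (ha j (Finset.mem_Icc.1 hj).1 (Finset.mem_Icc.1 hj).2 Z).continuousAt

theorem quadratic_sq (hψ : ψ = 1 ∨ ψ = quadChar p) : ψ ^ 2 = 1 := by
  rcases hψ with rfl | rfl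
  · exact one_pow 2
  · exact quadChar_sq p

/-- The eigenvalue equation at a point of holomorphy. -/
theorem eigenEis_of_analyticAt (hψ : ψ = 1 ∨ ψ = quadChar p) {k : ℤ} (hk : ψ (-1) = (-1) ^ k)
    {i : ℕ} (hi : i ≤ n) {s : ℂ} (ha : ∀ j, i ≤ j → j ≤ n → ∀ Z : HalfSpace n,
      AnalyticAt ℂ (fun t => eisenstein n p ψ k j Z t) s)
    (hd : ∀ j : ℕ, i < j → j ≤ n →
      (p : ℂ) ^ (((j : ℂ) - i) * (2 * s - ((j : ℂ) + i + 1) / 2)) ≠ 1) :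
    eigenEis p n ψ k i s ∈ autForms n p k ψ ∧
      Up n p k ψ (eigenEis p n ψ k i s) = eigenvalue p n k i s • eigenEis p n ψ k i s := by
  have hψ2 := quadratic_sq hψ
  rcases meromorphic_eisenstein_or (n := n) (ψ := ψ) k with hm | h0
  · refine ⟨eigenEis_mem_autForms hi fun j hj => ?_, funext fun Z => Up_eigenEis hi (fun j hj => ?_) hd⟩
    · rw [Finset.mem_Icc] at hj
      exact eisenstein_mem_autForms_of_analyticAt hψ2 hk hm hj.2 (ha j hj.1 hj.2)
    · rw [Finset.mem_Icc] at hj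
      exact heckeIdentity_of_analyticAt hψ hk hm hj.2 (fun l hl => ha l (hj.1.trans hl)) Z
  by_cases hs : (n : ℝ) + 1 < 2 * s.re
  · exact ⟨eigenEis_mem_autForms hi fun j hj =>
      eisenstein_mem_autForms_of_lt hψ2 hk (Finset.mem_Icc.1 hj).2 hs,
      funext fun Z => Up_eigenEis_of_lt hψ hk hi hs Z⟩
  -- Without a continuation every series has the value 0 here, and the assertion is trivial.
  · rw [eigenEis_eq_zero h0 hs]
    refine ⟨zero_mem _, funext fun Z => ?_⟩
    rw [Up_zero, Pi.smul_apply, smul_zero]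

end Continuation

/-! ### Nonvanishing through the constant term at the cusp w_i. -/

section Nonvanishing

open Filter Topology
open scoped ComplexOrder

variable {n p : ℕ} [hp : Fact p.Prime] {ψ : DirichletCharacter ℂ p}

/-- At Z = i one has M - M* = -2i M M*. If tr M = 0, then tr(M M*) = 0, so M = 0 and C = 0. -/
theorem trace_denInvC_ne_zero {g : SpZ n} (hg : g ∉ parabolic n) :
    (denInvC g (imPoint n 1 one_pos)).trace ≠ 0 := by
  intro h0
  have h1 := congrArg trace (denInvC_sub_conjTranspose g (imPoint n 1 one_pos))
  have hY : (imPoint n 1 one_pos).imag.map Complex.ofReal = 1 := by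
    rw [imPoint_imag]
    ext a b
    by_cases hab : a = b <;> simp [hab, Matrix.one_apply]
  rw [hY, Matrix.mul_one, trace_sub, trace_conjTranspose, h0, star_zero, sub_zero, trace_smul,
    smul_eq_mul, eq_comm, mul_eq_zero] at h1
  have h2 := trace_mul_conjTranspose_self_eq_zero_iff.1 (h1.resolve_left (by simp))
  have h3 : bC ℂ g = 0 := by
    have := congrArg (fun M => (bC ℂ g * (imPoint n 1 one_pos).1 + bD ℂ g) * M) h2
    simpa only [denInvC, ← Matrix.mul_assoc, mul_nonsing_inv _ (isUnit_det_den g _), Matrix.one_mul,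
      Matrix.mul_zero] using this
  refine hg ((mem_parabolic g).2 ?_)
  ext a b
  have := congrFun (congrFun h3 a) b
  simpa [bC] using this

/-- On the points i(m + 1) the automorphy factor is j(g, i) P(-im), where P is the reverse
characteristic polynomial of M. Its linear coefficient -tr M is nonzero, so P is not constant. -/
theorem tendsto_norm_autFactor {g : SpZ n} (hg : g ∉ parabolic n) :
    Tendsto (fun m : ℕ => ‖autFactor g.toGSp (imPoint n ((m : ℝ) + 1) (by positivity))‖)
      atTop atTop := by
  set M := denInvC g (imPoint n 1 one_pos) with hM
  set P := M.charpolyRev with hP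
  have hdeg : 0 < P.degree := by
    by_contra hle
    have h0 := Polynomial.coeff_eq_zero_of_degree_lt (p := P) (n := 1)
      ((not_lt.1 hle).trans_lt (by norm_num))
    rw [hP, coeff_charpolyRev_eq_neg_trace, neg_eq_zero] at h0
    exact trace_denInvC_ne_zero hg h0
  have hev : ∀ m : ℕ, autFactor g.toGSp (imPoint n ((m : ℝ) + 1) (by positivity)) =
      autFactor g.toGSp (imPoint n 1 one_pos) * P.eval (-((m : ℂ) * Complex.I)) := by
    intro m
    rw [autFactor_toGSp, autFactor_ratio g (imPoint n 1 one_pos), ← hM]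
    congr 1
    rw [hP, charpolyRev, ← Polynomial.coe_evalRingHom, RingHom.map_det, RingHom.mapMatrix_apply]
    congr 1
    have e : (imPoint n ((m : ℝ) + 1) (by positivity)).1 - (imPoint n 1 one_pos).1 =
        ((m : ℂ) * Complex.I) • (1 : Matrix (Fin n) (Fin n) ℂ) := by
      simp only [imPoint, ← sub_smul]
      congr 1
      push_cast
      ring
    rw [e, Matrix.mul_smul, Matrix.mul_one]
    ext a b
    by_cases hab : a = b <;> simp [hab, mul_comm (M _ _)]
  have hz : Tendsto (fun m : ℕ => ‖-((m : ℂ) * Complex.I)‖) atTop atTop := by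
    simpa using tendsto_natCast_atTop_atTop (R := ℝ)
  have h := P.tendsto_norm_atTop hdeg hz
  simp only [hev, norm_mul]
  exact h.const_mul_atTop (norm_pos_iff.2 (autFactor_ne_zero _ _))

/-- The lower bound m + 1 of the imaginary part also bounds the distance to i, so the comparison
constant is independent of m and g. This provides the majorant for dominated convergence. -/
theorem norm_autFactor_imPoint_le (g : SpZ n) (m : ℕ) :
    ‖autFactor g.toGSp (imPoint n 1 one_pos)‖ ≤ n.factorial * (1 + n) ^ n *
      ‖autFactor g.toGSp (imPoint n ((m : ℝ) + 1) (by positivity))‖ := by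
  have hpos : (0 : ℝ) < (m : ℝ) + 1 := by positivity
  have h := norm_autFactor_le hpos (imLower_imPoint _ hpos) (imPoint n 1 one_pos) (B := (m : ℝ) + 1)
    (fun a b => ?_) g
  · rwa [inv_mul_cancel₀ hpos.ne', mul_one] at h
  · simp only [imPoint, ← sub_smul, Matrix.smul_apply, smul_eq_mul, norm_mul, ← sub_mul]
    have h1 : ‖((1 : ℝ) : ℂ) - (((m : ℝ) + 1 : ℝ) : ℂ)‖ = m := by
      rw [← Complex.ofReal_sub, Complex.norm_real, Real.norm_eq_abs]
      simp
    have h2 : ‖(1 : Matrix (Fin n) (Fin n) ℂ) a b‖ ≤ 1 := by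
      rw [Matrix.one_apply]
      split_ifs <;> simp
    rw [h1, Complex.norm_I, mul_one]
    have h3 : (0 : ℝ) ≤ m := m.cast_nonneg
    nlinarith

theorem tendsto_wt_autFactor {k : ℤ} {s : ℂ} (hs : 0 < s.re) {g : SpZ n} (hg : g ∉ parabolic n) :
    Tendsto (fun m : ℕ => wt k s (autFactor g.toGSp (imPoint n ((m : ℝ) + 1) (by positivity))))
      atTop (𝓝 0) := by
  rw [tendsto_zero_iff_norm_tendsto_zero]
  simp only [norm_wt _ _ (autFactor_ne_zero _ _), neg_mul]
  exact (tendsto_rpow_neg_atTop (by linarith : 0 < 2 * s.re)).comp (tendsto_norm_autFactor hg)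

theorem norm_wt_autFactor_le (k : ℤ) {s : ℂ} (hs : 0 < s.re) (g : SpZ n) (m : ℕ) :
    ‖wt k s (autFactor g.toGSp (imPoint n ((m : ℝ) + 1) (by positivity)))‖ ≤
      (n.factorial * (1 + n) ^ n : ℝ) ^ (2 * s.re) *
        ‖autFactor g.toGSp (imPoint n 1 one_pos)‖ ^ (-2 * s.re) := by
  have h0 : ∀ y hy, 0 < ‖autFactor g.toGSp (imPoint n y hy)‖ := fun y hy =>
    norm_pos_iff.2 (autFactor_ne_zero _ _)
  have hK : (0 : ℝ) < n.factorial * (1 + n) ^ n := by positivity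
  have h1 := Real.rpow_le_rpow_of_nonpos (h0 _ _) (norm_autFactor_imPoint_le g m)
    (by linarith : -2 * s.re ≤ 0)
  rw [Real.mul_rpow hK.le (norm_nonneg _)] at h1
  rw [norm_wt _ _ (autFactor_ne_zero _ _)]
  have h2 := mul_le_mul_of_nonneg_left h1 (Real.rpow_nonneg hK.le (2 * s.re))
  rwa [← mul_assoc, ← Real.rpow_add hK, neg_mul, add_neg_cancel, Real.rpow_zero, one_mul,
    ← neg_mul] at h2

theorem autFactor_of_parabolic {η : SpZ n} (hη : η ∈ parabolic n) (Z : HalfSpace n) :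
    autFactor η.toGSp Z = ((bD ℤ η).det : ℂ) := by
  rw [autFactor_toGSp, bC_of_parabolic ℂ hη, Matrix.zero_mul, zero_add, det_map_bD]

theorem chi_mul_w_of_ne {η : SpZ n} (hη : η ∈ parabolic n) {i j : ℕ} (hi : i ≤ n) (hij : i ≠ j) :
    chi p ψ j (η * w n i) = 0 := by
  have h := NF_of_decomp (p := p) (r := i) hη (one_mem (Gamma0 n p))
  rw [mul_one] at h
  exact pairChar_of_ne h (by rwa [card_headSet hi])

theorem chi_mul_w_ne_zero (hψ2 : ψ ^ 2 = 1) {η : SpZ n} (hη : η ∈ parabolic n) {i : ℕ} (hi : i ≤ n) :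
    chi p ψ i (η * w n i) ≠ 0 := by
  have h := NF_of_decomp (p := p) (r := i) hη (one_mem (Gamma0 n p))
  rw [mul_one] at h
  rw [chi, pairChar_eq hψ2 h (card_headSet hi)]
  have h1 := (h.hU.map ψ).ne_zero
  have h2 : bD (ZMod p) (1 : SpZ n) = 1 := (blocks_one (ZMod p)).2.2.2
  rw [h2, det_one, map_one, mul_one]
  exact h1

theorem act_toGSp_one (Z : HalfSpace n) : act (1 : SpZ n).toGSp Z = Z := by
  obtain ⟨h1, h2, h3, h4⟩ := toGSp_blocks (1 : SpZ n)
  obtain ⟨b1, b2, b3, b4⟩ := blocks_one (n := n) ℂ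
  refine HalfSpace.ext ?_
  simp [act, GSpPos.num, GSpPos.den, h1, h2, h3, h4, b1, b2, b3, b4]

open Classical in
/-- The Eisenstein series `E^{n,(i)}` does not vanish identically. -/
theorem eigenEis_ne_zero (hψ2 : ψ ^ 2 = 1) {k : ℤ} (hk : ψ (-1) = (-1) ^ k) {i : ℕ} (hi : i ≤ n)
    {s : ℂ} (hs : (n : ℝ) + 1 < 2 * s.re) : eigenEis p n ψ k i s ≠ 0 := by
  intro h0
  have hs0 : 0 < s.re := by
    have : (0 : ℝ) ≤ n := n.cast_nonneg
    linarith
  -- c is the combined character after right translation by w_i, which moves the cusp w_i to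
  -- infinity.
  let c : PCoset n → ℂ := fun q =>
    ∑ j ∈ Finset.Icc i n, bCoeff p ψ s i j * chi p ψ j (q.out * w n i)
  let Y : ℕ → HalfSpace n := fun m => imPoint n ((m : ℝ) + 1) (by positivity)
  let f : ℕ → PCoset n → ℂ := fun m q => c q * wt k s (autFactor q.out.toGSp (Y m))
  have hzero : ∀ m, ∑' q, f m q = 0 := by
    intro m
    -- The vanishing function is evaluated at w_i⁻¹⟨Y m⟩ and the cosets are reindexed by q ↦ q w_i;
    -- the common factor is nonzero and cancels.
    set W := act (w n i)⁻¹.toGSp (Y m) with hW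
    have hact : act (w n i).toGSp W = Y m := by
      rw [hW, ← act_mul (g₃ := (1 : SpZ n).toGSp) (by rw [← (toGSp_mul _ _).1, mul_inv_cancel])]
      exact act_toGSp_one _
    have hA : ((W.imag.det : ℝ) : ℂ) ^ (s - k / 2) * wt k s (autFactor (w n i).toGSp W) ≠ 0 := by
      refine mul_ne_zero (fun h => ?_) (wt_ne_zero _ _ (autFactor_ne_zero _ _))
      have hd : ((W.imag.det : ℝ) : ℂ) ≠ 0 := by exact_mod_cast W.det_imag_pos.ne'
      exact hd ((Complex.cpow_eq_zero_iff _ _).1 h).1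
    have hE : ∀ j ∈ Finset.Icc i n, eisenstein n p ψ k j W s =
        ((W.imag.det : ℝ) : ℂ) ^ (s - k / 2) * wt k s (autFactor (w n i).toGSp W) *
          ∑' q : PCoset n, chi p ψ j (q.out * w n i) * wt k s (autFactor q.out.toGSp (Y m)) := by
      intro j hj
      rw [eisenstein_of_lt k j W hs, eisSeries_eq hψ2 k (Finset.mem_Icc.1 hj).2,
        ← tsum_mul_right_coset (eisFun_leftInv hψ2 hk j W s) (w n i), mul_assoc,
        ← tsum_mul_left (a := wt k s (autFactor (w n i).toGSp W))]
      congr 1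
      refine tsum_congr fun q => ?_
      rw [eisFun_mul, hact]
      ring
    have hsum : ∀ j, Summable fun q : PCoset n =>
        chi p ψ j (q.out * w n i) * wt k s (autFactor q.out.toGSp (Y m)) := fun j =>
      Summable.of_norm_bounded (summable_norm_autFactor hs (Y m)) fun q => by
        rw [norm_mul, norm_wt _ _ (autFactor_ne_zero _ _)]
        exact mul_le_of_le_one_left (Real.rpow_nonneg (norm_nonneg _) _) (norm_chi_le hψ2 _ _)
    have h1 := congrFun h0 W
    rw [eigenEis_eq k hi, Finset.sum_congr rfl fun j hj => by rw [hE j hj, mul_left_comm],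
      ← Finset.mul_sum, Pi.zero_apply] at h1
    have h2 := (mul_eq_zero.1 h1).resolve_left hA
    simp only [← tsum_mul_left] at h2
    rw [← Summable.tsum_finsetSum fun j _ => (hsum j).mul_left _] at h2
    rw [← h2]
    refine tsum_congr fun q => ?_
    simp only [f, c, Finset.sum_mul, mul_assoc]
  set q₀ : PCoset n := Quotient.mk _ 1 with hq₀
  have hmem : ∀ q : PCoset n, q.out ∈ parabolic n ↔ q = q₀ := by
    intro q
    rw [← Quotient.out_eq q, hq₀, eq_comm, coset_eq_iff, Quotient.out_eq]
    simp
  -- Terms outside P tend to 0 as the imaginary part grows, and those in P are constant, so only the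
  -- trivial coset is left in the limit.
  have hlim : Tendsto (fun m => ∑' q, f m q) atTop
      (𝓝 (∑' q, if q = q₀ then c q * wt k s ((bD ℤ q.out).det : ℂ) else 0)) := by
    refine tendsto_tsum_of_dominated_convergence
      (bound := fun q => (∑ j ∈ Finset.Icc i n, ‖bCoeff p ψ s i j‖) *
        ((n.factorial * (1 + n) ^ n : ℝ) ^ (2 * s.re) *
          ‖autFactor q.out.toGSp (imPoint n 1 one_pos)‖ ^ (-2 * s.re)))
      (((summable_norm_autFactor hs _).mul_left _).mul_left _) (fun q => ?_)
      (Eventually.of_forall fun m q => ?_)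
    · split_ifs with hq
      · simp only [f, autFactor_of_parabolic ((hmem q).2 hq)]
        exact tendsto_const_nhds
      · have := (tendsto_wt_autFactor (k := k) hs0 (fun h => hq ((hmem q).1 h))).const_mul (c q)
        rwa [mul_zero] at this
    · rw [norm_mul]
      refine mul_le_mul ((norm_sum_le _ _).trans (Finset.sum_le_sum fun j _ => ?_))
        (norm_wt_autFactor_le k hs0 _ m) (norm_nonneg _)
        (Finset.sum_nonneg fun j _ => norm_nonneg _)
      rw [norm_mul]
      exact mul_le_of_le_one_right (norm_nonneg _) (norm_chi_le hψ2 _ _)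
  rw [tsum_ite_eq] at hlim
  simp only [hzero] at hlim
  have h3 := tendsto_nhds_unique hlim tendsto_const_nhds
  have hη := (hmem q₀).2 rfl
  -- P w_i lies in the i-th cell only, so every character with j ≠ i vanishes there and b_ii = 1
  -- alone enters.
  have hc : c q₀ = chi p ψ i (q₀.out * w n i) := by
    simp only [c]
    rw [Finset.sum_eq_single i, bCoeff_self, one_mul]
    · intro j _ hj
      rw [chi_mul_w_of_ne hη hi hj.symm, mul_zero]
    · intro h
      exact absurd (Finset.mem_Icc.2 ⟨le_rfl, hi⟩) h
  rw [hc] at h3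
  refine mul_ne_zero (chi_mul_w_ne_zero hψ2 hη hi) (wt_ne_zero _ _ ?_) h3
  rcases det_bD_of_parabolic hη with h | h <;> simp [h]

end Nonvanishing

end SiegelEis

end

/-! ### Assembly of the three assertions. -/

theorem mainTheorem6 (n p : ℕ) [Fact p.Prime] (hn : 1 ≤ n) (hp : p ≠ 2)
    (ψ : DirichletCharacter ℂ p) (hψ : ψ = 1 ∨ ψ = SiegelEis.quadChar p)
    (k : ℤ) (hk : ψ (-1) = (-1) ^ k) (i : ℕ) (hi : i ≤ n) :
    (∀ s : ℂ, (n : ℝ) + 1 < 2 * s.re →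
      (∀ j ≤ n, ∀ Z : SiegelEis.HalfSpace n,
        Summable fun q : SiegelEis.cellCosets n p j =>
          SiegelEis.eisTerm n p ψ k j Z s q.1.out) ∧
      SiegelEis.eigenEis p n ψ k i s ∈ SiegelEis.autForms n p k ψ ∧
      SiegelEis.eigenEis p n ψ k i s ≠ 0 ∧
      SiegelEis.Up n p k ψ (SiegelEis.eigenEis p n ψ k i s) =
        SiegelEis.eigenvalue p n k i s • SiegelEis.eigenEis p n ψ k i s) ∧
    (∀ s : ℂ,
      (∀ j, i ≤ j → j ≤ n → ∀ Z : SiegelEis.HalfSpace n,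
        AnalyticAt ℂ (fun t => SiegelEis.eisenstein n p ψ k j Z t) s) →
      (∀ j : ℕ, i < j → j ≤ n →
        (p : ℂ) ^ (((j : ℂ) - i) * (2 * s - ((j : ℂ) + i + 1) / 2)) ≠ 1) →
      SiegelEis.eigenEis p n ψ k i s ∈ SiegelEis.autForms n p k ψ ∧
      SiegelEis.Up n p k ψ (SiegelEis.eigenEis p n ψ k i s) =
        SiegelEis.eigenvalue p n k i s • SiegelEis.eigenEis p n ψ k i s) ∧
    ∀ Z : SiegelEis.HalfSpace n,
      (fun s => SiegelEis.Up n p k ψ (SiegelEis.eigenEis p n ψ k i s) Z) =ᶠ[Filter.codiscrete ℂ]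
        fun s => SiegelEis.eigenvalue p n k i s * SiegelEis.eigenEis p n ψ k i s Z := by
  have hψ2 := SiegelEis.quadratic_sq hψ
  refine ⟨fun s hs => ⟨fun j hj Z => SiegelEis.summable_eisTerm hψ2 k hj Z hs, ?_,
    SiegelEis.eigenEis_ne_zero hψ2 hk hi hs, funext fun Z => SiegelEis.Up_eigenEis_of_lt hψ hk hi hs Z⟩,
    fun s ha hd => SiegelEis.eigenEis_of_analyticAt hψ hk hi ha hd,
    SiegelEis.Up_eigenEis_codiscrete hψ hk hi⟩
  exact SiegelEis.eigenEis_mem_autForms hi fun j hj =>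
    SiegelEis.eisenstein_mem_autForms_of_lt hψ2 hk (Finset.mem_Icc.1 hj).2 hs
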